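/- Let $p_Z$ be a probability density function on $\mathbb{R}$ such that, for some $\zeta\in(0,1)$, $$\int_{\mathbb R} p_Z(\ln p_Z)^4\,dz<\infty,\qquad \int_{\mathbb R} p_Z^{\zeta}\,dz<\infty,\qquad \int_{\mathbb R} p_Z^{\zeta}(\ln p_Z)^4\,dz<\infty$$ (the integrands being $0$ where $p_Z=0$). Assume moreover that 1. $p_Z$ is bounded; 2. $z\mapsto p_Z(z)\ln p_Z(z)$ is uniformly continuous on $\{z: p_Z(z)>0\}$; 3. there is $\xi\in(0,1)$ such that for every $\gamma\in[0,\xi)$ there is a random variable $X$, independent of $Z\sim p_Z$, for which $X+Z$ has the density $\alpha\,p_Z^{1-\gamma}$ with $\alpha=\bigl(\int_{\mathbb R} p_Z^{1-\gamma}\,dz\bigr)^{-1}$. Consider the memoryless channel $Y_i=X_i+Z_i$, with $Z_1,Z_2,\dots$ i.i.d. with density $p_Z$. A code of length $n$ consists of finite nonempty sets $\mathcal M$ (messages) and $\mathcal K$ (keys), an encoder $f\colon\mathcal M\times\mathcal K\to\mathbb R^n$ and a decoder $g\colon\mathbb R^n\times\mathcal K\to\mathcal M$. The message and the key are uniform,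 independent of each other and of the noise; $Y^n=f(m,k)+Z^n$; the average error probability is the probability that $g(Y^n,k)\ne m$. Fix $\Delta>0$. A code is called covert if $D(P_{Y^n}\|P_{Z^n})\le\Delta$, where $D$ is the Kullback–Leibler divergence in nats and $P_{Y^n}$ is averaged over message and key. Let $A_n(\Delta,\epsilon)$ be the supremum of $\ln|\mathcal M|$ over all covert codes of length $n$ (with keys of any length) whose average error probability is at most $\epsilon$, and let $$L=\lim_{\epsilon\downarrow0}\liminf_{n\to\infty}\frac{A_n(\Delta,\epsilon)}{\sqrt{n\Delta}}.$$ Then $L=\sqrt2\,\sqrt{\mathrm{Var}[\ln p_Z(Z)]}$, and there is a sequence of codes $\mathcal C_n$ of length $n=0,1,2,\dots$, with message sets $\mathcal M_n$ and key sets $\mathcal K_n$, such that every $\mathcal C_n$ is covert, the average error probability of $\mathcal C_n$ tends to $0$, $$\lim_{n\to\infty}\frac{\ln|\mathcal M_n|}{\sqrt{n\Delta}}=L,\qquad\text{and}\qquad \ln|\mathcal K_n|=O(n).$$ -/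

import Mathlib

open MeasureTheory ProbabilityTheory Filter Topology
open scoped ENNReal

noncomputable section

namespace CovertChannel

/-- `p` is a probability density function on the real line: nonnegative, Lebesgue-measurable
(contained in `Integrable`) and of total integral one. -/
structure IsPDF (p : ℝ → ℝ) : Prop where
  nonneg : ∀ z, 0 ≤ p z
  integrable : Integrable p
  integral_eq_one : ∫ z, p z = 1

/-- The law `P_Z` on `ℝ` with density `p`. -/
def noiseLaw (p : ℝ → ℝ) : Measure ℝ :=
  volume.withDensity fun z => ENNReal.ofReal (p z)

instance (p : ℝ → ℝ) : SigmaFinite (noiseLaw p) := by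
  unfold noiseLaw; infer_instance

/-- The law `P_{Z^n}` of `n` i.i.d. noise variables with density `p`. -/
def noiseLawN (p : ℝ → ℝ) (n : ℕ) : Measure (Fin n → ℝ) :=
  Measure.pi fun _ => noiseLaw p

/-- The integrability conditions on the noise density. The integrands are nonnegative and
vanish where `p` does. -/
def IntegrabilityConditions (p : ℝ → ℝ) : Prop :=
  ∃ ζ : ℝ, 0 < ζ ∧ ζ < 1 ∧
    Integrable (fun z => p z * Real.log (p z) ^ 4) ∧
    Integrable (fun z => p z ^ ζ) ∧
    Integrable (fun z => p z ^ ζ * Real.log (p z) ^ 4)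

/-- The tilted density `α p ^ (1 - γ)` with `α = (∫ p ^ (1 - γ))⁻¹`. -/
def tiltedDensity (p : ℝ → ℝ) (γ : ℝ) (z : ℝ) : ℝ :=
  (∫ t, p t ^ (1 - γ))⁻¹ * p z ^ (1 - γ)

/-- The three further assumptions on the noise density. -/
structure NoiseAssumption (p : ℝ → ℝ) : Prop where
  bounded : ∃ b : ℝ, 0 < b ∧ ∀ z, p z ≤ b
  uniformContinuousOn :
    UniformContinuousOn (fun z => p z * Real.log (p z)) (Function.support p)
  /-- For every `γ ∈ [0, ξ)` some law `P_X` on `ℝ` is such that `X + Z`, for independent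
  `X ∼ P_X` and `Z ∼ P_Z`, has the tilted density. The law of that sum is the convolution. -/
  decomposable : ∃ ξ : ℝ, 0 < ξ ∧ ξ < 1 ∧ ∀ γ : ℝ, 0 ≤ γ → γ < ξ →
    ∃ PX : Measure ℝ, IsProbabilityMeasure PX ∧
      PX.conv (noiseLaw p) = volume.withDensity fun z => ENNReal.ofReal (tiltedDensity p γ z)

/-- A code of length `n`: finite nonempty message and key sets, an encoder, and a decoder that
also knows the key. -/
structure Code (n : ℕ) where
  /-- The number `|M|` of messages. -/
  numMsg : ℕ
  /-- The number `|K|` of keys. -/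
  numKey : ℕ
  numMsg_pos : 0 < numMsg
  numKey_pos : 0 < numKey
  /-- The encoder. -/
  enc : Fin numMsg → Fin numKey → Fin n → ℝ
  /-- The decoder. -/
  dec : (Fin n → ℝ) → Fin numKey → Fin numMsg
  measurable_dec : ∀ k, Measurable fun y => dec y k

namespace Code

variable {n : ℕ} (C : Code n)

/-- The law `P_{Y^n}` of the output `Y^n = f(m,k) + Z^n`, averaged over the uniform message and
the uniform key. -/
def outputLaw (p : ℝ → ℝ) : Measure (Fin n → ℝ) :=
  ((C.numMsg : ℝ≥0∞) * (C.numKey : ℝ≥0∞))⁻¹ •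
    ∑ m, ∑ k, (noiseLawN p n).map fun z => C.enc m k + z

/-- The covertness condition `D(P_{Y^n} ‖ P_{Z^n}) ≤ Δ`, in nats. -/
def IsCovert (p : ℝ → ℝ) (Δ : ℝ) : Prop :=
  InformationTheory.klDiv (C.outputLaw p) (noiseLawN p n) ≤ ENNReal.ofReal Δ

/-- The probability of decoding error, averaged over the uniform message and the uniform key. -/
def avgError (p : ℝ → ℝ) : ℝ :=
  ((C.numMsg : ℝ) * (C.numKey : ℝ))⁻¹ *
    ∑ m, ∑ k, (noiseLawN p n).real {z | C.dec (C.enc m k + z) k ≠ m}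

end Code

/-- `A_n(Δ, ε)`: the largest `ln |M|` over all codes of length `n`, with keys of any length, that
are covert and have average error at most `ε`; a supremum in `[0, ∞]`. -/
def maxLogMsg (p : ℝ → ℝ) (n : ℕ) (Δ ε : ℝ) : ℝ≥0∞ :=
  ⨆ (C : Code n) (_ : C.IsCovert p Δ ∧ C.avgError p ≤ ε), ENNReal.ofReal (Real.log C.numMsg)

/-- `L = lim_{ε ↓ 0} liminf_{n → ∞} A_n(Δ, ε) / √(n Δ)`. -/
def IsScalingConstant (p : ℝ → ℝ) (Δ L : ℝ) : Prop :=
  0 ≤ L ∧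
  Tendsto
    (fun ε : ℝ =>
      liminf (fun n : ℕ => maxLogMsg p n Δ ε / ENNReal.ofReal (Real.sqrt (n * Δ))) atTop)
    (𝓝[>] 0) (𝓝 (ENNReal.ofReal L))

end CovertChannel

end

/-
Let `φ` be the cumulant generating function of `-ln p_Z(Z)`, so that `φ''(0) = Var[ln p_Z(Z)] = V`.

Converse. The mutual information over the channel is at most the cross entropy of the output
relative to the noise density, minus the noise entropy and the output divergence. By
Donsker–Varadhan, covertness bounds that cross entropy by `(Δ + n φ(γ)) / γ` for every tilt
`γ > 0`, hence by the entropy plus `Δ / γ + n γ V / 2` to leading order. The choice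
`γ = √(2 Δ / (n V))` gives `√(2 n Δ V)`, and Fano's inequality turns this into a bound on `ln |M|`.

Achievability. Draw the codewords from a law for which the output has the tilted density
`α p_Z ^ (1 - γ)`, with `γ` just below that value. The divergence of the tilted law from the noise
is about `n γ² V / 2 < Δ`, and a key of linear length brings the code's output law close to it by
soft covering. The mutual information is about `n γ V`, and the information density has a variance
that vanishes with `γ`, so threshold decoding recovers almost that many nats.
-/

noncomputable section

open InformationTheory

namespace CovertChannel

section ProductMeasures

variable {ι : Type*} [Fintype ι]

lemma pi_withDensity_ofReal {X : ι → Type*} [∀ i, MeasurableSpace (X i)]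
    {μ : ∀ i, Measure (X i)} [∀ i, SigmaFinite (μ i)] {f : ∀ i, X i → ℝ} (hf0 : ∀ i z, 0 ≤ f i z)
    (hfi : ∀ i, Integrable (f i) (μ i)) :
    Measure.pi (fun i => (μ i).withDensity fun z => ENNReal.ofReal (f i z)) =
      (Measure.pi μ).withDensity fun y => ENNReal.ofReal (∏ i, f i (y i)) := by
  have := fun i => isFiniteMeasure_withDensity_ofReal (hfi i).2
  refine Measure.pi_eq fun s hs => ?_
  have hind : ∀ i, Integrable ((s i).indicator (f i)) (μ i) := fun i => (hfi i).indicator (hs i)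
  have hind0 : ∀ i z, 0 ≤ (s i).indicator (f i) z := fun i z =>
    Set.indicator_nonneg (fun z _ => hf0 i z) z
  have hprod : ∀ y, (Set.pi Set.univ s).indicator (fun y => ENNReal.ofReal (∏ i, f i (y i))) y =
      ENNReal.ofReal (∏ i, (s i).indicator (f i) (y i)) := by
    intro y
    by_cases hy : ∀ i, y i ∈ s i
    · rw [Set.indicator_of_mem (by simpa using hy)]
      simp only [Set.indicator_of_mem (hy _)]
    · obtain ⟨i, hi⟩ := not_forall.1 hy
      rw [Set.indicator_of_notMem (by simpa using ⟨i, hi⟩),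
        Finset.prod_eq_zero (Finset.mem_univ i) (Set.indicator_of_notMem hi (f i)),
        ENNReal.ofReal_zero]
  have hfactor : ∀ i, ENNReal.ofReal (∫ z, (s i).indicator (f i) z ∂μ i) =
      (μ i).withDensity (fun z => ENNReal.ofReal (f i z)) (s i) := fun i => by
    rw [withDensity_apply _ (hs i), integral_indicator (hs i),
      ofReal_integral_eq_lintegral_ofReal (hfi i).integrableOn (ae_of_all _ (hf0 i))]
  rw [withDensity_apply _ (MeasurableSet.univ_pi hs), ← lintegral_indicator (.univ_pi hs)]
  simp_rw [hprod]
  rw [← ofReal_integral_eq_lintegral_ofReal (Integrable.fintype_prod_dep hind)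
      (ae_of_all _ fun y => Finset.prod_nonneg fun i _ => hind0 i _),
    integral_fintype_prod_eq_prod (fun i => (s i).indicator (f i)),
    ENNReal.ofReal_prod_of_nonneg fun i _ => integral_nonneg (hind0 i)]
  exact Finset.prod_congr rfl fun i _ => hfactor i

lemma conv_pi {X : Type*} [AddMonoid X] [MeasurableSpace X] [MeasurableAdd₂ X]
    (μ ν : ι → Measure X) [∀ i, IsProbabilityMeasure (μ i)] [∀ i, IsProbabilityMeasure (ν i)] :
    (Measure.pi μ).conv (Measure.pi ν) = Measure.pi fun i => (μ i).conv (ν i) := by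
  have hadd := Measure.pi_map_pi (μ := fun i => (μ i).prod (ν i))
    (f := fun _ (x : X × X) => x.1 + x.2) fun _ => by fun_prop
  simp only [Measure.conv]
  rw [← hadd, ← (measurePreserving_arrowProdEquivProdArrow X X ι μ ν).map_eq,
    Measure.map_map (by fun_prop) (MeasurableEquiv.measurable _)]
  rfl

lemma ae_pi_forall {Ω : Type*} [MeasurableSpace Ω] {P : Measure Ω} [SigmaFinite P]
    {q : Ω → Prop} (hq : ∀ᵐ x ∂P, q x) : ∀ᵐ y ∂Measure.pi (fun _ : ι => P), ∀ i, q (y i) :=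
  ae_all_iff.2 fun i => Measure.quasiMeasurePreserving_eval (fun _ : ι => P) i |>.ae hq

end ProductMeasures

section Densities

variable {E : Type*} [MeasurableSpace E] {ν : Measure E} {f : E → ℝ}

lemma ae_withDensity_ofReal_pos (hf : Measurable f) :
    ∀ᵐ z ∂ν.withDensity (fun z => ENNReal.ofReal (f z)), 0 < f z :=
  (ae_withDensity_iff (by fun_prop)).2 (ae_of_all _ fun z hz => by simpa using hz)

variable [AddCommGroup E] [MeasurableAdd₂ E] [ν.IsAddLeftInvariant]

lemma map_add_left_withDensity (x : E) :
    (ν.withDensity fun z => ENNReal.ofReal (f z)).map (fun z => x + z) =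
      ν.withDensity fun y => ENNReal.ofReal (f (y - x)) := by
  ext s hs
  rw [Measure.map_apply (by fun_prop) hs, withDensity_apply _ hs,
    withDensity_apply _ (hs.preimage (by fun_prop)), ← lintegral_indicator hs,
    ← lintegral_indicator (hs.preimage (by fun_prop)),
    ← lintegral_add_left_eq_self (s.indicator fun y => ENNReal.ofReal (f (y - x))) x]
  refine lintegral_congr fun z => ?_
  by_cases hz : x + z ∈ s <;> simp [hz]

end Densities

section Gibbs

lemma mul_le_klFun_add_exp {a : ℝ} (ha : 0 ≤ a) (b : ℝ) :
    a * b ≤ klFun a - 1 + Real.exp b := by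
  rw [klFun_apply]
  rcases ha.eq_or_lt with rfl | ha
  · simp [Real.exp_nonneg]
  · have h := Real.add_one_le_exp (b - Real.log a)
    rw [Real.exp_sub, Real.exp_log ha, le_div_iff₀ ha] at h
    linarith

variable {Ω : Type*} [MeasurableSpace Ω]

-- The Donsker–Varadhan inequality.
lemma integrable_and_integral_le_of_klDiv_le {P μ : Measure Ω}
    [IsProbabilityMeasure P] [IsProbabilityMeasure μ] {b : Ω → ℝ}
    (hb : Measurable b) {β : ℝ} (hβ : ∀ ω, β ≤ b ω)
    (hexp : Integrable (fun ω => Real.exp (b ω)) μ) {Δ : ℝ} (hΔ : 0 ≤ Δ)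
    (hkl : klDiv P μ ≤ ENNReal.ofReal Δ) :
    Integrable b P ∧ ∫ ω, b ω ∂P ≤ Δ - 1 + ∫ ω, Real.exp (b ω) ∂μ := by
  obtain ⟨hac, hllr⟩ := klDiv_ne_top_iff.1 (ne_top_of_le_ne_top ENNReal.ofReal_ne_top hkl)
  have hkli : Integrable (fun ω => klFun (P.rnDeriv μ ω).toReal - 1) μ :=
    ((integrable_klFun_rnDeriv_iff hac).2 hllr).sub (integrable_const 1)
  have hkl_le : ∫ ω, (klFun (P.rnDeriv μ ω).toReal - 1) ∂μ ≤ Δ - 1 := by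
    rw [integral_sub ((integrable_klFun_rnDeriv_iff hac).2 hllr) (integrable_const 1),
      ← toReal_klDiv_eq_integral_klFun hac]
    simpa using ENNReal.toReal_le_of_le_ofReal hΔ hkl
  have hle : ∀ ω, (P.rnDeriv μ ω).toReal * b ω ≤
      klFun (P.rnDeriv μ ω).toReal - 1 + Real.exp (b ω) :=
    fun ω => mul_le_klFun_add_exp ENNReal.toReal_nonneg _
  have hbi : Integrable (fun ω => (P.rnDeriv μ ω).toReal * b ω) μ :=
    integrable_of_le_of_le (Measurable.aestronglyMeasurable (by fun_prop))
      (ae_of_all _ fun ω => mul_le_mul_of_nonneg_left (hβ ω) ENNReal.toReal_nonneg)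
      (ae_of_all _ hle) (Measure.integrable_toReal_rnDeriv.mul_const β) (hkli.add hexp)
  refine ⟨(integrable_rnDeriv_smul_iff hac).1 hbi, ?_⟩
  calc ∫ ω, b ω ∂P
      = ∫ ω, (P.rnDeriv μ ω).toReal * b ω ∂μ := (integral_rnDeriv_smul hac).symm
    _ ≤ ∫ ω, (klFun (P.rnDeriv μ ω).toReal - 1 + Real.exp (b ω)) ∂μ :=
      integral_mono hbi (hkli.add hexp) hle
    _ = ∫ ω, (klFun (P.rnDeriv μ ω).toReal - 1) ∂μ + ∫ ω, Real.exp (b ω) ∂μ :=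
      integral_add hkli hexp
    _ ≤ Δ - 1 + ∫ ω, Real.exp (b ω) ∂μ := by gcongr

lemma integrable_and_integral_le_of_lintegral_ofReal_le {μ : Measure Ω} {f : Ω → ℝ} {c : ℝ}
    (hf : AEStronglyMeasurable f μ) (hf0 : ∀ ω, 0 ≤ f ω) (hc : 0 ≤ c)
    (h : ∫⁻ ω, ENNReal.ofReal (f ω) ∂μ ≤ ENNReal.ofReal c) :
    Integrable f μ ∧ ∫ ω, f ω ∂μ ≤ c := by
  have hint : Integrable f μ := (lintegral_ofReal_ne_top_iff_integrable hf (ae_of_all _ hf0)).1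
    (ne_top_of_le_ne_top ENNReal.ofReal_ne_top h)
  refine ⟨hint, ?_⟩
  rwa [← ofReal_integral_eq_lintegral_ofReal hint (ae_of_all _ hf0),
    ENNReal.ofReal_le_ofReal_iff hc] at h

lemma integral_le_of_lintegral_exp_le {μ : Measure Ω} [IsProbabilityMeasure μ] {i : Ω → ℝ}
    (hi : Integrable i μ) {c : ℝ} (hc : 0 ≤ c)
    (hexp : ∫⁻ ω, ENNReal.ofReal (Real.exp (i ω)) ∂μ ≤ ENNReal.ofReal c) :
    ∫ ω, i ω ∂μ ≤ c - 1 := by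
  obtain ⟨hei, hle⟩ := integrable_and_integral_le_of_lintegral_ofReal_le
    (Real.continuous_exp.comp_aestronglyMeasurable hi.aestronglyMeasurable)
    (fun ω => Real.exp_nonneg _) hc hexp
  have h := integral_mono (hi.add (integrable_const 1)) hei fun ω => Real.add_one_le_exp (i ω)
  simp only [Pi.add_apply] at h
  rw [integral_add hi (integrable_const 1)] at h
  simp only [integral_const, probReal_univ, one_smul] at h
  linarith

variable {E : Type*} [AddCommGroup E] [MeasurableSpace E] [MeasurableAdd₂ E]
  {ν μ : Measure E} [ν.IsAddLeftInvariant] {f a : E → ℝ} {x : E}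

lemma lintegral_exp_log_translate_le (hf : Measurable f) (hf0 : ∀ y, 0 ≤ f y)
    (hμ : μ = ν.withDensity fun z => ENNReal.ofReal (f z)) (ha : Measurable a)
    (hx : ∀ᵐ z ∂μ, f (x + z) ≠ 0) :
    ∫⁻ z, ENNReal.ofReal (Real.exp (Real.log (f (x + z)) + a (x + z) - Real.log (f z))) ∂μ ≤
      ∫⁻ z, ENNReal.ofReal (Real.exp (a z)) ∂μ := by
  have hpos : ∀ᵐ z ∂μ, 0 < f z := hμ ▸ ae_withDensity_ofReal_pos hf
  calc _ = ∫⁻ z, ENNReal.ofReal (f (x + z) * Real.exp (a (x + z)) / f z) ∂μ := by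
        refine lintegral_congr_ae ?_
        filter_upwards [hx, hpos] with z hxz hz
        rw [Real.exp_sub, Real.exp_add, Real.exp_log hz,
          Real.exp_log ((hf0 _).lt_of_ne hxz.symm)]
    _ = ∫⁻ z, ENNReal.ofReal (f z) *
          ENNReal.ofReal (f (x + z) * Real.exp (a (x + z)) / f z) ∂ν := by
        rw [hμ, lintegral_withDensity_eq_lintegral_mul _ (by fun_prop) (by fun_prop)]
        rfl
    _ ≤ ∫⁻ z, ENNReal.ofReal (f (x + z)) * ENNReal.ofReal (Real.exp (a (x + z))) ∂ν := by
        refine lintegral_mono fun z => ?_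
        rw [← ENNReal.ofReal_mul (hf0 _), ← ENNReal.ofReal_mul (hf0 _)]
        refine ENNReal.ofReal_le_ofReal ?_
        rcases (hf0 z).eq_or_lt with hz | hz
        · rw [← hz, zero_mul]
          exact mul_nonneg (hf0 _) (Real.exp_nonneg _)
        · rw [mul_div_cancel₀ _ hz.ne']
    _ = ∫⁻ z, ENNReal.ofReal (f z) * ENNReal.ofReal (Real.exp (a z)) ∂ν :=
        lintegral_add_left_eq_self
          (fun z => ENNReal.ofReal (f z) * ENNReal.ofReal (Real.exp (a z))) x
    _ = ∫⁻ z, ENNReal.ofReal (Real.exp (a z)) ∂μ := by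
        rw [hμ, lintegral_withDensity_eq_lintegral_mul _ (by fun_prop) (by fun_prop)]
        rfl

-- The Gibbs inequality for the translate of `μ` against the law with density `e ^ a` over `μ`.
lemma integral_log_translate_le [IsProbabilityMeasure μ] (hf : Measurable f) (hf0 : ∀ y, 0 ≤ f y)
    (hμ : μ = ν.withDensity fun z => ENNReal.ofReal (f z)) (ha : Measurable a)
    (hexp : Integrable (fun z => Real.exp (a z)) μ) (hx : ∀ᵐ z ∂μ, f (x + z) ≠ 0)
    (hi : Integrable (fun z => Real.log (f (x + z)) + a (x + z) - Real.log (f z)) μ) :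
    ∫ z, (Real.log (f (x + z)) + a (x + z) - Real.log (f z)) ∂μ ≤
      ∫ z, Real.exp (a z) ∂μ - 1 := by
  refine integral_le_of_lintegral_exp_le hi (integral_nonneg fun z => Real.exp_nonneg _) ?_
  rw [ofReal_integral_eq_lintegral_ofReal hexp (ae_of_all _ fun z => Real.exp_nonneg _)]
  exact lintegral_exp_log_translate_le hf hf0 hμ ha hx

end Gibbs

section SecondMoment

variable {Ω : Type*} {mΩ : MeasurableSpace Ω} {μ : Measure Ω} {X : Ω → ℝ} {s T κ : ℝ}

lemma measure_pi_sum_le_le [IsProbabilityMeasure μ] {ι : Type*} [Fintype ι] (hX : MemLp X 2 μ)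
    {τ : ℝ} (hτ : τ < Fintype.card ι * μ[X]) :
    Measure.pi (fun _ : ι => μ) {a | ∑ k, X (a k) ≤ τ} ≤
      ENNReal.ofReal (Fintype.card ι * Var[X; μ] / (Fintype.card ι * μ[X] - τ) ^ 2) := by
  set S : (ι → Ω) → ℝ := ∑ k, fun a => X (a k)
  have hmem (k : ι) : MemLp (fun a : ι → Ω => X (a k)) 2 (Measure.pi fun _ => μ) :=
    hX.comp_measurePreserving (measurePreserving_eval _ k)
  have hvar : Var[S; Measure.pi fun _ => μ] = Fintype.card ι * Var[X; μ] := by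
    simp [S, variance_sum_pi (μ := fun _ : ι => μ) fun _ => hX]
  have hmean : ∫ a, S a ∂Measure.pi (fun _ => μ) = Fintype.card ι * μ[X] := by
    have heval (k : ι) : ∫ a : ι → Ω, X (a k) ∂Measure.pi (fun _ => μ) = μ[X] :=
      integral_comp_eval hX.aestronglyMeasurable
    simp only [S, Finset.sum_apply]
    rw [integral_finsetSum _ fun k _ => (hmem k).integrable one_le_two]
    simp [heval]
  have hdev := meas_ge_le_variance_div_sq (memLp_finsetSum' _ fun k _ => hmem k : MemLp S 2 _)
    (sub_pos.2 hτ)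
  rw [hvar] at hdev
  refine le_trans (measure_mono fun a ha => ?_) hdev
  have ha' : S a ≤ τ := by simpa [S] using ha
  rw [Set.mem_ofPred_eq, hmean, abs_sub_comm]
  exact le_trans (by linarith) (le_abs_self _)

lemma sq_le_mul_exp_neg_add_mul_exp (hs : 0 < s) (hT : 1 ≤ T) (x : ℝ) :
    x ^ 2 ≤ 4 * T * (Real.exp (-x) - 1 + x) + 6 / (s ^ 3 * T) * Real.exp (s * x) := by
  have hexp : 0 ≤ 6 / (s ^ 3 * T) * Real.exp (s * x) := by positivity
  have hlin := Real.add_one_le_exp (-x)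
  rcases le_total x 2 with h2 | h2
  · have hhalf : (1 - x / 2) ^ 2 ≤ Real.exp (-x) := by
      rw [show -x = -(x / 2) + -(x / 2) by ring, Real.exp_add, ← sq]
      exact pow_le_pow_left₀ (by linarith) (by linarith [Real.add_one_le_exp (-(x / 2))]) 2
    nlinarith
  rcases le_total x T with hxT | hTx
  · nlinarith [Real.exp_pos (-x)]
  · have hcube : x ^ 2 ≤ 6 / (s ^ 3 * T) * Real.exp (s * x) := by
      have hfact := Real.pow_div_factorial_le_exp (s * x) (by positivity) 3
      calc x ^ 2 ≤ x ^ 3 / T := by rw [le_div_iff₀ (by linarith)]; nlinarith [sq_nonneg x]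
        _ = 6 / (s ^ 3 * T) * ((s * x) ^ 3 / Nat.factorial 3) := by
          norm_num [Nat.factorial]
          field_simp
        _ ≤ _ := by gcongr
    nlinarith

lemma memLp_two_of_integrable_exp (hs : 0 < s) (hneg : Integrable (fun ω => Real.exp (-X ω)) μ)
    (hpos : Integrable (fun ω => Real.exp (s * X ω)) μ) : MemLp X 2 μ := by
  have hord : Set.OrdConnected (integrableExpSet X μ) := convex_integrableExpSet.ordConnected
  have hsub : Set.Ioo (-1) s ⊆ integrableExpSet X μ :=
    Set.Ioo_subset_Icc_self.trans <| hord.out (by simpa [integrableExpSet] using hneg) hpos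
  refine memLp_of_mem_interior_integrableExpSet ?_ 2
  exact interior_mono hsub (by simp [hs])

lemma integral_sq_le [IsProbabilityMeasure μ] (hs : 0 < s) (hT : 1 ≤ T)
    (hneg : Integrable (fun ω => Real.exp (-X ω)) μ) (hneg1 : ∫ ω, Real.exp (-X ω) ∂μ ≤ 1)
    (hpos : Integrable (fun ω => Real.exp (s * X ω)) μ)
    (hposκ : ∫ ω, Real.exp (s * X ω) ∂μ ≤ κ) :
    ∫ ω, X ω ^ 2 ∂μ ≤ 4 * T * μ[X] + 6 / (s ^ 3 * T) * κ := by
  have hX := memLp_two_of_integrable_exp hs hneg hpos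
  have hX1 := hX.integrable one_le_two
  have hlin : Integrable (fun ω => 4 * T * (Real.exp (-X ω) - 1 + X ω)) μ :=
    ((hneg.sub (integrable_const 1)).add hX1).const_mul _
  calc ∫ ω, X ω ^ 2 ∂μ
      ≤ ∫ ω, (4 * T * (Real.exp (-X ω) - 1 + X ω) + 6 / (s ^ 3 * T) * Real.exp (s * X ω)) ∂μ :=
        integral_mono hX.integrable_sq (hlin.add (hpos.const_mul _)) fun ω =>
          sq_le_mul_exp_neg_add_mul_exp hs hT (X ω)
    _ = 4 * T * (∫ ω, Real.exp (-X ω) ∂μ - 1 + μ[X]) +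
          6 / (s ^ 3 * T) * ∫ ω, Real.exp (s * X ω) ∂μ := by
        rw [integral_add hlin (hpos.const_mul _), integral_const_mul, integral_const_mul,
          integral_add (f := fun ω => Real.exp (-X ω) - 1) (hneg.sub (integrable_const 1)) hX1,
          integral_sub hneg (integrable_const 1)]
        simp
    _ ≤ 4 * T * (1 - 1 + μ[X]) + 6 / (s ^ 3 * T) * κ := by gcongr
    _ = _ := by ring

end SecondMoment

section Taylor

lemma tendsto_taylor_two_nhdsGT {f f' : ℝ → ℝ} {c x : ℝ}
    (hf : ∀ᶠ y in 𝓝 x, HasDerivAt f (f' y) y) (hf' : HasDerivAt f' c x) :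
    Tendsto (fun y => (f y - f x - f' x * (y - x)) / (y - x) ^ 2) (𝓝[>] x) (𝓝 (c / 2)) := by
  have hcont : ContinuousAt f x := hf.self_of_nhds.continuousAt
  refine HasDerivAt.lhopital_zero_nhdsGT (f' := fun y => f' y - f' x)
    (g' := fun y => 2 * (y - x)) ?_ ?_ ?_ ?_ ?_ ?_
  · filter_upwards [hf.filter_mono nhdsWithin_le_nhds] with y hy
    simpa using (hy.sub_const (f x)).fun_sub (((hasDerivAt_id y).sub_const x).const_mul (f' x))
  · filter_upwards with y
    simpa using ((hasDerivAt_id y).sub_const x).fun_pow 2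
  · filter_upwards [self_mem_nhdsWithin] with y (hy : x < y)
    exact (mul_pos two_pos (sub_pos.2 hy)).ne'
  · refine (Tendsto.mono_left ?_ nhdsWithin_le_nhds)
    have : ContinuousAt (fun y => f y - f x - f' x * (y - x)) x := by fun_prop
    simpa [ContinuousAt] using this
  · refine (Tendsto.mono_left ?_ nhdsWithin_le_nhds)
    have : ContinuousAt (fun y => (y - x) ^ 2) x := by fun_prop
    simpa [ContinuousAt] using this
  · have hslope := (hasDerivAt_iff_tendsto_slope.1 hf').mono_left
      (nhdsWithin_mono x fun y (hy : x < y) => hy.ne')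
    refine (hslope.div_const 2).congr fun y => ?_
    rw [slope_def_field, div_div, mul_comm]

end Taylor

section ExponentialFamily

variable {Ω : Type*} {mΩ : MeasurableSpace Ω} {μ : Measure Ω} {X : Ω → ℝ} {t : ℝ}

lemma hasDerivAt_cgf (ht : t ∈ interior (integrableExpSet X μ)) :
    HasDerivAt (cgf X μ) (deriv (cgf X μ) t) t :=
  (analyticAt_cgf ht).differentiableAt.hasDerivAt

lemma hasDerivAt_deriv_cgf_zero [IsProbabilityMeasure μ]
    (h0 : 0 ∈ interior (integrableExpSet X μ)) :
    HasDerivAt (deriv (cgf X μ)) Var[X; μ] 0 := by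
  have hvar := variance_tilted_mul h0
  rw [iteratedDeriv_succ, iteratedDeriv_one] at hvar
  simp only [zero_mul, tilted_const] at hvar
  rw [hvar]
  exact (analyticAt_cgf h0).deriv.differentiableAt.hasDerivAt

lemma tendsto_cgf_sub_div_sq [IsProbabilityMeasure μ]
    (h0 : 0 ∈ interior (integrableExpSet X μ)) :
    Tendsto (fun t => (cgf X μ t - t * deriv (cgf X μ) 0) / t ^ 2) (𝓝[>] 0)
      (𝓝 (Var[X; μ] / 2)) := by
  have hmem : ∀ᶠ t in 𝓝 0, t ∈ interior (integrableExpSet X μ) :=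
    isOpen_interior.mem_nhds h0
  refine (tendsto_taylor_two_nhdsGT (hmem.mono fun t ht => hasDerivAt_cgf ht)
    (hasDerivAt_deriv_cgf_zero h0)).congr fun t => ?_
  rw [cgf_zero, sub_zero, sub_zero, mul_comm t]

lemma tendsto_legendre_cgf_div_sq [IsProbabilityMeasure μ]
    (h0 : 0 ∈ interior (integrableExpSet X μ)) :
    Tendsto (fun t => (t * deriv (cgf X μ) t - cgf X μ t) / t ^ 2) (𝓝[>] 0)
      (𝓝 (Var[X; μ] / 2)) := by
  have hslope := (hasDerivAt_deriv_cgf_zero h0).tendsto_slope_zero_right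
  rw [show Var[X; μ] / 2 = Var[X; μ] - Var[X; μ] / 2 by ring]
  refine (hslope.sub (tendsto_cgf_sub_div_sq h0)).congr' ?_
  filter_upwards [self_mem_nhdsWithin] with t (ht : 0 < t)
  simp only [zero_add, smul_eq_mul]
  field_simp
  ring

end ExponentialFamily

section Tilted

variable {Ω : Type*} {mΩ : MeasurableSpace Ω} {μ : Measure Ω} [IsProbabilityMeasure μ]
  {f : Ω → ℝ}

lemma pi_tilted {ι : Type*} [Fintype ι] (hf : Integrable (fun ω => Real.exp (f ω)) μ) :
    Measure.pi (fun _ : ι => μ.tilted f) =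
      (Measure.pi fun _ : ι => μ).tilted fun y => ∑ i, f (y i) := by
  simp only [Measure.tilted, Real.exp_sum]
  rw [pi_withDensity_ofReal (fun _ _ => div_nonneg (Real.exp_nonneg _)
    (integral_nonneg fun _ => Real.exp_nonneg _)) fun _ => hf.div_const _]
  simp [Finset.prod_div_distrib,
    integral_fintype_prod_eq_pow fun ω => Real.exp (f ω)]

lemma klDiv_tilted_self (hf : Integrable (fun ω => Real.exp (f ω)) μ)
    (hfi : Integrable f (μ.tilted f)) :
    klDiv (μ.tilted f) μ =
      ENNReal.ofReal (∫ ω, f ω ∂μ.tilted f - Real.log (∫ ω, Real.exp (f ω) ∂μ)) := by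
  have := isProbabilityMeasure_tilted hf
  have hac := tilted_absolutelyContinuous μ f
  have hllr : llr (μ.tilted f) μ =ᵐ[μ.tilted f]
      fun ω => f ω - Real.log (∫ ω, Real.exp (f ω) ∂μ) :=
    hac.ae_le (log_rnDeriv_tilted_left_self hf)
  rw [klDiv_of_ac_of_integrable hac ((hfi.sub (integrable_const _)).congr hllr.symm),
    integral_congr_ae hllr, integral_sub hfi (integrable_const _)]
  simp

lemma klDiv_pi_tilted_mul_self {ι : Type*} [Fintype ι] {X : Ω → ℝ} {t : ℝ}
    (ht : t ∈ interior (integrableExpSet X μ)) :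
    klDiv (Measure.pi fun _ : ι => μ.tilted (t * X ·)) (Measure.pi fun _ => μ) =
      ENNReal.ofReal (Fintype.card ι * (t * deriv (cgf X μ) t - cgf X μ t)) := by
  have hexp : Integrable (fun ω => Real.exp (t * X ω)) μ :=
    interior_subset (s := integrableExpSet X μ) ht
  have := isProbabilityMeasure_tilted hexp
  have hX : Integrable (fun ω => t * X ω) (μ.tilted (t * X ·)) :=
    ((memLp_tilted_mul ht 1).integrable le_rfl).const_mul t
  have hXi (i : ι) :
      Integrable (fun y => t * X (y i)) (Measure.pi fun _ : ι => μ.tilted (t * X ·)) :=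
    integrable_comp_eval (μ := fun _ : ι => μ.tilted (t * X ·)) (i := i) hX
  have hmean (i : ι) : ∫ y, t * X (y i) ∂(Measure.pi fun _ : ι => μ.tilted (t * X ·)) =
      t * deriv (cgf X μ) t := by
    rw [integral_comp_eval (μ := fun _ : ι => μ.tilted (t * X ·)) (i := i)
      hX.aestronglyMeasurable, integral_const_mul, integral_tilted_mul_self ht]
  rw [pi_tilted hexp, klDiv_tilted_self, ← pi_tilted hexp, integral_finsetSum _ fun i _ => hXi i]
  · simp [hmean, Real.exp_sum, integral_fintype_prod_eq_pow (fun ω => Real.exp (t * X ω)),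
      Real.log_pow, cgf, mgf, mul_sub]
  · simpa only [Real.exp_sum] using Integrable.fintype_prod fun _ => hexp
  · rw [← pi_tilted hexp]
    exact integrable_finsetSum _ fun i _ => hXi i

end Tilted

/-- The surprisal `-log f` of a density `f`; it has the junk value `0` where `f` vanishes. -/
def surprisal {X : Type*} (f : X → ℝ) (x : X) : ℝ := -Real.log (f x)

lemma measurable_surprisal {X : Type*} [MeasurableSpace X] {f : X → ℝ} (hf : Measurable f) :
    Measurable (surprisal f) :=
  (Real.measurable_log.comp hf).neg

lemma neg_log_le_surprisal {X : Type*} {f : X → ℝ} {B : ℝ} {x : X} (hf0 : 0 ≤ f x) (hB1 : 1 ≤ B)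
    (hB : f x ≤ B) : -Real.log B ≤ surprisal f x := by
  rcases hf0.eq_or_lt with h | h
  · simpa [surprisal, ← h] using Real.log_nonneg hB1
  · exact neg_le_neg (Real.log_le_log h hB)

namespace Code

variable {n : ℕ} (C : Code n) {p : ℝ → ℝ}

lemma natCast_numMsg_pos : (0 : ℝ) < C.numMsg := by exact_mod_cast C.numMsg_pos

lemma numMsg_mul_numKey_pos : 0 < (C.numMsg : ℝ) * C.numKey :=
  mul_pos C.natCast_numMsg_pos (by exact_mod_cast C.numKey_pos)

lemma numMsg_mul_numKey_ne_zero : (C.numMsg : ℝ≥0∞) * C.numKey ≠ 0 := by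
  exact_mod_cast (Nat.mul_pos C.numMsg_pos C.numKey_pos).ne'

lemma numMsg_mul_numKey_ne_top : (C.numMsg : ℝ≥0∞) * C.numKey ≠ ⊤ := by
  exact_mod_cast ENNReal.natCast_ne_top (C.numMsg * C.numKey)

section OutputLaw

variable (m : Fin C.numMsg) (k : Fin C.numKey)

lemma map_enc_le_smul_outputLaw (p : ℝ → ℝ) :
    (noiseLawN p n).map (fun z => C.enc m k + z) ≤
      ((C.numMsg : ℝ≥0∞) * C.numKey) • C.outputLaw p := by
  rw [outputLaw, smul_smul,
    ENNReal.mul_inv_cancel C.numMsg_mul_numKey_ne_zero C.numMsg_mul_numKey_ne_top, one_smul]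
  intro s
  simp only [Measure.coe_finsetSum, Finset.sum_apply]
  exact (Finset.single_le_sum (f := fun k => (noiseLawN p n).map (fun z => C.enc m k + z) s)
      (fun _ _ => zero_le) (Finset.mem_univ k)).trans
    (Finset.single_le_sum (f := fun m => ∑ k, (noiseLawN p n).map (fun z => C.enc m k + z) s)
      (fun _ _ => zero_le) (Finset.mem_univ m))

lemma isProbabilityMeasure_outputLaw (p : ℝ → ℝ) [IsProbabilityMeasure (noiseLawN p n)] :
    IsProbabilityMeasure (C.outputLaw p) := by
  have hmap : ∀ m k, (noiseLawN p n).map (fun z => C.enc m k + z) Set.univ = 1 := fun m k => by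
    rw [Measure.map_apply (by fun_prop) MeasurableSet.univ, Set.preimage_univ, measure_univ]
  constructor
  simp only [outputLaw, Measure.smul_apply, Measure.coe_finsetSum, Finset.sum_apply, hmap,
    smul_eq_mul, Finset.sum_const, Finset.card_univ, Fintype.card_fin, nsmul_eq_mul, mul_one]
  exact ENNReal.inv_mul_cancel C.numMsg_mul_numKey_ne_zero C.numMsg_mul_numKey_ne_top

lemma integrable_map_enc {b : (Fin n → ℝ) → ℝ} (hb : Integrable b (C.outputLaw p)) :
    Integrable b ((noiseLawN p n).map fun z => C.enc m k + z) :=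
  (hb.smul_measure C.numMsg_mul_numKey_ne_top).mono_measure (C.map_enc_le_smul_outputLaw m k p)

lemma integrable_enc_add {b : (Fin n → ℝ) → ℝ} (hb : Integrable b (C.outputLaw p)) :
    Integrable (fun z => b (C.enc m k + z)) (noiseLawN p n) :=
  (C.integrable_map_enc m k hb).comp_measurable (by fun_prop)

lemma integral_outputLaw {b : (Fin n → ℝ) → ℝ} (hb : Integrable b (C.outputLaw p)) :
    ∫ y, b y ∂C.outputLaw p = ((C.numMsg : ℝ) * C.numKey)⁻¹ *
      ∑ m, ∑ k, ∫ z, b (C.enc m k + z) ∂noiseLawN p n := by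
  have hmap := fun m k => C.integrable_map_enc m k hb
  have hmap_eq : ∀ m k, ∫ y, b y ∂(noiseLawN p n).map (fun z => C.enc m k + z) =
      ∫ z, b (C.enc m k + z) ∂noiseLawN p n :=
    fun m k => integral_map (by fun_prop) (hmap m k).aestronglyMeasurable
  rw [outputLaw, integral_smul_measure,
    integral_finsetSum_measure fun m _ => integrable_finsetSum_measure.2 fun k _ => hmap m k]
  simp only [smul_eq_mul, ENNReal.toReal_inv, ENNReal.toReal_mul, ENNReal.toReal_natCast,
    integral_finsetSum_measure fun k _ => hmap _ k, hmap_eq]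

lemma ae_enc_add_of_absolutelyContinuous (hac : C.outputLaw p ≪ noiseLawN p n)
    {q : (Fin n → ℝ) → Prop} (hq : ∀ᵐ y ∂noiseLawN p n, q y) :
    ∀ᵐ z ∂noiseLawN p n, q (C.enc m k + z) :=
  ae_of_ae_map (by fun_prop) <| ae_mono (C.map_enc_le_smul_outputLaw m k p) <|
    Measure.ae_smul_measure (hac.ae_le hq) _

end OutputLaw

section DecodeGain

/-- The score behind the Fano part of the converse: `log |M|` at the outputs that `C` decodes to
`m` under the key `k`, and `0` at all others. -/
def decodeGain (m : Fin C.numMsg) (k : Fin C.numKey) : (Fin n → ℝ) → ℝ :=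
  {y | C.dec y k = m}.indicator fun _ => Real.log C.numMsg

variable (m : Fin C.numMsg) (k : Fin C.numKey)

lemma measurable_decodeGain : Measurable (C.decodeGain m k) :=
  measurable_const.indicator (C.measurable_dec k (measurableSet_singleton m))

lemma norm_decodeGain_le (y : Fin n → ℝ) : ‖C.decodeGain m k y‖ ≤ Real.log C.numMsg :=
  (norm_indicator_le_norm_self _ _).trans
    (by rw [Real.norm_of_nonneg (Real.log_natCast_nonneg _)])

lemma exp_decodeGain (y : Fin n → ℝ) :
    Real.exp (C.decodeGain m k y) = if C.dec y k = m then (C.numMsg : ℝ) else 1 := by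
  by_cases h : C.dec y k = m <;> simp [decodeGain, h, Real.exp_log C.natCast_numMsg_pos]

lemma sum_exp_decodeGain_le (y : Fin n → ℝ) :
    ∑ m, Real.exp (C.decodeGain m k y) ≤ 2 * C.numMsg := by
  have hle : ∀ m, Real.exp (C.decodeGain m k y) ≤
      1 + if C.dec y k = m then (C.numMsg : ℝ) else 0 := fun m => by
    rw [exp_decodeGain]
    split_ifs <;> simp
  refine (Finset.sum_le_sum fun m _ => hle m).trans_eq ?_
  simp [Finset.sum_add_distrib, two_mul]

variable {μ : Measure (Fin n → ℝ)} {b : (Fin n → ℝ) → ℝ}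

lemma integrable_decodeGain_add [IsFiniteMeasure μ] (x : Fin n → ℝ) :
    Integrable (fun z => C.decodeGain m k (x + z)) μ :=
  .of_bound ((C.measurable_decodeGain m k).comp (measurable_const_add x)).aestronglyMeasurable
    _ (ae_of_all _ fun _ => C.norm_decodeGain_le m k _)

lemma integral_decodeGain_enc_add [IsProbabilityMeasure μ] :
    ∫ z, C.decodeGain m k (C.enc m k + z) ∂μ =
      (1 - μ.real {z | C.dec (C.enc m k + z) k ≠ m}) * Real.log C.numMsg := by
  have hmeas : MeasurableSet {z | C.dec (C.enc m k + z) k = m} :=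
    (C.measurable_dec k (measurableSet_singleton m)).preimage (measurable_const_add _)
  have hset : {z | C.dec (C.enc m k + z) k ≠ m} = {z | C.dec (C.enc m k + z) k = m}ᶜ := rfl
  rw [hset, probReal_compl_eq_one_sub hmeas, sub_sub_cancel, ← smul_eq_mul,
    ← integral_indicator_const _ hmeas]
  rfl

lemma integrable_exp_decodeGain_mul (hb : Integrable (fun y => Real.exp (b y)) μ) :
    Integrable (fun y => Real.exp (C.decodeGain m k y) * Real.exp (b y)) μ := by
  have hm := C.measurable_decodeGain m k
  refine hb.bdd_mul (c := Real.exp (Real.log C.numMsg))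
    (Measurable.aestronglyMeasurable (by fun_prop)) (ae_of_all _ fun y => ?_)
  rw [Real.norm_of_nonneg (Real.exp_pos _).le]
  exact Real.exp_le_exp.2 ((le_abs_self _).trans (C.norm_decodeGain_le m k y))

lemma sum_integral_exp_decodeGain_mul_le (hb : Integrable (fun y => Real.exp (b y)) μ) :
    ∑ m, ∫ y, Real.exp (C.decodeGain m k y) * Real.exp (b y) ∂μ ≤
      2 * C.numMsg * ∫ y, Real.exp (b y) ∂μ := by
  rw [← integral_finsetSum _ fun m _ => C.integrable_exp_decodeGain_mul m k hb,
    ← integral_const_mul]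
  refine integral_mono (integrable_finsetSum _ fun m _ => C.integrable_exp_decodeGain_mul m k hb)
    (hb.const_mul _) fun y => ?_
  simp only
  rw [← Finset.sum_mul]
  exact mul_le_mul_of_nonneg_right (C.sum_exp_decodeGain_le k y) (Real.exp_nonneg _)

end DecodeGain

section OneShotConverse

variable [IsProbabilityMeasure (noiseLawN p n)] {f b : (Fin n → ℝ) → ℝ}

-- The Gibbs inequality for the test function `b + decodeGain - log 2`.
lemma integral_enc_add_add_decodeGain_le (hf : Measurable f) (hf0 : ∀ y, 0 ≤ f y)
    (hμ : noiseLawN p n = volume.withDensity fun y => ENNReal.ofReal (f y))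
    (hs : Integrable (surprisal f) (noiseLawN p n)) (hb : Measurable b)
    (hexp : Integrable (fun y => Real.exp (b y)) (noiseLawN p n))
    (hac : C.outputLaw p ≪ noiseLawN p n)
    (hi : Integrable (fun y => b y - surprisal f y) (C.outputLaw p))
    (m : Fin C.numMsg) (k : Fin C.numKey) :
    ∫ z, (b (C.enc m k + z) - surprisal f (C.enc m k + z)) ∂noiseLawN p n +
        (1 - (noiseLawN p n).real {z | C.dec (C.enc m k + z) k ≠ m}) * Real.log C.numMsg -
        Real.log 2 + ∫ y, surprisal f y ∂noiseLawN p n ≤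
      2⁻¹ * ∫ y, Real.exp (C.decodeGain m k y) * Real.exp (b y) ∂noiseLawN p n - 1 := by
  have hgm := C.measurable_decodeGain m k
  have hpos : ∀ᵐ z ∂noiseLawN p n, f z ≠ 0 := by
    filter_upwards [hμ ▸ ae_withDensity_ofReal_pos hf] with z hz using hz.ne'
  have hsplit : ∀ z, Real.log (f (C.enc m k + z)) +
      (b (C.enc m k + z) + C.decodeGain m k (C.enc m k + z) - Real.log 2) - Real.log (f z) =
      b (C.enc m k + z) - surprisal f (C.enc m k + z) + C.decodeGain m k (C.enc m k + z) -
        Real.log 2 + surprisal f z := fun z => by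
    simp only [surprisal]
    ring
  have hexp_split : ∀ y, Real.exp (b y + C.decodeGain m k y - Real.log 2) =
      2⁻¹ * (Real.exp (C.decodeGain m k y) * Real.exp (b y)) := fun y => by
    rw [Real.exp_sub, Real.exp_log two_pos, Real.exp_add]
    ring
  have hi1 := C.integrable_enc_add m k hi
  have hi2 : Integrable (fun z => b (C.enc m k + z) - surprisal f (C.enc m k + z) +
      C.decodeGain m k (C.enc m k + z)) (noiseLawN p n) :=
    hi1.add (C.integrable_decodeGain_add m k _)
  have hi3 : Integrable (fun z => b (C.enc m k + z) - surprisal f (C.enc m k + z) +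
      C.decodeGain m k (C.enc m k + z) - Real.log 2) (noiseLawN p n) :=
    hi2.sub (integrable_const _)
  have hgibbs := integral_log_translate_le hf hf0 hμ
    (a := fun y => b y + C.decodeGain m k y - Real.log 2) (by fun_prop)
    (by simpa only [hexp_split] using (C.integrable_exp_decodeGain_mul m k hexp).const_mul 2⁻¹)
    (C.ae_enc_add_of_absolutelyContinuous m k hac hpos)
    (by simp only [hsplit]; exact hi3.add hs)
  simp only [hsplit, hexp_split] at hgibbs
  rw [integral_add hi3 hs, integral_sub hi2 (integrable_const _),
    integral_add hi1 (C.integrable_decodeGain_add m k _), integral_const_mul,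
    C.integral_decodeGain_enc_add] at hgibbs
  simpa using hgibbs

lemma one_sub_avgError_mul_log_numMsg_le (hf : Measurable f) (hf0 : ∀ y, 0 ≤ f y)
    (hμ : noiseLawN p n = volume.withDensity fun y => ENNReal.ofReal (f y))
    (hs : Integrable (surprisal f) (noiseLawN p n)) (hb : Measurable b)
    (hexp : Integrable (fun y => Real.exp (b y)) (noiseLawN p n))
    (hexp_le : ∫ y, Real.exp (b y) ∂noiseLawN p n ≤ 1) (hac : C.outputLaw p ≪ noiseLawN p n)
    (hi : Integrable (fun y => b y - surprisal f y) (C.outputLaw p)) :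
    (1 - C.avgError p) * Real.log C.numMsg ≤ Real.log 2 - ∫ y, surprisal f y ∂noiseLawN p n -
      ∫ y, (b y - surprisal f y) ∂C.outputLaw p := by
  have hgibbs := Finset.sum_le_sum fun m (_ : m ∈ Finset.univ) =>
    Finset.sum_le_sum fun k (_ : k ∈ Finset.univ) =>
      C.integral_enc_add_add_decodeGain_le hf hf0 hμ hs hb hexp hac hi m k
  have hexp_sum : ∑ m, ∑ k,
      (2⁻¹ * ∫ y, Real.exp (C.decodeGain m k y) * Real.exp (b y) ∂noiseLawN p n - 1) ≤ 0 := by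
    rw [Finset.sum_comm]
    refine Finset.sum_nonpos fun k _ => ?_
    have hle := (C.sum_integral_exp_decodeGain_mul_le k hexp).trans
      (mul_le_of_le_one_right (by positivity) hexp_le)
    rw [Finset.sum_sub_distrib, ← Finset.mul_sum]
    simp only [Finset.sum_const, Finset.card_univ, Fintype.card_fin, nsmul_eq_mul, mul_one]
    linarith
  have hN := C.numMsg_mul_numKey_pos
  have havg : ∑ m, ∑ k, (∫ z, (b (C.enc m k + z) - surprisal f (C.enc m k + z)) ∂noiseLawN p n +
        (1 - (noiseLawN p n).real {z | C.dec (C.enc m k + z) k ≠ m}) * Real.log C.numMsg -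
        Real.log 2 + ∫ y, surprisal f y ∂noiseLawN p n) =
      (C.numMsg * C.numKey) * (∫ y, (b y - surprisal f y) ∂C.outputLaw p +
        (1 - C.avgError p) * Real.log C.numMsg - Real.log 2 +
          ∫ y, surprisal f y ∂noiseLawN p n) := by
    rw [C.integral_outputLaw hi, avgError]
    simp only [sub_mul, Finset.sum_add_distrib, Finset.sum_sub_distrib, ← Finset.sum_mul,
      Finset.sum_const, Finset.card_univ, Fintype.card_fin, nsmul_eq_mul]
    obtain ⟨hM, hK⟩ := mul_ne_zero_iff.1 hN.ne'
    field_simp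
  linarith [nonpos_of_mul_nonpos_right (havg ▸ hgibbs.trans hexp_sum) hN]

lemma log_numMsg_le_of_isCovert (hf : Measurable f) (hf0 : ∀ y, 0 ≤ f y) {B : ℝ} (hB1 : 1 ≤ B)
    (hB : ∀ y, f y ≤ B) (hμ : noiseLawN p n = volume.withDensity fun y => ENNReal.ofReal (f y))
    (hs : Integrable (surprisal f) (noiseLawN p n)) {γ Δ : ℝ} (hγ : 0 < γ) (hγ1 : γ ≤ 1)
    (hΔ : 0 ≤ Δ) (hexp : Integrable (fun y => Real.exp (γ * surprisal f y)) (noiseLawN p n))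
    (hcov : C.IsCovert p Δ) :
    (1 - C.avgError p) * Real.log C.numMsg ≤
      Real.log 2 + (Δ + cgf (surprisal f) (noiseLawN p n) γ) / γ - Δ -
        ∫ y, surprisal f y ∂noiseLawN p n := by
  have := C.isProbabilityMeasure_outputLaw p
  have hsm := measurable_surprisal hf
  set Φ := cgf (surprisal f) (noiseLawN p n) γ
  have hexp_sub : ∀ y, Real.exp (γ * surprisal f y - Φ) =
      Real.exp (γ * surprisal f y) * Real.exp (-Φ) := fun y => by
    rw [← Real.exp_add, sub_eq_add_neg]
  have hexp' : Integrable (fun y => Real.exp (γ * surprisal f y - Φ)) (noiseLawN p n) := by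
    simpa only [hexp_sub] using hexp.mul_const _
  have hone : ∫ y, Real.exp (γ * surprisal f y - Φ) ∂noiseLawN p n = 1 := by
    simp only [hexp_sub]
    rw [integral_mul_const, ← mgf, ← exp_cgf hexp, ← Real.exp_add, add_neg_cancel, Real.exp_zero]
  obtain ⟨htest, htest_le⟩ := integrable_and_integral_le_of_klDiv_le
    (b := fun y => γ * surprisal f y - Φ) (by fun_prop) (β := γ * -Real.log B - Φ)
    (fun y => by
      have := mul_le_mul_of_nonneg_left (neg_log_le_surprisal (hf0 y) hB1 (hB y)) hγ.le
      linarith) hexp' hΔ hcov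
  rw [hone, sub_add_cancel] at htest_le
  have hcross : ∀ y, γ * surprisal f y - Φ - surprisal f y =
      (1 - γ⁻¹) * (γ * surprisal f y - Φ) - γ⁻¹ * Φ := fun y => by
    field_simp
    ring
  have hac := (klDiv_ne_top_iff.1 (ne_top_of_le_ne_top ENNReal.ofReal_ne_top hcov)).1
  have hfano := C.one_sub_avgError_mul_log_numMsg_le hf hf0 hμ hs (by fun_prop) hexp' hone.le hac
    (by simp only [hcross]; exact (htest.const_mul _).sub (integrable_const _))
  simp only [hcross] at hfano
  rw [integral_sub (htest.const_mul _) (integrable_const _), integral_const_mul] at hfano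
  have htilt := mul_le_mul_of_nonneg_left htest_le (sub_nonneg.2 ((one_le_inv₀ hγ).2 hγ1))
  simp only [integral_const, probReal_univ, smul_eq_mul, one_mul] at hfano
  rw [div_eq_inv_mul]
  linarith

end OneShotConverse

end Code

section SoftCovering

lemma mul_log_add_le {a u N s : ℝ} (ha : 0 ≤ a) (hu : 0 ≤ u) (hN : 0 < N) (hs : 0 < s)
    (hs1 : s ≤ 1) :
    a * Real.log (a / N + u) ≤ (s * N ^ s)⁻¹ * (a * a ^ s) + a * (u - 1) := by
  rcases ha.eq_or_lt with rfl | ha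
  · simp
  have hsum : 0 < a / N + u := by positivity
  have hlog : Real.log (a / N + u) ≤ ((a / N + u) ^ s - 1) / s := by
    rw [le_div_iff₀ hs, mul_comm, ← Real.log_rpow hsum]
    exact Real.log_le_sub_one_of_pos (by positivity)
  have hsub : (a / N + u) ^ s ≤ a ^ s / N ^ s + u ^ s := by
    rw [← Real.div_rpow ha.le hN.le]
    exact Real.rpow_add_le_add_rpow (by positivity) hu hs.le hs1
  have hbern : u ^ s ≤ 1 + s * (u - 1) := by
    simpa using rpow_one_add_le_one_add_mul_self (s := u - 1) (by linarith) hs.le hs1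
  calc a * Real.log (a / N + u) ≤ a * ((a ^ s / N ^ s + s * (u - 1)) / s) := by
        gcongr
        exact hlog.trans (by gcongr; linarith)
    _ = (s * N ^ s)⁻¹ * (a * a ^ s) + a * (u - 1) := by
        field_simp

variable {X J : Type*} [MeasurableSpace X] [Fintype J]

lemma klFun_average_add_le [DecidableEq J] [Nonempty J] {a : J → ℝ} (ha : ∀ j, 0 ≤ a j) {s : ℝ}
    (hs : 0 < s) (hs1 : s ≤ 1) :
    klFun ((Fintype.card J : ℝ)⁻¹ * ∑ j, a j) + 2 * ((Fintype.card J : ℝ)⁻¹ * ∑ j, a j) ≤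
      (Fintype.card J : ℝ)⁻¹ * ∑ j, ((s * (Fintype.card J : ℝ) ^ s)⁻¹ * (a j * a j ^ s) +
        a j * ((Fintype.card J : ℝ)⁻¹ * ∑ i ∈ Finset.univ.erase j, a i)) + 1 := by
  set N := (Fintype.card J : ℝ)
  have hN0 : 0 < N := Nat.cast_pos.2 Fintype.card_pos
  set t := N⁻¹ * ∑ j, a j with ht
  set u : J → ℝ := fun j => N⁻¹ * ∑ i ∈ Finset.univ.erase j, a i with hu
  have hsplit : ∀ j, t = a j / N + u j := fun j => by
    rw [ht, hu, ← Finset.add_sum_erase _ _ (Finset.mem_univ j), mul_add, inv_mul_eq_div]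
  have hterm : ∀ j, a j * Real.log t ≤ (s * N ^ s)⁻¹ * (a j * a j ^ s) + a j * (u j - 1) :=
    fun j => hsplit j ▸ mul_log_add_le (ha j)
      (mul_nonneg (inv_nonneg.2 hN0.le) (Finset.sum_nonneg fun i _ => ha i)) hN0 hs hs1
  have hmain : t * Real.log t ≤
      N⁻¹ * ∑ j, ((s * N ^ s)⁻¹ * (a j * a j ^ s) + a j * u j) - t := by
    calc t * Real.log t = N⁻¹ * ∑ j, a j * Real.log t := by rw [ht, mul_assoc, Finset.sum_mul]
      _ ≤ N⁻¹ * ∑ j, ((s * N ^ s)⁻¹ * (a j * a j ^ s) + a j * (u j - 1)) := by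
          gcongr with j; exact hterm j
      _ = N⁻¹ * ∑ j, ((s * N ^ s)⁻¹ * (a j * a j ^ s) + a j * u j) - t := by
          rw [ht, ← mul_sub, ← Finset.sum_sub_distrib]
          simp only [mul_sub, mul_one, add_sub_assoc]
  rw [klFun_apply]
  linarith

lemma ofReal_average {a : J → ℝ} (ha : ∀ j, 0 ≤ a j) :
    ENNReal.ofReal ((Fintype.card J : ℝ)⁻¹ * ∑ j, a j) =
      (Fintype.card J : ℝ≥0∞)⁻¹ * ∑ j, ENNReal.ofReal (a j) := by
  cases isEmpty_or_nonempty J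
  · simp
  · rw [ENNReal.ofReal_mul (by positivity), ENNReal.ofReal_sum_of_nonneg fun j _ => ha j,
      ENNReal.ofReal_inv_of_pos (Nat.cast_pos.2 Fintype.card_pos), ENNReal.ofReal_natCast]

lemma lintegral_ofReal_average {Ω : Type*} [MeasurableSpace Ω] {μ : Measure Ω} {F : J → Ω → ℝ}
    (hF : ∀ j, Measurable (F j)) (hF0 : ∀ j ω, 0 ≤ F j ω) :
    ∫⁻ ω, ENNReal.ofReal ((Fintype.card J : ℝ)⁻¹ * ∑ j, F j ω) ∂μ =
      (Fintype.card J : ℝ≥0∞)⁻¹ * ∑ j, ∫⁻ ω, ENNReal.ofReal (F j ω) ∂μ := by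
  simp_rw [fun ω => ofReal_average fun j => hF0 j ω]
  rw [lintegral_const_mul _ (by fun_prop), lintegral_finsetSum _ (by fun_prop)]

lemma average_const [Nonempty J] (x : ℝ≥0∞) : (Fintype.card J : ℝ≥0∞)⁻¹ * ∑ _j : J, x = x := by
  rw [Finset.sum_const, Finset.card_univ, nsmul_eq_mul, ← mul_assoc,
    ENNReal.inv_mul_cancel (by simp) (by simp), one_mul]

variable {P : Measure X} [IsProbabilityMeasure P]

lemma measurePreserving_eval_pair {i j : J} (hij : i ≠ j) :
    MeasurePreserving (fun c : J → X => (c i, c j)) (Measure.pi fun _ => P) (P.prod P) := by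
  refine ⟨by fun_prop, ?_⟩
  have hind := (iIndepFun_pi (μ := fun _ : J => P) (X := fun _ => id)
    fun _ => aemeasurable_id).indepFun hij
  rw [(indepFun_iff_map_prod_eq_prod_map_map (measurable_pi_apply i).aemeasurable
    (measurable_pi_apply j).aemeasurable).1 hind,
    (measurePreserving_eval (fun _ : J => P) i).map_eq,
    (measurePreserving_eval (fun _ : J => P) j).map_eq]

lemma lintegral_ofReal_average_eval [Nonempty J] {φ : X → ℝ} (hφ : Measurable φ)
    (hφ0 : ∀ x, 0 ≤ φ x) :
    ∫⁻ c : J → X, ENNReal.ofReal ((Fintype.card J : ℝ)⁻¹ * ∑ j, φ (c j)) ∂(Measure.pi fun _ => P) =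
      ∫⁻ x, ENNReal.ofReal (φ x) ∂P := by
  rw [lintegral_ofReal_average (F := fun j (c : J → X) => φ (c j)) (by fun_prop)
    fun j c => hφ0 (c j)]
  simp_rw [fun j => (measurePreserving_eval (fun _ : J => P) j).lintegral_comp
    (f := fun x => ENNReal.ofReal (φ x)) (by fun_prop)]
  exact average_const _

lemma lintegral_mul_average_erase_le [DecidableEq J] {φ : X → ℝ} (hφ : Measurable φ)
    (hφ0 : ∀ x, 0 ≤ φ x) (hφ1 : ∫⁻ x, ENNReal.ofReal (φ x) ∂P = 1) (j : J) :
    ∫⁻ c : J → X, ENNReal.ofReal (φ (c j) *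
        ((Fintype.card J : ℝ)⁻¹ * ∑ i ∈ Finset.univ.erase j, φ (c i))) ∂(Measure.pi fun _ => P) ≤
      1 := by
  have : Nonempty J := ⟨j⟩
  have hN : (0 : ℝ) < Fintype.card J := Nat.cast_pos.2 Fintype.card_pos
  have hpair : ∀ i ∈ Finset.univ.erase j, ∫⁻ c : J → X,
      ENNReal.ofReal (φ (c j)) * ENNReal.ofReal (φ (c i)) ∂(Measure.pi fun _ => P) = 1 := by
    intro i hi
    rw [(measurePreserving_eval_pair (P := P) (Finset.ne_of_mem_erase hi).symm).lintegral_comp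
        (f := fun q => ENNReal.ofReal (φ q.1) * ENNReal.ofReal (φ q.2)) (by fun_prop),
      lintegral_prod_mul (f := fun x => ENNReal.ofReal (φ x))
        (g := fun x => ENNReal.ofReal (φ x)) (by fun_prop) (by fun_prop), hφ1, one_mul]
  calc ∫⁻ c : J → X, ENNReal.ofReal (φ (c j) *
        ((Fintype.card J : ℝ)⁻¹ * ∑ i ∈ Finset.univ.erase j, φ (c i))) ∂(Measure.pi fun _ => P)
      = ∫⁻ c : J → X, (Fintype.card J : ℝ≥0∞)⁻¹ * ∑ i ∈ Finset.univ.erase j,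
          ENNReal.ofReal (φ (c j)) * ENNReal.ofReal (φ (c i)) ∂(Measure.pi fun _ => P) := by
        refine lintegral_congr fun c => ?_
        rw [mul_left_comm, Finset.mul_sum, ENNReal.ofReal_mul (by positivity),
          ENNReal.ofReal_sum_of_nonneg fun i _ => mul_nonneg (hφ0 _) (hφ0 _),
          ENNReal.ofReal_inv_of_pos hN, ENNReal.ofReal_natCast]
        simp_rw [ENNReal.ofReal_mul (hφ0 _)]
    _ = (Fintype.card J : ℝ≥0∞)⁻¹ * ∑ _i ∈ Finset.univ.erase j, 1 := by
        rw [lintegral_const_mul _ (by fun_prop), lintegral_finsetSum _ (by fun_prop),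
          Finset.sum_congr rfl hpair]
    _ ≤ (Fintype.card J : ℝ≥0∞)⁻¹ * ∑ _i : J, 1 := by
        gcongr
        exact Finset.erase_subset _ _
    _ = 1 := average_const 1

lemma lintegral_add_mul_average_erase_le [DecidableEq J] {φ : X → ℝ} (hφ : Measurable φ)
    (hφ0 : ∀ x, 0 ≤ φ x) (hφ1 : ∫⁻ x, ENNReal.ofReal (φ x) ∂P = 1) {h : X → ℝ} (hh : Measurable h)
    (hh0 : ∀ x, 0 ≤ h x) (j : J) :
    ∫⁻ c : J → X, ENNReal.ofReal (h (c j) +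
        φ (c j) * ((Fintype.card J : ℝ)⁻¹ * ∑ i ∈ Finset.univ.erase j, φ (c i)))
        ∂(Measure.pi fun _ => P) ≤ ∫⁻ x, ENNReal.ofReal (h x) ∂P + 1 := by
  have hnonneg (c : J → X) :
      0 ≤ φ (c j) * ((Fintype.card J : ℝ)⁻¹ * ∑ i ∈ Finset.univ.erase j, φ (c i)) :=
    mul_nonneg (hφ0 _) (mul_nonneg (by positivity) (Finset.sum_nonneg fun i _ => hφ0 _))
  simp_rw [fun c : J → X => ENNReal.ofReal_add (hh0 (c j)) (hnonneg c)]
  rw [lintegral_add_left (by fun_prop), (measurePreserving_eval (fun _ : J => P) j).lintegral_comp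
    (f := fun x => ENNReal.ofReal (h x)) (by fun_prop)]
  gcongr
  exact lintegral_mul_average_erase_le hφ hφ0 hφ1 j

lemma lintegral_klFun_add_two_mul {Ω : Type*} [MeasurableSpace Ω] {μ : Measure Ω} {t : Ω → ℝ}
    (ht : Measurable t) (ht0 : ∀ ω, 0 ≤ t ω) :
    ∫⁻ ω, ENNReal.ofReal (klFun (t ω) + 2 * t ω) ∂μ =
      ∫⁻ ω, ENNReal.ofReal (klFun (t ω)) ∂μ + 2 * ∫⁻ ω, ENNReal.ofReal (t ω) ∂μ := by
  simp_rw [fun ω => ENNReal.ofReal_add (klFun_nonneg (ht0 ω)) (mul_nonneg zero_le_two (ht0 ω)),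
    ENNReal.ofReal_mul zero_le_two]
  rw [lintegral_add_right _ (by fun_prop), lintegral_const_mul _ (by fun_prop),
    ENNReal.ofReal_ofNat]

lemma lintegral_klFun_average_le [Nonempty J] {φ : X → ℝ} (hφ : Measurable φ)
    (hφ0 : ∀ x, 0 ≤ φ x) (hφ1 : ∫⁻ x, ENNReal.ofReal (φ x) ∂P = 1) {s : ℝ} (hs : 0 < s)
    (hs1 : s ≤ 1) :
    ∫⁻ c : J → X, ENNReal.ofReal (klFun ((Fintype.card J : ℝ)⁻¹ * ∑ j, φ (c j)))
        ∂(Measure.pi fun _ => P) ≤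
      ENNReal.ofReal (s * (Fintype.card J : ℝ) ^ s)⁻¹ *
        ∫⁻ x, ENNReal.ofReal (φ x * φ x ^ s) ∂P := by
  classical
  set P' := Measure.pi fun _ : J => P
  set A := ∫⁻ x, ENNReal.ofReal (φ x * φ x ^ s) ∂P
  set κ := (s * (Fintype.card J : ℝ) ^ s)⁻¹
  let t : (J → X) → ℝ := fun c => (Fintype.card J : ℝ)⁻¹ * ∑ j, φ (c j)
  let a : J → (J → X) → ℝ := fun j c => κ * (φ (c j) * φ (c j) ^ s)
  let b : J → (J → X) → ℝ := fun j c =>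
    φ (c j) * ((Fintype.card J : ℝ)⁻¹ * ∑ i ∈ Finset.univ.erase j, φ (c i))
  have hκ0 : 0 ≤ κ := by positivity
  have ht0 : ∀ c, 0 ≤ t c := fun c =>
    mul_nonneg (by positivity) (Finset.sum_nonneg fun j _ => hφ0 (c j))
  have ha0 : ∀ j c, 0 ≤ a j c := fun j c =>
    mul_nonneg hκ0 (mul_nonneg (hφ0 _) (Real.rpow_nonneg (hφ0 _) s))
  have hb0 : ∀ j c, 0 ≤ b j c := fun j c =>
    mul_nonneg (hφ0 _) (mul_nonneg (by positivity) (Finset.sum_nonneg fun i _ => hφ0 _))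
  have ht1 : ∫⁻ c, ENNReal.ofReal (t c) ∂P' = 1 := (lintegral_ofReal_average_eval hφ hφ0).trans hφ1
  have hterm (j : J) : ∫⁻ c, ENNReal.ofReal (a j c + b j c) ∂P' ≤ ENNReal.ofReal κ * A + 1 := by
    refine (lintegral_add_mul_average_erase_le (h := fun x => κ * (φ x * φ x ^ s)) hφ hφ0 hφ1
      (by fun_prop) (fun x => ?_) j).trans_eq ?_
    · exact mul_nonneg hκ0 (mul_nonneg (hφ0 x) (Real.rpow_nonneg (hφ0 x) s))
    · simp_rw [ENNReal.ofReal_mul hκ0]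
      rw [lintegral_const_mul _ (by fun_prop)]
  -- Adding `2`, the integral of `2 * t`, keeps subtraction out of the pointwise bound.
  refine (ENNReal.add_le_add_iff_right (a := 2) (by simp)).1 ?_
  calc ∫⁻ c, ENNReal.ofReal (klFun (t c)) ∂P' + 2
      = ∫⁻ c, ENNReal.ofReal (klFun (t c) + 2 * t c) ∂P' := by
        rw [lintegral_klFun_add_two_mul (by fun_prop) ht0, ht1, mul_one]
    _ ≤ ∫⁻ c, ENNReal.ofReal ((Fintype.card J : ℝ)⁻¹ * ∑ j, (a j c + b j c) + 1) ∂P' :=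
        lintegral_mono fun c => ENNReal.ofReal_le_ofReal
          (klFun_average_add_le (fun j => hφ0 (c j)) hs hs1)
    _ = (Fintype.card J : ℝ≥0∞)⁻¹ * ∑ j, ∫⁻ c, ENNReal.ofReal (a j c + b j c) ∂P' + 1 := by
        have hsum0 : ∀ c, 0 ≤ (Fintype.card J : ℝ)⁻¹ * ∑ j, (a j c + b j c) := fun c =>
          mul_nonneg (by positivity) (Finset.sum_nonneg fun j _ => add_nonneg (ha0 j c) (hb0 j c))
        simp_rw [fun c => ENNReal.ofReal_add (hsum0 c) zero_le_one]
        rw [lintegral_add_right _ measurable_const, lintegral_ofReal_average (by fun_prop)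
          fun j c => add_nonneg (ha0 j c) (hb0 j c), ENNReal.ofReal_one, lintegral_const,
          measure_univ, mul_one]
    _ ≤ ENNReal.ofReal κ * A + 2 := by
        rw [← one_add_one_eq_two, ← add_assoc, ← average_const (J := J) (ENNReal.ofReal κ * A + 1)]
        gcongr with j
        exact hterm j

lemma klFun_mul_add {t w : ℝ} (ht : 0 ≤ t) (hw : 0 ≤ w) :
    klFun (t * w) + (w + t) = w * klFun t + (klFun w * t + (1 + w * t)) := by
  rcases ht.eq_or_lt with rfl | ht
  · simp [klFun_zero, add_comm]
  rcases hw.eq_or_lt with rfl | hw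
  · simp [klFun_zero, add_comm]
  simp only [klFun_apply, Real.log_mul ht.ne' hw.ne']
  ring

lemma lintegral_klFun_mul_le {Ω : Type*} [MeasurableSpace Ω] {μ : Measure Ω}
    [IsProbabilityMeasure μ] {t : Ω → ℝ} (ht : Measurable t) (ht0 : ∀ ω, 0 ≤ t ω) {w : ℝ}
    (hw : 0 ≤ w) (ht1 : w ≠ 0 → ∫⁻ ω, ENNReal.ofReal (t ω) ∂μ = 1) :
    ∫⁻ ω, ENNReal.ofReal (klFun (t ω * w)) ∂μ ≤
      ENNReal.ofReal w * ∫⁻ ω, ENNReal.ofReal (klFun (t ω)) ∂μ + ENNReal.ofReal (klFun w) := by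
  rcases eq_or_ne w 0 with rfl | hw0
  · simp
  have hadd : ∀ ω, ENNReal.ofReal (klFun (t ω * w)) + (ENNReal.ofReal w + ENNReal.ofReal (t ω)) =
      ENNReal.ofReal w * ENNReal.ofReal (klFun (t ω)) + (ENNReal.ofReal (klFun w) *
        ENNReal.ofReal (t ω) + (1 + ENNReal.ofReal w * ENNReal.ofReal (t ω))) := fun ω => by
    have hklt := klFun_nonneg (ht0 ω)
    have hklw := klFun_nonneg hw
    have hkl := klFun_nonneg (mul_nonneg (ht0 ω) hw)
    have ht := ht0 ω
    rw [← ENNReal.ofReal_one, ← ENNReal.ofReal_mul hw, ← ENNReal.ofReal_mul hw,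
      ← ENNReal.ofReal_mul hklw, ← ENNReal.ofReal_add (by positivity) (by positivity),
      ← ENNReal.ofReal_add (by positivity) (by positivity),
      ← ENNReal.ofReal_add (by positivity) (by positivity),
      ← ENNReal.ofReal_add (by positivity) (by positivity),
      ← ENNReal.ofReal_add (by positivity) (by positivity), klFun_mul_add ht hw]
  have hint := lintegral_congr (μ := μ) hadd
  rw [lintegral_add_left (by fun_prop), lintegral_add_left (by fun_prop),
    lintegral_add_left (by fun_prop), lintegral_add_left (by fun_prop),
    lintegral_add_left (by fun_prop), lintegral_const_mul _ (by fun_prop),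
    lintegral_const_mul _ (by fun_prop), lintegral_const_mul _ (by fun_prop), ht1 hw0] at hint
  simp only [lintegral_const, measure_univ, mul_one] at hint
  rw [← ENNReal.add_le_add_iff_right (a := ENNReal.ofReal w + 1) (by simp), hint]
  exact le_of_eq (by ring)

lemma lintegral_klFun_average_mul_le [Nonempty J] {φ : X → ℝ} (hφ : Measurable φ)
    (hφ0 : ∀ x, 0 ≤ φ x) {w : ℝ} (hw : 0 ≤ w) (hφ1 : w ≠ 0 → ∫⁻ x, ENNReal.ofReal (φ x) ∂P = 1)
    {s : ℝ} (hs : 0 < s) (hs1 : s ≤ 1) :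
    ∫⁻ c : J → X, ENNReal.ofReal (klFun (((Fintype.card J : ℝ)⁻¹ * ∑ j, φ (c j)) * w))
        ∂(Measure.pi fun _ => P) ≤
      ENNReal.ofReal w * (ENNReal.ofReal (s * (Fintype.card J : ℝ) ^ s)⁻¹ *
        ∫⁻ x, ENNReal.ofReal (φ x * φ x ^ s) ∂P) + ENNReal.ofReal (klFun w) := by
  refine (lintegral_klFun_mul_le (by fun_prop)
    (fun c => mul_nonneg (by positivity) (Finset.sum_nonneg fun j _ => hφ0 (c j))) hw
    fun h => (lintegral_ofReal_average_eval hφ hφ0).trans (hφ1 h)).trans ?_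
  rcases eq_or_ne w 0 with rfl | hw0
  · simp
  · gcongr
    exact lintegral_klFun_average_le hφ hφ0 (hφ1 hw0) hs hs1

end SoftCovering

section Channel

variable {X Y : Type*} [MeasurableSpace X] [MeasurableSpace Y] {P : Measure X} {W : Kernel X Y}
  {r : X → Y → ℝ}

/-- The function `r` is the likelihood ratio of the channel `W` with input law `P`: the density
of the law `W x` of the output given the input `x` with respect to the output law. -/
structure IsLikelihoodRatio (P : Measure X) (W : Kernel X Y) (r : X → Y → ℝ) : Prop where
  measurable : Measurable fun q : X × Y => r q.1 q.2
  nonneg : ∀ x y, 0 ≤ r x y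
  withDensity_eq : ∀ᵐ x ∂P, (W ∘ₘ P).withDensity (fun y => ENNReal.ofReal (r x y)) = W x

lemma IsLikelihoodRatio.ae_lintegral_eq_one [SFinite P] [IsFiniteMeasure (W ∘ₘ P)]
    (hr : IsLikelihoodRatio P W r) :
    ∀ᵐ y ∂(W ∘ₘ P), ∫⁻ x, ENNReal.ofReal (r x y) ∂P = 1 := by
  have hmeas := hr.measurable
  have hmarg : Measurable fun y => ∫⁻ x, ENNReal.ofReal (r x y) ∂P :=
    Measurable.lintegral_prod_left' (f := fun q : X × Y => ENNReal.ofReal (r q.1 q.2))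
      (by fun_prop)
  refine (withDensity_eq_iff_of_sigmaFinite hmarg.aemeasurable aemeasurable_const).1 ?_
  ext s hs
  rw [withDensity_apply _ hs, withDensity_const, one_smul, lintegral_lintegral_swap
    (by fun_prop), Measure.bind_apply hs W.aemeasurable]
  refine lintegral_congr_ae ?_
  filter_upwards [hr.withDensity_eq] with x hx
  rw [← hx, withDensity_apply _ hs]

lemma IsLikelihoodRatio.lintegral_mul (hr : IsLikelihoodRatio P W r) {h : X → Y → ℝ≥0∞}
    (hh : Measurable fun q : X × Y => h q.1 q.2) :
    ∫⁻ x, ∫⁻ y, ENNReal.ofReal (r x y) * h x y ∂(W ∘ₘ P) ∂P = ∫⁻ x, ∫⁻ y, h x y ∂W x ∂P := by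
  have hmeas := hr.measurable
  refine lintegral_congr_ae ?_
  filter_upwards [hr.withDensity_eq] with x hx
  rw [← hx, lintegral_withDensity_eq_lintegral_mul _ (by fun_prop) (by fun_prop)]
  rfl

lemma IsLikelihoodRatio.lintegral_inv_le [IsProbabilityMeasure P] [IsFiniteMeasure (W ∘ₘ P)]
    (hr : IsLikelihoodRatio P W r) :
    ∫⁻ x, ∫⁻ y, ENNReal.ofReal (r x y)⁻¹ ∂W x ∂P ≤ (W ∘ₘ P) Set.univ := by
  have hmeas := hr.measurable
  calc _ = ∫⁻ x, ∫⁻ y, ENNReal.ofReal (r x y) * ENNReal.ofReal (r x y)⁻¹ ∂(W ∘ₘ P) ∂P :=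
        (hr.lintegral_mul (by fun_prop)).symm
    _ ≤ ∫⁻ _, ∫⁻ _, 1 ∂(W ∘ₘ P) ∂P := by
        gcongr with x y
        rw [← ENNReal.ofReal_mul (hr.nonneg x y), ← ENNReal.ofReal_one]
        exact ENNReal.ofReal_le_ofReal (mul_inv_le_one_of_le₀ le_rfl (hr.nonneg x y))
    _ = _ := by simp

variable {J : Type*} [Fintype J]

/-- The output law of the channel `W` when its input is drawn uniformly from the codebook `c`. -/
def codebookLaw (W : Kernel X Y) (c : J → X) : Measure Y :=
  (Fintype.card J : ℝ≥0∞)⁻¹ • ∑ j, W (c j)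

instance [Nonempty J] [IsMarkovKernel W] (c : J → X) : IsProbabilityMeasure (codebookLaw W c) :=
  ⟨by simp [codebookLaw, ENNReal.inv_mul_cancel]⟩

lemma IsLikelihoodRatio.ae_codebookLaw_eq [IsProbabilityMeasure P] (hr : IsLikelihoodRatio P W r) :
    ∀ᵐ c ∂(Measure.pi fun _ : J => P), codebookLaw W c = (W ∘ₘ P).withDensity
      fun y => ENNReal.ofReal ((Fintype.card J : ℝ)⁻¹ * ∑ j, r (c j) y) := by
  have hmeas := hr.measurable
  have hrat : ∀ᵐ c ∂(Measure.pi fun _ : J => P), ∀ j,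
      (W ∘ₘ P).withDensity (fun y => ENNReal.ofReal (r (c j) y)) = W (c j) :=
    ae_all_iff.2 fun j =>
      (measurePreserving_eval (fun _ : J => P) j).quasiMeasurePreserving.ae hr.withDensity_eq
  filter_upwards [hrat] with c hc
  ext s hs
  simp_rw [fun y => ofReal_average fun j => hr.nonneg (c j) y]
  rw [codebookLaw, withDensity_apply _ hs, lintegral_const_mul _ (by fun_prop),
    lintegral_finsetSum _ (by fun_prop)]
  simp only [← hc, withDensity_apply _ hs, Measure.smul_apply, Measure.coe_finsetSum,
    Finset.sum_apply, smul_eq_mul]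

lemma klDiv_withDensity_withDensity {Q : Measure Y} [IsFiniteMeasure Q] {t w : Y → ℝ}
    (ht : Measurable t) (ht0 : ∀ y, 0 ≤ t y) (hw : Measurable w)
    [IsFiniteMeasure ((Q.withDensity fun y => ENNReal.ofReal (w y)).withDensity
      fun y => ENNReal.ofReal (t y))] (hw0 : ∀ y, 0 ≤ w y) :
    klDiv ((Q.withDensity fun y => ENNReal.ofReal (w y)).withDensity
      fun y => ENNReal.ofReal (t y)) Q = ∫⁻ y, ENNReal.ofReal (klFun (t y * w y)) ∂Q := by
  rw [klDiv_eq_lintegral_klFun_of_ac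
    ((withDensity_absolutelyContinuous _ _).trans (withDensity_absolutelyContinuous _ _))]
  refine lintegral_congr_ae ?_
  rw [← withDensity_mul _ (by fun_prop) (by fun_prop)]
  filter_upwards [Q.rnDeriv_withDensity ((hw.ennreal_ofReal).mul ht.ennreal_ofReal)] with y hy
  rw [hy, Pi.mul_apply, ← ENNReal.ofReal_mul (hw0 y), mul_comm,
    ENNReal.toReal_ofReal (mul_nonneg (ht0 y) (hw0 y))]

lemma withDensity_ofReal_toReal_rnDeriv {μ ν : Measure Y} [μ.HaveLebesgueDecomposition ν]
    [SigmaFinite μ] (hac : μ ≪ ν) :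
    ν.withDensity (fun y => ENNReal.ofReal (μ.rnDeriv ν y).toReal) = μ := by
  refine (withDensity_congr_ae ?_).trans (Measure.withDensity_rnDeriv_eq _ _ hac)
  filter_upwards [μ.rnDeriv_lt_top ν] with y hy
  rw [ENNReal.ofReal_toReal hy.ne]

lemma IsLikelihoodRatio.ae_klDiv_codebookLaw_eq [Nonempty J] [IsProbabilityMeasure P]
    [IsMarkovKernel W] (hr : IsLikelihoodRatio P W r) {Q : Measure Y} [IsFiniteMeasure Q]
    {w : Y → ℝ} (hw : Measurable w) (hw0 : ∀ y, 0 ≤ w y)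
    (hQ : W ∘ₘ P = Q.withDensity fun y => ENNReal.ofReal (w y)) :
    ∀ᵐ c ∂(Measure.pi fun _ : J => P), klDiv (codebookLaw W c) Q =
      ∫⁻ y, ENNReal.ofReal (klFun ((Fintype.card J : ℝ)⁻¹ * (∑ j, r (c j) y) * w y)) ∂Q := by
  have hmeas := hr.measurable
  filter_upwards [hr.ae_codebookLaw_eq (J := J)] with c hc
  have : IsProbabilityMeasure (codebookLaw W c) := inferInstance
  rw [hc, hQ] at this
  rw [hc, hQ]
  exact klDiv_withDensity_withDensity (by fun_prop) (fun y =>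
    mul_nonneg (by positivity) (Finset.sum_nonneg fun j _ => hr.nonneg _ _)) hw hw0

lemma IsLikelihoodRatio.lintegral_klDiv_codebookLaw_le [Nonempty J] [IsProbabilityMeasure P]
    [IsMarkovKernel W] (hr : IsLikelihoodRatio P W r) {Q : Measure Y} [IsFiniteMeasure Q]
    (hac : W ∘ₘ P ≪ Q) {s : ℝ} (hs : 0 < s) (hs1 : s ≤ 1) :
    ∫⁻ c : J → X, klDiv (codebookLaw W c) Q ∂(Measure.pi fun _ => P) ≤
      ENNReal.ofReal (s * (Fintype.card J : ℝ) ^ s)⁻¹ *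
        ∫⁻ x, ∫⁻ y, ENNReal.ofReal (r x y ^ s) ∂W x ∂P + klDiv (W ∘ₘ P) Q := by
  have hmeas := hr.measurable
  set κ := ENNReal.ofReal (s * (Fintype.card J : ℝ) ^ s)⁻¹
  let w : Y → ℝ := fun y => ((W ∘ₘ P).rnDeriv Q y).toReal
  let t : (J → X) → Y → ℝ := fun c y => (Fintype.card J : ℝ)⁻¹ * ∑ j, r (c j) y
  have hw := (withDensity_ofReal_toReal_rnDeriv hac).symm
  have hmarg : Measurable fun y => ∫⁻ x, ENNReal.ofReal (r x y * r x y ^ s) ∂P :=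
    Measurable.lintegral_prod_left'
      (f := fun q : X × Y => ENNReal.ofReal (r q.1 q.2 * r q.1 q.2 ^ s)) (by fun_prop)
  have hone : ∀ᵐ y ∂Q, w y ≠ 0 → ∫⁻ x, ENNReal.ofReal (r x y) ∂P = 1 := by
    have := hr.ae_lintegral_eq_one
    rw [hw, ae_withDensity_iff (by fun_prop)] at this
    filter_upwards [this] with y hy hy0
    exact hy (ENNReal.ofReal_pos.2 (ENNReal.toReal_nonneg.lt_of_ne' hy0)).ne'
  calc ∫⁻ c : J → X, klDiv (codebookLaw W c) Q ∂(Measure.pi fun _ => P)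
      = ∫⁻ c : J → X, ∫⁻ y, ENNReal.ofReal (klFun (t c y * w y)) ∂Q ∂(Measure.pi fun _ => P) :=
        lintegral_congr_ae (hr.ae_klDiv_codebookLaw_eq (by fun_prop)
          (fun y => ENNReal.toReal_nonneg) hw)
    _ = ∫⁻ y, ∫⁻ c : J → X, ENNReal.ofReal (klFun (t c y * w y)) ∂(Measure.pi fun _ => P) ∂Q :=
        lintegral_lintegral_swap (by fun_prop)
    _ ≤ ∫⁻ y, (ENNReal.ofReal (w y) * (κ * ∫⁻ x, ENNReal.ofReal (r x y * r x y ^ s) ∂P) +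
          ENNReal.ofReal (klFun (w y))) ∂Q := by
        refine lintegral_mono_ae ?_
        filter_upwards [hone] with y hy
        exact lintegral_klFun_average_mul_le (by fun_prop) (fun x => hr.nonneg x y)
          ENNReal.toReal_nonneg hy hs hs1
    _ = κ * ∫⁻ y, ∫⁻ x, ENNReal.ofReal (r x y * r x y ^ s) ∂P ∂(W ∘ₘ P) + klDiv (W ∘ₘ P) Q := by
        rw [lintegral_add_right _ (by fun_prop), ← klDiv_eq_lintegral_klFun_of_ac hac,
          ← lintegral_const_mul _ hmarg]
        congr 1
        conv_rhs => rw [hw]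
        exact (lintegral_withDensity_eq_lintegral_mul _ (by fun_prop) (hmarg.const_mul κ)).symm
    _ = κ * ∫⁻ x, ∫⁻ y, ENNReal.ofReal (r x y ^ s) ∂W x ∂P + klDiv (W ∘ₘ P) Q := by
        simp_rw [fun x y => ENNReal.ofReal_mul (q := r x y ^ s) (hr.nonneg x y)]
        rw [lintegral_lintegral_swap (by fun_prop), hr.lintegral_mul (by fun_prop)]

variable {M K : ℕ}

/-- The probability of decoding error of the codebook `c`, indexed by messages and keys, with the
decoder `d`, averaged over the message and the key. -/
def codebookError (W : Kernel X Y) (c : Fin M × Fin K → X) (d : Y → Fin K → Fin M) : ℝ≥0∞ :=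
  (Fintype.card (Fin M × Fin K) : ℝ≥0∞)⁻¹ * ∑ i, W (c i) {y | d y i.2 ≠ i.1}

/-- The union bound on the error of threshold decoding: either the likelihood ratio of the codeword
sent is at most `θ`, or that of another codeword with the same key exceeds `θ`. -/
def thresholdError (W : Kernel X Y) (r : X → Y → ℝ) (θ : ℝ) (c : Fin M × Fin K → X) : ℝ≥0∞ :=
  (Fintype.card (Fin M × Fin K) : ℝ≥0∞)⁻¹ * ∑ i, (W (c i) {y | r (c i) y ≤ θ} +
    ∑ m ∈ Finset.univ.erase i.1, W (c i) {y | θ < r (c (m, i.2)) y})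

lemma exists_measurable_decoder [NeZero M] {u : Fin M → Y → ℝ} (hu : ∀ m, Measurable (u m))
    (θ : ℝ) :
    ∃ d : Y → Fin M, Measurable d ∧ ∀ y m, θ < u m y → (∀ m' ≠ m, u m' y ≤ θ) → d y = m := by
  classical
  let select : (Fin M → Prop) → Fin M := fun b => if h : ∃ m, b m then h.choose else 0
  refine ⟨fun y => select fun m => θ < u m y, (Measurable.of_discrete (f := select)).comp
    (measurable_pi_lambda _ fun m => measurableSet_setOfPred.1
      (measurableSet_lt measurable_const (hu m))), fun y m hm hother => ?_⟩
  have hex : ∃ m, θ < u m y := ⟨m, hm⟩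
  simp only [select, dif_pos hex]
  by_contra hne
  exact absurd hex.choose_spec (not_lt.2 (hother _ hne))

lemma exists_decoder_codebookError_le [NeZero M] (hr : Measurable fun q : X × Y => r q.1 q.2)
    (θ : ℝ) (c : Fin M × Fin K → X) :
    ∃ d : Y → Fin K → Fin M, (∀ k, Measurable fun y => d y k) ∧
      codebookError W c d ≤ thresholdError W r θ c := by
  choose d hd hdec using fun k => exists_measurable_decoder (u := fun m y => r (c (m, k)) y)
    (by fun_prop) θ
  refine ⟨fun y k => d k y, hd, ?_⟩
  unfold codebookError thresholdError
  gcongr with i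
  have hsub : {y | d i.2 y ≠ i.1} ⊆ {y | r (c i) y ≤ θ} ∪
      ⋃ m ∈ Finset.univ.erase i.1, {y | θ < r (c (m, i.2)) y} := by
    intro y hy
    by_contra hnot
    simp only [Set.mem_union, Set.mem_iUnion, Set.mem_ofPred_eq, not_or, not_le, not_exists,
      not_lt, Finset.mem_erase, Finset.mem_univ, and_true] at hnot
    exact hy (hdec i.2 y i.1 hnot.1 hnot.2)
  exact (measure_mono hsub).trans ((measure_union_le _ _).trans
    (by gcongr; exact measure_biUnion_finset_le _ _))

lemma measurable_kernel_lt [IsSFiniteKernel W] (hr : Measurable fun q : X × Y => r q.1 q.2)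
    (θ : ℝ) {Ω : Type*} [MeasurableSpace Ω] {g h : Ω → X} (hg : Measurable g) (hh : Measurable h) :
    Measurable fun ω => W (g ω) {y | θ < r (h ω) y} :=
  Kernel.measurable_kernel_prodMk_left (κ := W.comap g hg) (t := {p : Ω × Y | θ < r (h p.1) p.2})
    (measurableSet_lt measurable_const
      (hr.comp ((hh.comp measurable_fst).prodMk measurable_snd)))

lemma measurable_kernel_le [IsSFiniteKernel W] (hr : Measurable fun q : X × Y => r q.1 q.2)
    (θ : ℝ) {Ω : Type*} [MeasurableSpace Ω] {g h : Ω → X} (hg : Measurable g) (hh : Measurable h) :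
    Measurable fun ω => W (g ω) {y | r (h ω) y ≤ θ} :=
  Kernel.measurable_kernel_prodMk_left (κ := W.comap g hg) (t := {p : Ω × Y | r (h p.1) p.2 ≤ θ})
    (measurableSet_le (hr.comp ((hh.comp measurable_fst).prodMk measurable_snd))
      measurable_const)

lemma IsLikelihoodRatio.lintegral_measure_lt_le [IsProbabilityMeasure P] [IsMarkovKernel W]
    (hr : IsLikelihoodRatio P W r) {θ : ℝ} (hθ : 0 < θ) :
    ∫⁻ q, W q.1 {y | θ < r q.2 y} ∂(P.prod P) ≤ (ENNReal.ofReal θ)⁻¹ := by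
  have hmeas := hr.measurable
  calc ∫⁻ q, W q.1 {y | θ < r q.2 y} ∂(P.prod P)
      = ∫⁻ x, (W ∘ₘ P) {y | θ < r x y} ∂P := by
        rw [lintegral_prod_symm' _ (measurable_kernel_lt hmeas θ measurable_fst measurable_snd)]
        exact lintegral_congr fun x => (Measure.bind_apply
          (measurableSet_lt measurable_const (hmeas.comp measurable_prodMk_left))
          W.aemeasurable).symm
    _ ≤ ∫⁻ x, (∫⁻ y, ENNReal.ofReal (r x y) ∂(W ∘ₘ P)) / ENNReal.ofReal θ ∂P := by
        gcongr with x
        refine (measure_mono fun y (hy : θ < r x y) => ENNReal.ofReal_le_ofReal hy.le).trans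
          (meas_ge_le_lintegral_div (f := fun y => ENNReal.ofReal (r x y)) (by fun_prop)
            (by simpa using hθ) ENNReal.ofReal_ne_top)
    _ = ∫⁻ _, 1 / ENNReal.ofReal θ ∂P := by
        refine lintegral_congr_ae ?_
        filter_upwards [hr.withDensity_eq] with x hx
        rw [← setLIntegral_univ, ← withDensity_apply _ MeasurableSet.univ, hx, measure_univ]
    _ = (ENNReal.ofReal θ)⁻¹ := by simp

lemma measurable_thresholdError_term [IsSFiniteKernel W]
    (hr : Measurable fun q : X × Y => r q.1 q.2) (θ : ℝ) (i : Fin M × Fin K) :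
    Measurable fun c : Fin M × Fin K → X => W (c i) {y | r (c i) y ≤ θ} +
      ∑ m ∈ Finset.univ.erase i.1, W (c i) {y | θ < r (c (m, i.2)) y} :=
  (measurable_kernel_le hr θ (measurable_pi_apply i) (measurable_pi_apply i)).add
    (Finset.measurable_fun_sum _ fun m _ =>
      measurable_kernel_lt hr θ (measurable_pi_apply i) (measurable_pi_apply (m, i.2)))

lemma IsLikelihoodRatio.lintegral_thresholdError_term_le [IsProbabilityMeasure P]
    [IsMarkovKernel W] (hr : IsLikelihoodRatio P W r) {θ : ℝ} (hθ : 0 < θ) (i : Fin M × Fin K) :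
    ∫⁻ c : Fin M × Fin K → X, (W (c i) {y | r (c i) y ≤ θ} +
        ∑ m ∈ Finset.univ.erase i.1, W (c i) {y | θ < r (c (m, i.2)) y})
        ∂(Measure.pi fun _ => P) ≤
      ∫⁻ x, W x {y | r x y ≤ θ} ∂P + M * (ENNReal.ofReal θ)⁻¹ := by
  have hpair : ∀ m ∈ Finset.univ.erase i.1, ∫⁻ c : Fin M × Fin K → X,
      W (c i) {y | θ < r (c (m, i.2)) y} ∂(Measure.pi fun _ => P) ≤ (ENNReal.ofReal θ)⁻¹ := by
    intro m hm
    have hne : i ≠ (m, i.2) := fun h => Finset.ne_of_mem_erase hm (Prod.ext_iff.1 h).1.symm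
    rw [(measurePreserving_eval_pair (P := P) hne).lintegral_comp
      (f := fun q => W q.1 {y | θ < r q.2 y})
      (measurable_kernel_lt hr.measurable θ measurable_fst measurable_snd)]
    exact hr.lintegral_measure_lt_le hθ
  rw [lintegral_add_left
      (measurable_kernel_le hr.measurable θ (measurable_pi_apply i) (measurable_pi_apply i)),
    lintegral_finsetSum _ fun m _ =>
      measurable_kernel_lt hr.measurable θ (measurable_pi_apply i) (measurable_pi_apply (m, i.2)),
    (measurePreserving_eval (fun _ : Fin M × Fin K => P) i).lintegral_comp
      (f := fun x => W x {y | r x y ≤ θ})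
      (measurable_kernel_le hr.measurable θ measurable_id measurable_id)]
  gcongr
  refine (Finset.sum_le_card_nsmul _ _ _ hpair).trans ?_
  rw [nsmul_eq_mul]
  gcongr
  simp

lemma IsLikelihoodRatio.lintegral_thresholdError_le [NeZero M] [NeZero K] [IsProbabilityMeasure P]
    [IsMarkovKernel W] (hr : IsLikelihoodRatio P W r) {θ : ℝ} (hθ : 0 < θ) :
    ∫⁻ c : Fin M × Fin K → X, thresholdError W r θ c ∂(Measure.pi fun _ => P) ≤
      ∫⁻ x, W x {y | r x y ≤ θ} ∂P + M * (ENNReal.ofReal θ)⁻¹ := by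
  have hterm := measurable_thresholdError_term (M := M) (K := K) (W := W) hr.measurable θ
  unfold thresholdError
  rw [lintegral_const_mul _ (by fun_prop), lintegral_finsetSum _ fun i _ => hterm i,
    ← average_const (J := Fin M × Fin K) (_ + _)]
  gcongr with i
  exact hr.lintegral_thresholdError_term_le hθ i

lemma exists_le_and_le_of_lintegral_div_add_lt_one {Ω : Type*} [MeasurableSpace Ω] {μ : Measure Ω}
    [IsProbabilityMeasure μ] (D : Ω → ℝ≥0∞) {E : Ω → ℝ≥0∞} (hE : Measurable E) {δ ε : ℝ≥0∞}
    (hδ : δ ≠ 0) (hδ' : δ ≠ ∞) (hε : ε ≠ 0) (hε' : ε ≠ ∞)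
    (h : (∫⁻ ω, D ω ∂μ) / δ + (∫⁻ ω, E ω ∂μ) / ε < 1) : ∃ ω, D ω ≤ δ ∧ E ω ≤ ε := by
  by_contra! hcon
  refine h.not_ge ?_
  simp only [div_eq_mul_inv]
  rw [← lintegral_mul_const' _ _ (ENNReal.inv_ne_top.2 hδ), ← lintegral_mul_const _ hE,
    ← lintegral_add_right _ (by fun_prop)]
  calc (1 : ℝ≥0∞) = ∫⁻ _, 1 ∂μ := by simp
    _ ≤ ∫⁻ ω, (D ω * δ⁻¹ + E ω * ε⁻¹) ∂μ := by
        gcongr with ω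
        simp only [← div_eq_mul_inv]
        by_cases hD : D ω ≤ δ
        · exact le_add_left ((ENNReal.le_div_iff_mul_le (.inl hε) (.inl hε')).2
            (by simpa using (hcon ω hD).le))
        · exact le_add_right ((ENNReal.le_div_iff_mul_le (.inl hδ) (.inl hδ')).2
            (by simpa using (not_le.1 hD).le))

theorem IsLikelihoodRatio.exists_codebook [NeZero M] [NeZero K] [IsProbabilityMeasure P]
    [IsMarkovKernel W] (hr : IsLikelihoodRatio P W r) {Q : Measure Y} [IsFiniteMeasure Q]
    (hac : W ∘ₘ P ≪ Q) {s θ : ℝ} (hs : 0 < s) (hs1 : s ≤ 1) (hθ : 0 < θ) {δ ε : ℝ≥0∞} (hδ : δ ≠ 0)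
    (hδ' : δ ≠ ∞) (hε : ε ≠ 0) (hε' : ε ≠ ∞)
    (h : (ENNReal.ofReal (s * (M * K : ℝ) ^ s)⁻¹ * ∫⁻ x, ∫⁻ y, ENNReal.ofReal (r x y ^ s) ∂W x ∂P +
        klDiv (W ∘ₘ P) Q) / δ +
      (∫⁻ x, W x {y | r x y ≤ θ} ∂P + M * (ENNReal.ofReal θ)⁻¹) / ε < 1) :
    ∃ (c : Fin M × Fin K → X) (d : Y → Fin K → Fin M), (∀ k, Measurable fun y => d y k) ∧
      klDiv (codebookLaw W c) Q ≤ δ ∧ codebookError W c d ≤ ε := by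
  have hmeas : Measurable (thresholdError W r θ (M := M) (K := K)) :=
    (Finset.measurable_fun_sum _ fun i _ =>
      measurable_thresholdError_term hr.measurable θ i).const_mul _
  obtain ⟨c, hcδ, hcε⟩ := exists_le_and_le_of_lintegral_div_add_lt_one
    (μ := Measure.pi fun _ : Fin M × Fin K => P) (fun c => klDiv (codebookLaw W c) Q)
    hmeas hδ hδ' hε hε' (lt_of_le_of_lt (by
      gcongr
      · simpa using hr.lintegral_klDiv_codebookLaw_le (J := Fin M × Fin K) hac hs hs1
      · exact hr.lintegral_thresholdError_le hθ) h)
  obtain ⟨d, hd, hde⟩ := exists_decoder_codebookError_le (W := W) hr.measurable θ c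
  exact ⟨c, d, hd, hcδ, hde.trans hcε⟩

end Channel

section AdditiveChannel

variable {E : Type*} [MeasurableSpace E]

/-- The channel `x ↦ x + Z` that adds to its input an independent noise `Z` of law `μ`. -/
def additiveNoise [Add E] [MeasurableAdd₂ E] (μ : Measure E) [SFinite μ] : Kernel E E :=
  (Kernel.id ×ₖ Kernel.const E μ).map fun q => q.1 + q.2

lemma additiveNoise_apply [Add E] [MeasurableAdd₂ E] (μ : Measure E) [SFinite μ] (x : E) :
    additiveNoise μ x = μ.map fun z => x + z := by
  rw [additiveNoise, Kernel.map_apply _ (by fun_prop), Kernel.prod_apply, Kernel.id_apply,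
    Kernel.const_apply, Measure.dirac_prod, Measure.map_map (by fun_prop) (by fun_prop)]
  rfl

instance [Add E] [MeasurableAdd₂ E] (μ : Measure E) [IsProbabilityMeasure μ] :
    IsMarkovKernel (additiveNoise μ) :=
  Kernel.IsMarkovKernel.map _ (by fun_prop)

lemma lintegral_additiveNoise [Add E] [MeasurableAdd₂ E] {P μ : Measure E} [SFinite μ]
    {h : E → E → ℝ≥0∞} (hh : Measurable fun q : E × E => h q.1 q.2) :
    ∫⁻ x, ∫⁻ y, h x y ∂additiveNoise μ x ∂P = ∫⁻ q, h q.1 (q.1 + q.2) ∂(P.prod μ) := by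
  have hadd : Measurable fun q : E × E => h q.1 (q.1 + q.2) :=
    hh.comp (f := fun q : E × E => (q.1, q.1 + q.2)) (by fun_prop)
  rw [lintegral_prod _ hadd.aemeasurable]
  refine lintegral_congr fun x => ?_
  have hx : Measurable (h x) := hh.comp measurable_prodMk_left
  rw [additiveNoise_apply, lintegral_map hx (by fun_prop)]

lemma comp_additiveNoise [AddMonoid E] [MeasurableAdd₂ E] (P μ : Measure E) [SFinite μ] :
    additiveNoise μ ∘ₘ P = P.conv μ := by
  ext s hs
  rw [Measure.bind_apply hs (Kernel.aemeasurable _), Measure.conv,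
    Measure.map_apply (by fun_prop) hs, Measure.prod_apply (measurable_add hs)]
  refine lintegral_congr fun x => ?_
  rw [additiveNoise_apply, Measure.map_apply (by fun_prop) hs]
  rfl

lemma ae_prod_add_of_conv [AddMonoid E] [MeasurableAdd₂ E] {P μ : Measure E} [SFinite P]
    [SFinite μ] {s : E → Prop} (hs : ∀ᵐ y ∂P.conv μ, s y) : ∀ᵐ q ∂P.prod μ, s (q.1 + q.2) :=
  ae_of_ae_map (by fun_prop) hs

lemma lintegral_div_add_rpow_le [AddMonoid E] [MeasurableAdd₂ E] {ν P μ : Measure E}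
    [SFinite P] [SFinite μ] {f g : E → ℝ} (hf0 : ∀ y, 0 ≤ f y) {b : ℝ} (hfb : ∀ y, f y ≤ b)
    (hg : Measurable g) (hg0 : ∀ y, 0 ≤ g y)
    (hconv : P.conv μ = ν.withDensity fun y => ENNReal.ofReal (g y)) {s : ℝ} (hs : 0 ≤ s) :
    ∫⁻ q, ENNReal.ofReal ((f q.2 / g (q.1 + q.2)) ^ s) ∂(P.prod μ) ≤
      ENNReal.ofReal (b ^ s) * ∫⁻ y, ENNReal.ofReal (g y ^ (1 - s)) ∂ν := by
  have hbound : ∀ q : E × E, ENNReal.ofReal ((f q.2 / g (q.1 + q.2)) ^ s) ≤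
      ENNReal.ofReal (b ^ s * g (q.1 + q.2) ^ (-s)) := fun q => by
    rw [Real.div_rpow (hf0 _) (hg0 _), Real.rpow_neg (hg0 _), ← div_eq_mul_inv]
    gcongr
    exacts [Real.rpow_nonneg (hg0 _) _, hf0 _, hfb _]
  have hpow : ∀ y, ENNReal.ofReal (g y) * ENNReal.ofReal (b ^ s * g y ^ (-s)) ≤
      ENNReal.ofReal (b ^ s) * ENNReal.ofReal (g y ^ (1 - s)) := fun y => by
    have hb : 0 ≤ b := (hf0 y).trans (hfb y)
    rw [← ENNReal.ofReal_mul (hg0 y), ← ENNReal.ofReal_mul (Real.rpow_nonneg hb s)]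
    rcases (hg0 y).eq_or_lt with h0 | h0
    · simp only [← h0, zero_mul, ENNReal.ofReal_zero, zero_le]
    · rw [sub_eq_add_neg, Real.rpow_add h0, Real.rpow_one, mul_left_comm]
  calc _ ≤ ∫⁻ q, ENNReal.ofReal (b ^ s * g (q.1 + q.2) ^ (-s)) ∂(P.prod μ) :=
        lintegral_mono hbound
    _ = ∫⁻ y, ENNReal.ofReal (b ^ s * g y ^ (-s)) ∂(P.conv μ) := by
        rw [Measure.conv, lintegral_map (by fun_prop) (by fun_prop)]
    _ = ∫⁻ y, ENNReal.ofReal (g y) * ENNReal.ofReal (b ^ s * g y ^ (-s)) ∂ν := by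
        rw [hconv, lintegral_withDensity_eq_lintegral_mul _ (by fun_prop) (by fun_prop)]
        rfl
    _ ≤ _ := (lintegral_mono hpow).trans_eq (lintegral_const_mul _ (by fun_prop))

lemma isLikelihoodRatio_additiveNoise [AddCommGroup E] [MeasurableAdd₂ E] [MeasurableSub₂ E]
    {ν P μ : Measure E} [ν.IsAddLeftInvariant] [SFinite P] [SFinite μ] {f g : E → ℝ}
    (hf : Measurable f) (hf0 : ∀ y, 0 ≤ f y) (hg : Measurable g) (hg0 : ∀ y, 0 ≤ g y)
    (hμ : μ = ν.withDensity fun y => ENNReal.ofReal (f y))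
    (hconv : P.conv μ = ν.withDensity fun y => ENNReal.ofReal (g y)) :
    IsLikelihoodRatio P (additiveNoise μ) fun x y => f (y - x) / g y := by
  refine ⟨by fun_prop, fun x y => div_nonneg (hf0 _) (hg0 _), ?_⟩
  have hpos : ∀ᵐ q ∂P.prod μ, 0 < g (q.1 + q.2) :=
    ae_prod_add_of_conv (hconv ▸ ae_withDensity_ofReal_pos hg)
  filter_upwards [Measure.ae_ae_of_ae_prod hpos] with x hx
  have hz : ∀ᵐ y ∂ν, ENNReal.ofReal (f (y - x)) ≠ 0 → 0 < g y := by
    rw [← ae_withDensity_iff (by fun_prop), ← map_add_left_withDensity x, ← hμ]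
    exact (ae_map_iff (p := fun y => 0 < g y) (by fun_prop)
      (measurableSet_lt measurable_const hg)).2 hx
  rw [comp_additiveNoise, hconv, additiveNoise_apply, hμ, map_add_left_withDensity x,
    ← withDensity_mul _ (by fun_prop) (by fun_prop)]
  refine withDensity_congr_ae ?_
  filter_upwards [hz] with y hy
  rw [Pi.mul_apply, ← ENNReal.ofReal_mul (hg0 y)]
  by_cases h0 : ENNReal.ofReal (f (y - x)) = 0
  · have hfy : f (y - x) = 0 := le_antisymm (ENNReal.ofReal_eq_zero.1 h0) (hf0 _)
    simp [hfy]
  · rw [mul_div_cancel₀ _ (hy h0).ne']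

end AdditiveChannel

section Memoryless

variable {ι E : Type*} [Fintype ι] [MeasurableSpace E]

lemma isLikelihoodRatio_additiveNoise_pi [AddCommGroup E] [MeasurableAdd₂ E] [MeasurableSub₂ E]
    {ν P μ : Measure E} [SigmaFinite ν] [ν.IsAddLeftInvariant] [IsProbabilityMeasure P]
    [IsProbabilityMeasure μ] {f g : E → ℝ} (hf : Measurable f)
    (hf0 : ∀ y, 0 ≤ f y) (hfi : Integrable f ν) (hg : Measurable g) (hg0 : ∀ y, 0 ≤ g y)
    (hgi : Integrable g ν) (hμ : μ = ν.withDensity fun y => ENNReal.ofReal (f y))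
    (hconv : P.conv μ = ν.withDensity fun y => ENNReal.ofReal (g y)) :
    IsLikelihoodRatio (Measure.pi fun _ : ι => P) (additiveNoise (Measure.pi fun _ : ι => μ))
      fun x y => ∏ i, f (y i - x i) / g (y i) := by
  simp_rw [Finset.prod_div_distrib]
  refine isLikelihoodRatio_additiveNoise (ν := Measure.pi fun _ : ι => ν)
    (f := fun y => ∏ i, f (y i)) (g := fun y => ∏ i, g (y i)) (by fun_prop)
    (fun y => Finset.prod_nonneg fun i _ => hf0 _) (by fun_prop)
    (fun y => Finset.prod_nonneg fun i _ => hg0 _) ?_ ?_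
  · rw [← pi_withDensity_ofReal (fun _ => hf0) (fun _ => hfi), hμ]
  · rw [conv_pi, hconv, pi_withDensity_ofReal (fun _ => hg0) (fun _ => hgi)]

lemma lintegral_additiveNoise_pi [Add E] [MeasurableAdd₂ E] {P μ : Measure E} [SigmaFinite P]
    [SigmaFinite μ] {h : (ι → E) → (ι → E) → ℝ≥0∞}
    (hh : Measurable fun q : (ι → E) × (ι → E) => h q.1 q.2) :
    ∫⁻ x, ∫⁻ y, h x y ∂additiveNoise (Measure.pi fun _ => μ) x ∂(Measure.pi fun _ => P) =
      ∫⁻ a, h (fun i => (a i).1) (fun i => (a i).1 + (a i).2)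
        ∂(Measure.pi fun _ : ι => P.prod μ) := by
  rw [lintegral_additiveNoise hh, ← (measurePreserving_arrowProdEquivProdArrow E E ι
    (fun _ => P) fun _ => μ).lintegral_comp_emb (MeasurableEquiv.measurableEmbedding _)]
  rfl

lemma lintegral_pi_prod_eq_pow {Ω : Type*} [MeasurableSpace Ω] {μ : Measure Ω}
    [IsProbabilityMeasure μ] {h : Ω → ℝ≥0∞} (hh : Measurable h) :
    ∫⁻ a, ∏ i, h (a i) ∂(Measure.pi fun _ : ι => μ) = (∫⁻ x, h x ∂μ) ^ Fintype.card ι := by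
  have hind : iIndepFun (fun i (a : ι → Ω) => h (a i)) (Measure.pi fun _ : ι => μ) :=
    iIndepFun_pi fun _ => hh.aemeasurable
  rw [lintegral_prod_eq_prod_lintegral_of_indepFun Finset.univ _ hind fun i =>
    hh.comp (measurable_pi_apply i)]
  simp_rw [fun i => (measurePreserving_eval (fun _ : ι => μ) i).lintegral_comp hh,
    Finset.prod_const, Finset.card_univ]

end Memoryless

lemma IsPDF.isProbabilityMeasure {p : ℝ → ℝ} (hp : IsPDF p) :
    IsProbabilityMeasure (noiseLaw p) := by
  constructor
  rw [noiseLaw, withDensity_apply _ MeasurableSet.univ, setLIntegral_univ,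
    ← ofReal_integral_eq_lintegral_ofReal hp.integrable (ae_of_all _ hp.nonneg),
    hp.integral_eq_one, ENNReal.ofReal_one]

instance (p : ℝ → ℝ) (n : ℕ) : SigmaFinite (noiseLawN p n) := by
  unfold noiseLawN
  infer_instance

instance (p : ℝ → ℝ) (n : ℕ) [IsProbabilityMeasure (noiseLaw p)] :
    IsProbabilityMeasure (noiseLawN p n) := by
  unfold noiseLawN
  infer_instance

namespace Code

variable {n M K : ℕ} [NeZero M] [NeZero K]

/-- The code whose codewords form the codebook `c`, with the decoder `d`. -/
def ofCodebook (c : Fin M × Fin K → Fin n → ℝ) (d : (Fin n → ℝ) → Fin K → Fin M)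
    (hd : ∀ k, Measurable fun y => d y k) : Code n where
  numMsg := M
  numKey := K
  numMsg_pos := NeZero.pos M
  numKey_pos := NeZero.pos K
  enc m k := c (m, k)
  dec := d
  measurable_dec := hd

variable {p : ℝ → ℝ} {c : Fin M × Fin K → Fin n → ℝ} {d : (Fin n → ℝ) → Fin K → Fin M}
  {hd : ∀ k, Measurable fun y => d y k}

lemma outputLaw_ofCodebook [IsProbabilityMeasure (noiseLawN p n)] :
    (ofCodebook c d hd).outputLaw p = codebookLaw (additiveNoise (noiseLawN p n)) c := by
  simp_rw [outputLaw, codebookLaw, additiveNoise_apply, Fintype.sum_prod_type, ofCodebook,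
    Fintype.card_prod, Fintype.card_fin, Nat.cast_mul]
  rfl

lemma ofReal_avgError_ofCodebook [IsProbabilityMeasure (noiseLawN p n)] :
    ENNReal.ofReal ((ofCodebook c d hd).avgError p) =
      codebookError (additiveNoise (noiseLawN p n)) c d := by
  have hMK : (0 : ℝ) < M * K := mod_cast Nat.mul_pos (NeZero.pos M) (NeZero.pos K)
  have hmeas : ∀ m k, MeasurableSet {y | d y k ≠ m} := fun m k =>
    (hd k) (measurableSet_singleton m).compl
  simp_rw [avgError, codebookError, ofCodebook, Fintype.card_prod, Fintype.card_fin,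
    Nat.cast_mul, additiveNoise_apply, Fintype.sum_prod_type]
  rw [ENNReal.ofReal_mul (by positivity), ENNReal.ofReal_inv_of_pos hMK,
    ENNReal.ofReal_mul (by positivity), ENNReal.ofReal_natCast, ENNReal.ofReal_natCast,
    ENNReal.ofReal_sum_of_nonneg fun m _ => by positivity]
  congr! 2 with m
  rw [ENNReal.ofReal_sum_of_nonneg fun k _ => by positivity]
  refine Finset.sum_congr rfl fun k _ => ?_
  rw [ofReal_measureReal, Measure.map_apply (by fun_prop) (hmeas m k)]
  rfl

end Code

/-- The information density `ln (p (y - x) / q y)` of the input `x` and the output `y = x + z`, as a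
function of the pair `(x, z)` of input and noise. -/
def infoDensity (p q : ℝ → ℝ) (a : ℝ × ℝ) : ℝ := Real.log (p a.2 / q (a.1 + a.2))

lemma measurable_infoDensity {p q : ℝ → ℝ} (hp : Measurable p) (hq : Measurable q) :
    Measurable (infoDensity p q) := by
  unfold infoDensity
  fun_prop

section RandomCoding

variable {p q : ℝ → ℝ} {P : Measure ℝ} [IsProbabilityMeasure P]

lemma ae_pos_and_pos_add (hpm : Measurable p) (hp : IsPDF p) (hq : Measurable q)
    (hconv : P.conv (noiseLaw p) = noiseLaw q) :
    ∀ᵐ a ∂P.prod (noiseLaw p), 0 < p a.2 ∧ 0 < q (a.1 + a.2) := by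
  have := hp.isProbabilityMeasure
  refine .and (Measure.quasiMeasurePreserving_snd.ae (ae_withDensity_ofReal_pos hpm)) ?_
  refine ae_prod_add_of_conv (s := fun y => 0 < q y) ?_
  rw [hconv]
  exact ae_withDensity_ofReal_pos hq

lemma lintegral_additiveNoise_le_exp (hpm : Measurable p) (hp : IsPDF p) (hq : Measurable q)
    (hconv : P.conv (noiseLaw p) = noiseLaw q) (n : ℕ) (τ : ℝ) :
    ∫⁻ x, additiveNoise (noiseLawN p n) x {y | ∏ i, p (y i - x i) / q (y i) ≤ Real.exp τ}
        ∂(Measure.pi fun _ => P) =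
      (Measure.pi fun _ : Fin n => P.prod (noiseLaw p)) {a | ∑ i, infoDensity p q (a i) ≤ τ} := by
  have := hp.isProbabilityMeasure
  have hset : MeasurableSet {b : (Fin n → ℝ) × (Fin n → ℝ) |
      ∏ i, p (b.2 i - b.1 i) / q (b.2 i) ≤ Real.exp τ} :=
    measurableSet_le (by fun_prop) measurable_const
  have hi := measurable_infoDensity hpm hq
  have hsum : MeasurableSet {a : Fin n → ℝ × ℝ | ∑ i, infoDensity p q (a i) ≤ τ} :=
    measurableSet_le (by fun_prop) measurable_const
  have hslice : ∀ x : Fin n → ℝ, MeasurableSet {y : Fin n → ℝ |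
      ∏ i, p (y i - x i) / q (y i) ≤ Real.exp τ} := fun x => measurable_prodMk_left hset
  simp_rw [fun x => (lintegral_indicator_one (hslice x)).symm]
  refine (lintegral_additiveNoise_pi (measurable_one.indicator hset)).trans ?_
  rw [← lintegral_indicator_one hsum]
  refine lintegral_congr_ae ?_
  filter_upwards [ae_pi_forall (ae_pos_and_pos_add hpm hp hq hconv)] with a ha
  have hpos : ∀ i, 0 < p (a i).2 / q ((a i).1 + (a i).2) := fun i => div_pos (ha i).1 (ha i).2
  simp only [Set.indicator, Set.mem_ofPred_eq, add_sub_cancel_left, infoDensity,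
    ← Real.log_prod (fun i _ => (hpos i).ne'),
    Real.log_le_iff_le_exp (Finset.prod_pos fun i _ => hpos i), Pi.one_apply]

lemma lintegral_additiveNoise_rpow_le (hpm : Measurable p) (hp : IsPDF p) {b : ℝ}
    (hpb : ∀ z, p z ≤ b) (hqm : Measurable q) (hq : IsPDF q)
    (hconv : P.conv (noiseLaw p) = noiseLaw q) {s : ℝ} (hs : 0 ≤ s) (n : ℕ) :
    ∫⁻ x, ∫⁻ y, ENNReal.ofReal ((∏ i, p (y i - x i) / q (y i)) ^ s)
        ∂additiveNoise (noiseLawN p n) x ∂(Measure.pi fun _ => P) ≤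
      (ENNReal.ofReal (b ^ s) * ∫⁻ y, ENNReal.ofReal (q y ^ (1 - s))) ^ n := by
  have := hp.isProbabilityMeasure
  have hdiv : ∀ y z, 0 ≤ p y / q z := fun y z => div_nonneg (hp.nonneg y) (hq.nonneg z)
  simp_rw [← fun x y : Fin n → ℝ => Real.finsetProd_rpow Finset.univ _
      (fun i _ => hdiv (y i - x i) (y i)) s,
    fun x y : Fin n → ℝ => ENNReal.ofReal_prod_of_nonneg
      fun i (_ : i ∈ Finset.univ) => Real.rpow_nonneg (hdiv (y i - x i) (y i)) s]
  refine (lintegral_additiveNoise_pi (P := P) (μ := noiseLaw p) (h := fun x y : Fin n → ℝ =>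
    ∏ i, ENNReal.ofReal ((p (y i - x i) / q (y i)) ^ s)) (by fun_prop)).trans_le ?_
  simp_rw [add_sub_cancel_left]
  rw [lintegral_pi_prod_eq_pow (h := fun a : ℝ × ℝ =>
    ENNReal.ofReal ((p a.2 / q (a.1 + a.2)) ^ s)) (by fun_prop), Fintype.card_fin]
  gcongr
  exact lintegral_div_add_rpow_le hp.nonneg hpb hqm hq.nonneg hconv hs

lemma exists_code_of_conv (hpm : Measurable p) (hp : IsPDF p) {b : ℝ}
    (hpb : ∀ z, p z ≤ b) (hqm : Measurable q) (hq : IsPDF q)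
    (hconv : P.conv (noiseLaw p) = noiseLaw q) {n : ℕ} (hac : noiseLawN q n ≪ noiseLawN p n)
    {M K : ℕ} [NeZero M] [NeZero K] {s : ℝ} (hs : 0 < s) (hs1 : s ≤ 1) {Δ ε : ℝ}
    (hΔ : 0 < Δ) (hε : 0 < ε) (τ : ℝ)
    (h : (ENNReal.ofReal (s * (M * K : ℝ) ^ s)⁻¹ *
          (ENNReal.ofReal (b ^ s) * ∫⁻ y, ENNReal.ofReal (q y ^ (1 - s))) ^ n +
          klDiv (noiseLawN q n) (noiseLawN p n)) / ENNReal.ofReal Δ +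
        ((Measure.pi fun _ : Fin n => P.prod (noiseLaw p)) {a | ∑ i, infoDensity p q (a i) ≤ τ} +
          M * (ENNReal.ofReal (Real.exp τ))⁻¹) / ENNReal.ofReal ε < 1) :
    ∃ C : Code n, C.numMsg = M ∧ C.numKey = K ∧ C.IsCovert p Δ ∧ C.avgError p ≤ ε := by
  have := hp.isProbabilityMeasure
  have hout : additiveNoise (noiseLawN p n) ∘ₘ (Measure.pi fun _ => P) = noiseLawN q n := by
    rw [comp_additiveNoise, noiseLawN, conv_pi, hconv, noiseLawN]
  have hr : IsLikelihoodRatio (Measure.pi fun _ => P) (additiveNoise (noiseLawN p n))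
      fun x y => ∏ i, p (y i - x i) / q (y i) :=
    isLikelihoodRatio_additiveNoise_pi (ι := Fin n) hpm hp.nonneg hp.integrable hqm hq.nonneg
      hq.integrable rfl hconv
  obtain ⟨c, d, hd, hcδ, hcε⟩ := hr.exists_codebook (M := M) (K := K) (hout ▸ hac) hs hs1
    (Real.exp_pos τ) (ENNReal.ofReal_pos.2 hΔ).ne' ENNReal.ofReal_ne_top
    (ENNReal.ofReal_pos.2 hε).ne' ENNReal.ofReal_ne_top (lt_of_le_of_lt (by
      rw [hout, ← lintegral_additiveNoise_le_exp hpm hp hqm hconv n τ]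
      gcongr
      exact lintegral_additiveNoise_rpow_le hpm hp hpb hqm hq hconv hs.le n) h)
  refine ⟨Code.ofCodebook c d hd, rfl, rfl, ?_, ?_⟩
  · rwa [Code.IsCovert, Code.outputLaw_ofCodebook]
  · rwa [← ENNReal.ofReal_le_ofReal_iff hε.le, Code.ofReal_avgError_ofCodebook]

end RandomCoding

section InformationDensity

variable {p q : ℝ → ℝ} {P : Measure ℝ} [IsProbabilityMeasure P] {b s κ : ℝ}

lemma integrable_exp_neg_infoDensity (hpm : Measurable p) (hp : IsPDF p) (hqm : Measurable q)
    (hq : IsPDF q) (hconv : P.conv (noiseLaw p) = noiseLaw q) :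
    Integrable (fun a => Real.exp (-infoDensity p q a)) (P.prod (noiseLaw p)) ∧
      ∫ a, Real.exp (-infoDensity p q a) ∂P.prod (noiseLaw p) ≤ 1 := by
  have := hp.isProbabilityMeasure
  have hr : IsLikelihoodRatio P (additiveNoise (noiseLaw p)) fun x y => p (y - x) / q y :=
    isLikelihoodRatio_additiveNoise hpm hp.nonneg hqm hq.nonneg rfl hconv
  have hi := measurable_infoDensity hpm hqm
  refine integrable_and_integral_le_of_lintegral_ofReal_le (by fun_prop)
    (fun a => Real.exp_nonneg _) zero_le_one ?_
  calc ∫⁻ a, ENNReal.ofReal (Real.exp (-infoDensity p q a)) ∂P.prod (noiseLaw p)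
      = ∫⁻ a, ENNReal.ofReal (p (a.1 + a.2 - a.1) / q (a.1 + a.2))⁻¹ ∂P.prod (noiseLaw p) := by
        refine lintegral_congr_ae ?_
        filter_upwards [ae_pos_and_pos_add hpm hp hqm hconv] with a ha
        rw [infoDensity, ← Real.log_inv, add_sub_cancel_left,
          Real.exp_log (inv_pos.2 (div_pos ha.1 ha.2))]
    _ = ∫⁻ x, ∫⁻ y, ENNReal.ofReal (p (y - x) / q y)⁻¹ ∂additiveNoise (noiseLaw p) x ∂P :=
        (lintegral_additiveNoise (h := fun x y => ENNReal.ofReal (p (y - x) / q y)⁻¹)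
          (by fun_prop)).symm
    _ ≤ ENNReal.ofReal 1 := by simpa using hr.lintegral_inv_le

lemma integrable_exp_mul_infoDensity (hpm : Measurable p) (hp : IsPDF p) (hpb : ∀ z, p z ≤ b)
    (hqm : Measurable q) (hq : IsPDF q) (hconv : P.conv (noiseLaw p) = noiseLaw q) (hs : 0 ≤ s)
    (hκ0 : 0 ≤ κ)
    (hκ : ENNReal.ofReal (b ^ s) * ∫⁻ y, ENNReal.ofReal (q y ^ (1 - s)) ≤ ENNReal.ofReal κ) :
    Integrable (fun a => Real.exp (s * infoDensity p q a)) (P.prod (noiseLaw p)) ∧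
      ∫ a, Real.exp (s * infoDensity p q a) ∂P.prod (noiseLaw p) ≤ κ := by
  have := hp.isProbabilityMeasure
  have hi := measurable_infoDensity hpm hqm
  refine integrable_and_integral_le_of_lintegral_ofReal_le (by fun_prop)
    (fun a => Real.exp_nonneg _) hκ0 (le_trans (le_of_eq ?_)
      ((lintegral_div_add_rpow_le hp.nonneg hpb hqm hq.nonneg hconv hs).trans hκ))
  refine lintegral_congr_ae ?_
  filter_upwards [ae_pos_and_pos_add hpm hp hqm hconv] with a ha
  rw [infoDensity, Real.rpow_def_of_pos (div_pos ha.1 ha.2), mul_comm]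

lemma memLp_infoDensity (hpm : Measurable p) (hp : IsPDF p) (hpb : ∀ z, p z ≤ b)
    (hqm : Measurable q) (hq : IsPDF q) (hconv : P.conv (noiseLaw p) = noiseLaw q) (hs : 0 < s)
    (hκ0 : 0 ≤ κ)
    (hκ : ENNReal.ofReal (b ^ s) * ∫⁻ y, ENNReal.ofReal (q y ^ (1 - s)) ≤ ENNReal.ofReal κ) :
    MemLp (infoDensity p q) 2 (P.prod (noiseLaw p)) :=
  memLp_two_of_integrable_exp hs (integrable_exp_neg_infoDensity hpm hp hqm hq hconv).1
    (integrable_exp_mul_infoDensity hpm hp hpb hqm hq hconv hs.le hκ0 hκ).1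

lemma variance_infoDensity_le (hpm : Measurable p) (hp : IsPDF p) (hpb : ∀ z, p z ≤ b)
    (hqm : Measurable q) (hq : IsPDF q) (hconv : P.conv (noiseLaw p) = noiseLaw q) (hs : 0 < s)
    (hκ0 : 0 ≤ κ)
    (hκ : ENNReal.ofReal (b ^ s) * ∫⁻ y, ENNReal.ofReal (q y ^ (1 - s)) ≤ ENNReal.ofReal κ)
    {T : ℝ} (hT : 1 ≤ T) :
    Var[infoDensity p q; P.prod (noiseLaw p)] ≤
      4 * T * ∫ a, infoDensity p q a ∂P.prod (noiseLaw p) + 6 / (s ^ 3 * T) * κ := by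
  have := hp.isProbabilityMeasure
  have hneg := integrable_exp_neg_infoDensity hpm hp hqm hq hconv
  have hpos := integrable_exp_mul_infoDensity hpm hp hpb hqm hq hconv hs.le hκ0 hκ
  exact (variance_le_expectation_sq
    (measurable_infoDensity hpm hqm).aestronglyMeasurable).trans
    (integral_sq_le hs hT hneg.1 hneg.2 hpos.1 hpos.2)

end InformationDensity

section TiltedDensity

variable {p : ℝ → ℝ} {s t γ : ℝ}

lemma integrable_noiseLaw_iff (hpm : Measurable p) (hp : IsPDF p) {k : ℝ → ℝ} :
    Integrable k (noiseLaw p) ↔ Integrable fun z => p z * k z := by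
  rw [noiseLaw, integrable_withDensity_iff_integrable_smul' (by fun_prop) (by simp)]
  simp [ENNReal.toReal_ofReal (hp.nonneg _)]

lemma integral_noiseLaw (hpm : Measurable p) (hp : IsPDF p) (k : ℝ → ℝ) :
    ∫ z, k z ∂noiseLaw p = ∫ z, p z * k z := by
  rw [noiseLaw, integral_withDensity_eq_integral_toReal_smul (by fun_prop) (by simp)]
  simp [ENNReal.toReal_ofReal (hp.nonneg _)]

lemma mul_exp_surprisal {z : ℝ} (hz : 0 ≤ p z) (ht : t < 1) :
    p z * Real.exp (t * surprisal p z) = p z ^ (1 - t) := by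
  rcases hz.eq_or_lt with h0 | h0
  · rw [← h0, zero_mul, Real.zero_rpow (by linarith)]
  · rw [Real.rpow_sub h0, Real.rpow_one, Real.rpow_def_of_pos h0, surprisal, div_eq_mul_inv,
      ← Real.exp_neg]
    congr 2
    ring

lemma mem_integrableExpSet_surprisal_iff (hpm : Measurable p) (hp : IsPDF p) (ht : t < 1) :
    t ∈ integrableExpSet (surprisal p) (noiseLaw p) ↔ Integrable fun z => p z ^ (1 - t) := by
  simp_rw [integrableExpSet, Set.mem_ofPred_eq, integrable_noiseLaw_iff hpm hp,
    fun z => mul_exp_surprisal (hp.nonneg z) ht]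

lemma mgf_surprisal (hpm : Measurable p) (hp : IsPDF p) (ht : t < 1) :
    mgf (surprisal p) (noiseLaw p) t = ∫ z, p z ^ (1 - t) := by
  simp_rw [mgf, integral_noiseLaw hpm hp, fun z => mul_exp_surprisal (hp.nonneg z) ht]

lemma tiltedDensity_eq (hpm : Measurable p) (hp : IsPDF p) (hγ : γ < 1) (z : ℝ) :
    tiltedDensity p γ z = (mgf (surprisal p) (noiseLaw p) γ)⁻¹ * p z ^ (1 - γ) := by
  rw [tiltedDensity, mgf_surprisal hpm hp hγ]

lemma measurable_tiltedDensity (hpm : Measurable p) : Measurable (tiltedDensity p γ) :=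
  (hpm.pow_const _).const_mul _

lemma noiseLaw_tiltedDensity (hpm : Measurable p) (hp : IsPDF p) (hγ : γ < 1) :
    noiseLaw (tiltedDensity p γ) = (noiseLaw p).tilted (γ * surprisal p ·) := by
  have hs := measurable_surprisal hpm
  rw [Measure.tilted, noiseLaw, noiseLaw, ← withDensity_mul _ (by fun_prop) (by fun_prop)]
  congr with z
  rw [Pi.mul_apply, ← ENNReal.ofReal_mul (hp.nonneg z), mul_div_assoc',
    mul_exp_surprisal (hp.nonneg z) hγ, tiltedDensity_eq hpm hp hγ, inv_mul_eq_div]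
  rfl

lemma isPDF_tiltedDensity (hpm : Measurable p) (hp : IsPDF p) (hγ1 : γ < 1)
    (hγ : γ ∈ integrableExpSet (surprisal p) (noiseLaw p)) : IsPDF (tiltedDensity p γ) where
  nonneg z := mul_nonneg (inv_nonneg.2 (integral_nonneg fun t => Real.rpow_nonneg (hp.nonneg t) _))
    (Real.rpow_nonneg (hp.nonneg z) _)
  integrable := ((mem_integrableExpSet_surprisal_iff hpm hp hγ1).1 hγ).const_mul _
  integral_eq_one := by
    have := hp.isProbabilityMeasure
    simp_rw [tiltedDensity, integral_const_mul, ← mgf_surprisal hpm hp hγ1]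
    exact inv_mul_cancel₀ (mgf_pos hγ).ne'

lemma lintegral_tiltedDensity_rpow (hpm : Measurable p) (hp : IsPDF p) (hγ : γ < 1)
    (hs : s < 1) (hexp : γ + s - γ * s ∈ integrableExpSet (surprisal p) (noiseLaw p)) :
    ∫⁻ y, ENNReal.ofReal (tiltedDensity p γ y ^ (1 - s)) =
      ENNReal.ofReal (mgf (surprisal p) (noiseLaw p) γ ^ (s - 1) *
        mgf (surprisal p) (noiseLaw p) (γ + s - γ * s)) := by
  have hlt : γ + s - γ * s < 1 := by nlinarith
  have hpow (z : ℝ) : tiltedDensity p γ z ^ (1 - s) =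
      mgf (surprisal p) (noiseLaw p) γ ^ (s - 1) * p z ^ (1 - (γ + s - γ * s)) := by
    have hz := hp.nonneg z
    rw [tiltedDensity_eq hpm hp hγ, Real.mul_rpow (inv_nonneg.2 mgf_nonneg) (by positivity),
      Real.inv_rpow mgf_nonneg, ← Real.rpow_neg mgf_nonneg, ← Real.rpow_mul hz]
    ring_nf
  have hint := (mem_integrableExpSet_surprisal_iff hpm hp hlt).1 hexp
  simp_rw [hpow]
  rw [← ofReal_integral_eq_lintegral_ofReal (hint.const_mul _) (ae_of_all _ fun z =>
    mul_nonneg (Real.rpow_nonneg mgf_nonneg _) (Real.rpow_nonneg (hp.nonneg z) _)),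
    integral_const_mul, mgf_surprisal hpm hp hlt]

lemma log_tiltedDensity (hpm : Measurable p) (hp : IsPDF p) (hγ1 : γ < 1)
    (hγ : γ ∈ integrableExpSet (surprisal p) (noiseLaw p)) {z : ℝ} (hz : 0 < p z) :
    Real.log (tiltedDensity p γ z) =
      -(1 - γ) * surprisal p z - cgf (surprisal p) (noiseLaw p) γ := by
  have := hp.isProbabilityMeasure
  rw [tiltedDensity_eq hpm hp hγ1, Real.log_mul (inv_ne_zero (mgf_pos hγ).ne')
    (Real.rpow_pos_of_pos hz _).ne', Real.log_inv, Real.log_rpow hz, cgf, surprisal]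
  ring

/-- The mutual information between `X` and `X + Z` when `X + Z` has the tilted density: the
differential entropy of `X + Z` minus the one of `Z`, written in terms of the cumulant generating
function of the surprisal. -/
def tiltInfo (p : ℝ → ℝ) (γ : ℝ) : ℝ :=
  (1 - γ) * deriv (cgf (surprisal p) (noiseLaw p)) γ + cgf (surprisal p) (noiseLaw p) γ -
    deriv (cgf (surprisal p) (noiseLaw p)) 0

lemma tendsto_tiltInfo_div (hp : IsPDF p)
    (h0 : 0 ∈ interior (integrableExpSet (surprisal p) (noiseLaw p))) :
    Tendsto (fun γ => tiltInfo p γ / γ) (𝓝[>] 0) (𝓝 (Var[surprisal p; noiseLaw p])) := by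
  have := hp.isProbabilityMeasure
  have hd : HasDerivAt (tiltInfo p) (Var[surprisal p; noiseLaw p]) 0 := by
    have h := ((((hasDerivAt_id (0 : ℝ)).const_sub 1).mul (hasDerivAt_deriv_cgf_zero h0)).add
      (hasDerivAt_cgf h0)).sub_const (deriv (cgf (surprisal p) (noiseLaw p)) 0)
    exact h.congr_deriv (by simp)
  refine hd.tendsto_slope_zero_right.congr fun γ => ?_
  simp [tiltInfo, div_eq_inv_mul]

variable {P : Measure ℝ} [IsProbabilityMeasure P]

lemma infoDensity_tiltedDensity_ae_eq (hpm : Measurable p) (hp : IsPDF p) (hγ1 : γ < 1)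
    (hγ : γ ∈ integrableExpSet (surprisal p) (noiseLaw p))
    (hconv : P.conv (noiseLaw p) = noiseLaw (tiltedDensity p γ)) :
    infoDensity p (tiltedDensity p γ) =ᵐ[P.prod (noiseLaw p)] fun a => -surprisal p a.2 +
      ((1 - γ) * surprisal p (a.1 + a.2) + cgf (surprisal p) (noiseLaw p) γ) := by
  filter_upwards [ae_pos_and_pos_add hpm hp (measurable_tiltedDensity hpm) hconv]
    with a ⟨hz, hy⟩
  have hpy : 0 < p (a.1 + a.2) := by
    refine (hp.nonneg _).lt_of_ne fun h0 => hy.ne ?_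
    rw [tiltedDensity, ← h0, Real.zero_rpow (by linarith), mul_zero]
  rw [infoDensity, Real.log_div hz.ne' hy.ne', log_tiltedDensity hpm hp hγ1 hγ hpy]
  simp only [surprisal]
  ring

lemma integral_infoDensity_tiltedDensity (hpm : Measurable p) (hp : IsPDF p) (hγ1 : γ < 1)
    (h0 : 0 ∈ interior (integrableExpSet (surprisal p) (noiseLaw p)))
    (hγ : γ ∈ interior (integrableExpSet (surprisal p) (noiseLaw p)))
    (hconv : P.conv (noiseLaw p) = noiseLaw (tiltedDensity p γ)) :
    ∫ a, infoDensity p (tiltedDensity p γ) a ∂P.prod (noiseLaw p) = tiltInfo p γ := by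
  have := hp.isProbabilityMeasure
  have hlaw := noiseLaw_tiltedDensity hpm hp hγ1
  have hadd : MeasurePreserving (fun a : ℝ × ℝ => a.1 + a.2) (P.prod (noiseLaw p))
      ((noiseLaw p).tilted (γ * surprisal p ·)) := ⟨by fun_prop, hlaw ▸ hconv⟩
  have hsnd := measurePreserving_snd (μ := P) (ν := noiseLaw p)
  have hsZ : Integrable (surprisal p) (noiseLaw p) :=
    integrable_of_mem_interior_integrableExpSet h0
  have hsY : Integrable (surprisal p) ((noiseLaw p).tilted (γ * surprisal p ·)) :=
    (memLp_tilted_mul hγ 1).integrable le_rfl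
  have hZ : Integrable (fun a : ℝ × ℝ => -surprisal p a.2) (P.prod (noiseLaw p)) :=
    (hsnd.integrable_comp_of_integrable hsZ).neg
  have hY : Integrable (fun a : ℝ × ℝ => (1 - γ) * surprisal p (a.1 + a.2))
      (P.prod (noiseLaw p)) := (hadd.integrable_comp_of_integrable hsY).const_mul _
  have hEZ : ∫ a, surprisal p a.2 ∂P.prod (noiseLaw p) =
      deriv (cgf (surprisal p) (noiseLaw p)) 0 := by
    rw [deriv_cgf_zero h0, probReal_univ, div_one]
    exact (integral_fun_snd (μ := P) (surprisal p)).trans (by simp)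
  have hEY : ∫ a, surprisal p (a.1 + a.2) ∂P.prod (noiseLaw p) =
      deriv (cgf (surprisal p) (noiseLaw p)) γ := by
    rw [← integral_tilted_mul_self hγ, ← hadd.map_eq,
      integral_map (by fun_prop) (measurable_surprisal hpm).aestronglyMeasurable]
  rw [integral_congr_ae (infoDensity_tiltedDensity_ae_eq hpm hp hγ1 (interior_subset hγ) hconv),
    integral_add (g := fun a => (1 - γ) * surprisal p (a.1 + a.2) + cgf (surprisal p) _ γ) hZ
      (hY.add (integrable_const _)), integral_add hY (integrable_const _), integral_neg,
    integral_const_mul, hEZ, hEY, integral_const, probReal_univ, one_smul, tiltInfo]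
  ring

end TiltedDensity

section RegularDensity

variable {p : ℝ → ℝ} {b ζ γ t : ℝ}

/-- A measurable probability density that is bounded by `b` and has an integrable `ζ`-th power.
It is the representative with which the proof replaces the given density; `1 ≤ b` keeps `-log b` a
lower bound of the surprisal also where that has its junk value `0`. -/
structure RegularDensity (p : ℝ → ℝ) (b ζ : ℝ) : Prop extends IsPDF p where
  measurable : Measurable p
  one_le : 1 ≤ b
  le_bound : ∀ z, p z ≤ b
  pos : 0 < ζ
  lt_one : ζ < 1
  integrable_rpow : Integrable fun z => p z ^ ζ

namespace RegularDensity

lemma ae_pos (h : RegularDensity p b ζ) : ∀ᵐ z ∂noiseLaw p, 0 < p z :=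
  ae_withDensity_ofReal_pos h.measurable

lemma rpow_le_add (h : RegularDensity p b ζ) {a : ℝ} (ha : ζ ≤ a) (ha1 : a ≤ 1) (z : ℝ) :
    p z ^ a ≤ p z ^ ζ + p z := by
  have hz := h.nonneg z
  rcases le_total (p z) 1 with h1 | h1
  · exact (Real.rpow_le_rpow_of_exponent_ge_of_imp hz h1 ha fun _ h0 =>
      absurd h0 (h.pos.trans_le ha).ne').trans (le_add_of_nonneg_right hz)
  · exact (Real.rpow_le_self_of_one_le h1 ha1).trans
      (le_add_of_nonneg_left (Real.rpow_nonneg hz ζ))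

lemma mem_integrableExpSet (h : RegularDensity p b ζ) (ht : t ≤ 1 - ζ) :
    t ∈ integrableExpSet (surprisal p) (noiseLaw p) := by
  have hζ := h.pos
  have hm : AEStronglyMeasurable (fun z => p z ^ (1 - t)) :=
    (h.measurable.pow_const _).aestronglyMeasurable
  rw [mem_integrableExpSet_surprisal_iff h.measurable h.toIsPDF (by linarith)]
  rcases le_total 0 t with h0 | h0
  · refine (h.integrable_rpow.add h.integrable).mono' hm (ae_of_all _ fun z => ?_)
    rw [Real.norm_of_nonneg (Real.rpow_nonneg (h.nonneg z) _)]
    exact h.rpow_le_add (by linarith) (by linarith) z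
  · refine (h.integrable.mul_const (b ^ (-t))).mono' hm (ae_of_all _ fun z => ?_)
    have hz := h.nonneg z
    rw [Real.norm_of_nonneg (Real.rpow_nonneg hz _), sub_eq_add_neg,
      Real.rpow_add_of_nonneg hz zero_le_one (by linarith), Real.rpow_one]
    exact mul_le_mul_of_nonneg_left (Real.rpow_le_rpow hz (h.le_bound z) (by linarith)) hz

lemma mem_interior_integrableExpSet (h : RegularDensity p b ζ) (ht : t < 1 - ζ) :
    t ∈ interior (integrableExpSet (surprisal p) (noiseLaw p)) :=
  mem_interior.2 ⟨Set.Iio (1 - ζ), fun _ hx => h.mem_integrableExpSet hx.le, isOpen_Iio, ht⟩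

lemma zero_mem_interior (h : RegularDensity p b ζ) :
    0 ∈ interior (integrableExpSet (surprisal p) (noiseLaw p)) :=
  h.mem_interior_integrableExpSet (sub_pos.2 h.lt_one)

lemma deriv_cgf_zero (h : RegularDensity p b ζ) :
    deriv (cgf (surprisal p) (noiseLaw p)) 0 = ∫ z, surprisal p z ∂noiseLaw p := by
  have := h.isProbabilityMeasure
  rw [ProbabilityTheory.deriv_cgf_zero h.zero_mem_interior, probReal_univ, div_one]

lemma surprisal_prod_ae_eq (h : RegularDensity p b ζ) (n : ℕ) :
    surprisal (fun y : Fin n → ℝ => ∏ i, p (y i)) =ᵐ[noiseLawN p n]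
      fun y => ∑ i, surprisal p (y i) := by
  have := h.isProbabilityMeasure
  filter_upwards [ae_pi_forall (ι := Fin n) h.ae_pos] with y hy
  simp_rw [surprisal, Real.log_prod fun i _ => (hy i).ne', Finset.sum_neg_distrib]

lemma integrable_surprisal (h : RegularDensity p b ζ) : Integrable (surprisal p) (noiseLaw p) :=
  integrable_of_mem_interior_integrableExpSet h.zero_mem_interior

lemma integrable_surprisal_prod (h : RegularDensity p b ζ) (n : ℕ) :
    Integrable (surprisal fun y : Fin n → ℝ => ∏ i, p (y i)) (noiseLawN p n) := by
  have := h.isProbabilityMeasure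
  exact (integrable_finsetSum _ fun i _ => integrable_comp_eval (μ := fun _ : Fin n => noiseLaw p)
    (i := i) h.integrable_surprisal).congr (h.surprisal_prod_ae_eq n).symm

lemma integral_surprisal_prod (h : RegularDensity p b ζ) (n : ℕ) :
    ∫ y, surprisal (fun y : Fin n → ℝ => ∏ i, p (y i)) y ∂noiseLawN p n =
      n * ∫ z, surprisal p z ∂noiseLaw p := by
  have := h.isProbabilityMeasure
  have hi (i : Fin n) : ∫ y, surprisal p (y i) ∂noiseLawN p n = ∫ z, surprisal p z ∂noiseLaw p :=
    integral_comp_eval (μ := fun _ : Fin n => noiseLaw p)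
      h.integrable_surprisal.aestronglyMeasurable
  rw [integral_congr_ae (h.surprisal_prod_ae_eq n),
    integral_finsetSum (μ := noiseLawN p n) _ fun i _ => integrable_comp_eval
      (μ := fun _ : Fin n => noiseLaw p) (i := i) h.integrable_surprisal]
  simp_rw [hi]
  simp

lemma exp_surprisal_prod_ae_eq (h : RegularDensity p b ζ) (n : ℕ) :
    (fun y => Real.exp (t * surprisal (fun y : Fin n → ℝ => ∏ i, p (y i)) y)) =ᵐ[noiseLawN p n]
      fun y => ∏ i, Real.exp (t * surprisal p (y i)) := by
  filter_upwards [h.surprisal_prod_ae_eq n] with y hy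
  rw [hy, Finset.mul_sum, Real.exp_sum]

lemma integrable_exp_surprisal_prod (h : RegularDensity p b ζ) (n : ℕ) (ht : t ≤ 1 - ζ) :
    Integrable (fun y => Real.exp (t * surprisal (fun y : Fin n → ℝ => ∏ i, p (y i)) y))
      (noiseLawN p n) := by
  refine Integrable.congr ?_ (h.exp_surprisal_prod_ae_eq n).symm
  exact Integrable.fintype_prod (f := fun _ z => Real.exp (t * surprisal p z))
    (μ := fun _ : Fin n => noiseLaw p) fun _ => h.mem_integrableExpSet ht

lemma cgf_surprisal_prod (h : RegularDensity p b ζ) (n : ℕ) :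
    cgf (surprisal fun y : Fin n → ℝ => ∏ i, p (y i)) (noiseLawN p n) t =
      n * cgf (surprisal p) (noiseLaw p) t := by
  rw [cgf, mgf, integral_congr_ae (h.exp_surprisal_prod_ae_eq n), noiseLawN,
    integral_fintype_prod_eq_pow (μ := noiseLaw p) fun z => Real.exp (t * surprisal p z),
    Real.log_pow, Fintype.card_fin, cgf, mgf]

lemma log_numMsg_le (h : RegularDensity p b ζ) (hγ0 : 0 < γ) (hγ : γ ≤ 1 - ζ) {Δ : ℝ}
    (hΔ : 0 ≤ Δ) {n : ℕ} (C : Code n) (hcov : C.IsCovert p Δ) :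
    (1 - C.avgError p) * Real.log C.numMsg ≤ Real.log 2 - Δ + (Δ + n *
      (cgf (surprisal p) (noiseLaw p) γ - γ * deriv (cgf (surprisal p) (noiseLaw p)) 0)) / γ := by
  have := h.isProbabilityMeasure
  have hpm := h.measurable
  have hbound (y : Fin n → ℝ) : ∏ i, p (y i) ≤ b ^ n :=
    (Finset.prod_le_prod (fun i _ => h.nonneg _) fun i _ => h.le_bound _).trans_eq (by simp)
  have hlaw : noiseLawN p n = volume.withDensity fun y => ENNReal.ofReal (∏ i, p (y i)) :=
    pi_withDensity_ofReal (fun _ => h.nonneg) fun _ => h.integrable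
  have hC := C.log_numMsg_le_of_isCovert (f := fun y => ∏ i, p (y i)) (by fun_prop)
    (fun y => Finset.prod_nonneg fun i _ => h.nonneg _) (one_le_pow₀ h.one_le) hbound hlaw
    (h.integrable_surprisal_prod n) hγ0 (by linarith [h.pos]) hΔ
    (h.integrable_exp_surprisal_prod n hγ) hcov
  rw [h.cgf_surprisal_prod n, h.integral_surprisal_prod n] at hC
  refine hC.trans_eq ?_
  rw [h.deriv_cgf_zero]
  field_simp
  ring

end RegularDensity

end RegularDensity

section Converse

lemma tendsto_sqrt_natCast : Tendsto (fun n : ℕ => √(n : ℝ)) atTop atTop :=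
  Real.tendsto_sqrt_atTop.comp tendsto_natCast_atTop_atTop

lemma tendsto_div_sqrt_nhdsGT {t : ℝ} (ht : 0 < t) :
    Tendsto (fun n : ℕ => t / √(n : ℝ)) atTop (𝓝[>] 0) := by
  refine tendsto_nhdsWithin_iff.2 ⟨tendsto_sqrt_natCast.const_div_atTop t, ?_⟩
  filter_upwards [eventually_gt_atTop 0] with n hn
  exact Set.mem_Ioi.2 (by positivity)

lemma RegularDensity.eventually_log_numMsg_le {p : ℝ → ℝ} {b ζ Δ a : ℝ}
    (h : RegularDensity p b ζ) (hΔ : 0 < Δ) (ha0 : 0 < a)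
    (ha : 2 * Δ * Var[surprisal p; noiseLaw p] < a ^ 2) :
    ∀ᶠ n : ℕ in atTop, ∀ C : Code n, C.IsCovert p Δ →
      (1 - C.avgError p) * Real.log C.numMsg ≤ a * √n := by
  have := h.isProbabilityMeasure
  -- The tilt `t / √n` that minimizes `Δ / t + t * a ^ 2 / (4 * Δ)`.
  obtain ⟨t, ht⟩ : ∃ t, t = 2 * Δ / a := ⟨_, rfl⟩
  have ht0 : 0 < t := by rw [ht]; positivity
  have htilt := tendsto_div_sqrt_nhdsGT ht0
  have hlim := (tendsto_sqrt_natCast.const_div_atTop (Real.log 2 - Δ)).add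
    ((((tendsto_cgf_sub_div_sq h.zero_mem_interior).comp htilt).const_mul t).const_add (Δ / t))
  have hlt : 0 + (Δ / t + t * (Var[surprisal p; noiseLaw p] / 2)) < a := by
    have : 0 + (Δ / t + t * (Var[surprisal p; noiseLaw p] / 2)) =
        (a ^ 2 + 2 * Δ * Var[surprisal p; noiseLaw p]) / (2 * a) := by
      rw [ht]
      field_simp
      ring
    rw [this, div_lt_iff₀ (by positivity)]
    linarith
  filter_upwards [hlim.eventually_le_const hlt, eventually_gt_atTop 0,
    htilt.eventually (Ioo_mem_nhdsGT (sub_pos.2 h.lt_one))] with n hn hn0 hγ C hcov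
  have hr : 0 < √(n : ℝ) := by positivity
  calc (1 - C.avgError p) * Real.log C.numMsg
    _ ≤ _ := h.log_numMsg_le hγ.1 hγ.2.le hΔ.le C hcov
    _ = _ * √n := ?_
    _ ≤ a * √n := mul_le_mul_of_nonneg_right hn hr.le
  rw [Function.comp_apply]
  nth_rewrite 1 [← Real.sq_sqrt n.cast_nonneg]
  field_simp

end Converse

section Achievability

variable {p : ℝ → ℝ} {b s γ κ : ℝ} {P : Measure ℝ} [IsProbabilityMeasure P]

lemma noiseLawN_tiltedDensity (hpm : Measurable p) (hp : IsPDF p) (hγ1 : γ < 1)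
    (n : ℕ) : noiseLawN (tiltedDensity p γ) n =
      Measure.pi fun _ => (noiseLaw p).tilted (γ * surprisal p ·) := by
  simp_rw [noiseLawN, noiseLaw_tiltedDensity hpm hp hγ1]

lemma klDiv_noiseLawN_tiltedDensity (hpm : Measurable p) (hp : IsPDF p) (hγ1 : γ < 1)
    (hγ : γ ∈ interior (integrableExpSet (surprisal p) (noiseLaw p))) (n : ℕ) :
    klDiv (noiseLawN (tiltedDensity p γ) n) (noiseLawN p n) =
      ENNReal.ofReal (n * (γ * deriv (cgf (surprisal p) (noiseLaw p)) γ -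
        cgf (surprisal p) (noiseLaw p) γ)) := by
  have := hp.isProbabilityMeasure
  rw [noiseLawN_tiltedDensity hpm hp hγ1, noiseLawN, klDiv_pi_tilted_mul_self hγ,
    Fintype.card_fin]

lemma noiseLawN_tiltedDensity_absolutelyContinuous (hpm : Measurable p) (hp : IsPDF p)
    (hγ1 : γ < 1) (hγ : γ ∈ interior (integrableExpSet (surprisal p) (noiseLaw p))) (n : ℕ) :
    noiseLawN (tiltedDensity p γ) n ≪ noiseLawN p n := by
  have hkl := klDiv_noiseLawN_tiltedDensity hpm hp hγ1 hγ n
  exact (klDiv_ne_top_iff.1 (hkl ▸ ENNReal.ofReal_ne_top)).1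

lemma exists_code_of_conv_tiltedDensity (hpm : Measurable p) (hp : IsPDF p)
    (hpb : ∀ z, p z ≤ b) (hγ1 : γ < 1)
    (h0 : 0 ∈ interior (integrableExpSet (surprisal p) (noiseLaw p)))
    (hγ : γ ∈ interior (integrableExpSet (surprisal p) (noiseLaw p)))
    (hconv : P.conv (noiseLaw p) = noiseLaw (tiltedDensity p γ)) (hs : 0 < s) (hs1 : s ≤ 1)
    (hκ0 : 0 ≤ κ)
    (hκ : ENNReal.ofReal (b ^ s) * ∫⁻ y, ENNReal.ofReal (tiltedDensity p γ y ^ (1 - s)) ≤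
      ENNReal.ofReal κ) {n M K : ℕ} [NeZero M] [NeZero K] {Δ ε V τ : ℝ} (hΔ : 0 < Δ)
    (hε : 0 < ε) (hV : Var[infoDensity p (tiltedDensity p γ); P.prod (noiseLaw p)] ≤ V)
    (hτ : τ < n * tiltInfo p γ)
    (h : (ENNReal.ofReal ((s * (M * K : ℝ) ^ s)⁻¹ * κ ^ n) +
        ENNReal.ofReal (n * (γ * deriv (cgf (surprisal p) (noiseLaw p)) γ -
          cgf (surprisal p) (noiseLaw p) γ))) / ENNReal.ofReal Δ +
      (ENNReal.ofReal (n * V / (n * tiltInfo p γ - τ) ^ 2) +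
        ENNReal.ofReal (M * Real.exp (-τ))) / ENNReal.ofReal ε < 1) :
    ∃ C : Code n, C.numMsg = M ∧ C.numKey = K ∧ C.IsCovert p Δ ∧ C.avgError p ≤ ε := by
  have := hp.isProbabilityMeasure
  have hqm := measurable_tiltedDensity (γ := γ) hpm
  have hq := isPDF_tiltedDensity hpm hp hγ1 (interior_subset hγ)
  refine exists_code_of_conv hpm hp hpb hqm hq hconv
    (noiseLawN_tiltedDensity_absolutelyContinuous hpm hp hγ1 hγ n) hs hs1 hΔ hε τ
    (lt_of_le_of_lt ?_ h)
  have hmean := integral_infoDensity_tiltedDensity hpm hp hγ1 h0 hγ hconv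
  have hcheb := measure_pi_sum_le_le (ι := Fin n)
    (memLp_infoDensity hpm hp hpb hqm hq hconv hs hκ0 hκ) (τ := τ)
    (by rwa [hmean, Fintype.card_fin])
  rw [hmean, Fintype.card_fin] at hcheb
  rw [klDiv_noiseLawN_tiltedDensity hpm hp hγ1 hγ,
    ENNReal.ofReal_mul (p := (_ * _)⁻¹) (by positivity), ENNReal.ofReal_pow hκ0,
    ENNReal.ofReal_mul (p := (M : ℝ)) (by positivity), Real.exp_neg,
    ENNReal.ofReal_inv_of_pos (Real.exp_pos _), ENNReal.ofReal_natCast]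
  gcongr
  exact hcheb.trans (by gcongr)

/-- A bound, for tilts near zero, on the single-letter factor in the soft-covering estimate; its
logarithm governs the rate of the key. -/
def keyFactor (p : ℝ → ℝ) (b s : ℝ) : ℝ :=
  b ^ s * mgf (surprisal p) (noiseLaw p) s + 1

lemma keyFactor_pos (hb : 0 ≤ b) : 0 < keyFactor p b s :=
  add_pos_of_nonneg_of_pos (mul_nonneg (Real.rpow_nonneg hb _) mgf_nonneg) one_pos

lemma eventually_lintegral_tiltedDensity_rpow_le (hpm : Measurable p) (hp : IsPDF p)
    (hb : 0 ≤ b) (h0 : 0 ∈ interior (integrableExpSet (surprisal p) (noiseLaw p)))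
    (hs : s ∈ interior (integrableExpSet (surprisal p) (noiseLaw p))) (hs1 : s < 1) :
    ∀ᶠ γ in 𝓝 0, ENNReal.ofReal (b ^ s) *
      ∫⁻ y, ENNReal.ofReal (tiltedDensity p γ y ^ (1 - s)) ≤
        ENNReal.ofReal (keyFactor p b s) := by
  have := hp.isProbabilityMeasure
  have hlin : Tendsto (fun γ : ℝ => γ + s - γ * s) (𝓝 0) (𝓝 s) :=
    (by fun_prop : Continuous fun γ : ℝ => γ + s - γ * s).tendsto' _ _ (by simp)
  have hlim : Tendsto (fun γ => b ^ s * (mgf (surprisal p) (noiseLaw p) γ ^ (s - 1) *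
      mgf (surprisal p) (noiseLaw p) (γ + s - γ * s))) (𝓝 0)
      (𝓝 (b ^ s * mgf (surprisal p) (noiseLaw p) s)) := by
    have h := (((analyticAt_mgf h0).continuousAt.tendsto.rpow_const (p := s - 1)
      (.inl (by simp))).mul ((analyticAt_mgf hs).continuousAt.tendsto.comp hlin)).const_mul (b ^ s)
    simpa using h
  filter_upwards [hlim.eventually_le_const (lt_add_one _), eventually_lt_nhds one_pos,
    hlin.eventually_mem (isOpen_interior.mem_nhds hs)] with γ hle hγ1 hmem
  rw [lintegral_tiltedDensity_rpow hpm hp hγ1 hs1 (interior_subset hmem),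
    ← ENNReal.ofReal_mul (Real.rpow_nonneg hb _)]
  exact ENNReal.ofReal_le_ofReal hle

/-- A bound on the variance of the information density that vanishes with the tilt. -/
def dispersionBound (p : ℝ → ℝ) (s κ γ : ℝ) : ℝ :=
  √γ * (4 * (tiltInfo p γ / γ) + 6 / s ^ 3 * κ)

lemma tendsto_dispersionBound (hp : IsPDF p)
    (h0 : 0 ∈ interior (integrableExpSet (surprisal p) (noiseLaw p))) :
    Tendsto (dispersionBound p s κ) (𝓝[>] 0) (𝓝 0) := by
  have hsqrt : Tendsto (√·) (𝓝[>] (0 : ℝ)) (𝓝 0) :=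
    (Real.continuous_sqrt.tendsto' 0 0 Real.sqrt_zero).mono_left nhdsWithin_le_nhds
  have h := hsqrt.mul (((tendsto_tiltInfo_div hp h0).const_mul 4).add_const (6 / s ^ 3 * κ))
  rw [zero_mul] at h
  exact h

lemma variance_infoDensity_tiltedDensity_le (hpm : Measurable p) (hp : IsPDF p)
    (hpb : ∀ z, p z ≤ b) (hγ0 : 0 < γ) (hγ1 : γ < 1)
    (h0 : 0 ∈ interior (integrableExpSet (surprisal p) (noiseLaw p)))
    (hγ : γ ∈ interior (integrableExpSet (surprisal p) (noiseLaw p)))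
    (hconv : P.conv (noiseLaw p) = noiseLaw (tiltedDensity p γ)) (hs : 0 < s) (hκ0 : 0 ≤ κ)
    (hκ : ENNReal.ofReal (b ^ s) * ∫⁻ y, ENNReal.ofReal (tiltedDensity p γ y ^ (1 - s)) ≤
      ENNReal.ofReal κ) :
    Var[infoDensity p (tiltedDensity p γ); P.prod (noiseLaw p)] ≤ dispersionBound p s κ γ := by
  have hr : 0 < √γ := Real.sqrt_pos.2 hγ0
  have hT : 1 ≤ (√γ)⁻¹ := (one_le_inv₀ hr).2 (Real.sqrt_le_one.2 hγ1.le)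
  have hvar := variance_infoDensity_le hpm hp hpb (measurable_tiltedDensity hpm)
    (isPDF_tiltedDensity hpm hp hγ1 (interior_subset hγ)) hconv hs hκ0 hκ hT
  rw [integral_infoDensity_tiltedDensity hpm hp hγ1 h0 hγ hconv] at hvar
  refine hvar.trans_eq ?_
  rw [dispersionBound]
  field_simp
  rw [Real.sq_sqrt hγ0.le]
  ring

end Achievability

section Asymptotics

variable {p : ℝ → ℝ} {s κ R a r t : ℝ}

lemma tendsto_inv_mul_rpow_mul_pow (hs : 0 < s) (hκ : 0 < κ) (hR : Real.log κ < R * s)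
    {N : ℕ → ℝ} (hN : ∀ n : ℕ, Real.exp (R * n) ≤ N n) :
    Tendsto (fun n : ℕ => (s * N n ^ s)⁻¹ * κ ^ n) atTop (𝓝 0) := by
  have hN0 (n : ℕ) : 0 < N n := (Real.exp_pos _).trans_le (hN n)
  have hgeom : Tendsto (fun n : ℕ => s⁻¹ * Real.exp (Real.log κ - R * s) ^ n) atTop (𝓝 0) := by
    have h := (tendsto_pow_atTop_nhds_zero_of_lt_one (Real.exp_nonneg _)
      (Real.exp_lt_one_iff.2 (sub_neg.2 hR))).const_mul s⁻¹
    rwa [mul_zero] at h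
  refine squeeze_zero (fun n => ?_) (fun n => ?_) hgeom
  · have := hN0 n
    positivity
  · have hle : Real.exp (R * s * n) ≤ N n ^ s := by
      rw [mul_right_comm, Real.exp_mul]
      exact Real.rpow_le_rpow (Real.exp_nonneg _) (hN n) hs.le
    rw [mul_inv, mul_assoc]
    gcongr
    calc (N n ^ s)⁻¹ * κ ^ n ≤ (Real.exp (R * s * n))⁻¹ * κ ^ n := by gcongr
      _ = Real.exp (Real.log κ - R * s) ^ n := by
        rw [← Real.exp_nat_mul, mul_sub, Real.exp_sub, Real.exp_nat_mul, Real.exp_log hκ,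
          mul_comm (n : ℝ), div_eq_inv_mul]

lemma ceil_exp_le_two_mul {x : ℝ} (hx : 0 ≤ x) : (⌈Real.exp x⌉₊ : ℝ) ≤ 2 * Real.exp x := by
  linarith [Nat.ceil_lt_add_one (Real.exp_nonneg x), Real.one_le_exp hx]

lemma tendsto_ceil_exp_mul_exp_neg (ha : 0 ≤ a) (har : a < r) :
    Tendsto (fun n : ℕ => (⌈Real.exp (a * √n)⌉₊ : ℝ) * Real.exp (-(r * √n))) atTop (𝓝 0) := by
  have hexp : Tendsto (fun n : ℕ => 2 * Real.exp (-((r - a) * √n))) atTop (𝓝 0) := by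
    have h := (Real.tendsto_exp_neg_atTop_nhds_zero.comp
      (tendsto_sqrt_natCast.const_mul_atTop (sub_pos.2 har))).const_mul 2
    rwa [mul_zero] at h
  refine squeeze_zero (fun n => by positivity) (fun n => ?_) hexp
  calc (⌈Real.exp (a * √n)⌉₊ : ℝ) * Real.exp (-(r * √n))
    _ ≤ 2 * Real.exp (a * √n) * Real.exp (-(r * √n)) := by
        gcongr
        exact ceil_exp_le_two_mul (by positivity)
    _ = 2 * Real.exp (-((r - a) * √n)) := by
        rw [mul_assoc, ← Real.exp_add]
        ring_nf

lemma tendsto_natCast_mul_of_tendsto_div_sq {f : ℝ → ℝ} {c : ℝ} (ht : 0 < t)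
    (hf : Tendsto (fun γ => f γ / γ ^ 2) (𝓝[>] 0) (𝓝 c)) :
    Tendsto (fun n : ℕ => n * f (t / √n)) atTop (𝓝 (t ^ 2 * c)) := by
  refine ((hf.comp (tendsto_div_sqrt_nhdsGT ht)).const_mul (t ^ 2)).congr' ?_
  filter_upwards [eventually_gt_atTop 0] with n hn
  have hn0 : (0 : ℝ) < n := Nat.cast_pos.2 hn
  rw [Function.comp_apply, div_pow, Real.sq_sqrt hn0.le]
  field_simp

lemma tendsto_sqrt_mul_of_tendsto_div {f : ℝ → ℝ} {c : ℝ} (ht : 0 < t)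
    (hf : Tendsto (fun γ => f γ / γ) (𝓝[>] 0) (𝓝 c)) :
    Tendsto (fun n : ℕ => √n * f (t / √n)) atTop (𝓝 (t * c)) := by
  refine ((hf.comp (tendsto_div_sqrt_nhdsGT ht)).const_mul t).congr' ?_
  filter_upwards [eventually_gt_atTop 0] with n hn
  have : 0 < √(n : ℝ) := by positivity
  rw [Function.comp_apply]
  field_simp

lemma tendsto_chebyshev {v f : ℝ → ℝ} {c : ℝ} (ht : 0 < t) (hrc : r < t * c)
    (hv : Tendsto v (𝓝[>] 0) (𝓝 0)) (hf : Tendsto (fun γ => f γ / γ) (𝓝[>] 0) (𝓝 c)) :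
    Tendsto (fun n : ℕ => n * v (t / √n) / (n * f (t / √n) - r * √n) ^ 2) atTop (𝓝 0) := by
  have h := (hv.comp (tendsto_div_sqrt_nhdsGT ht)).div
    (((tendsto_sqrt_mul_of_tendsto_div ht hf).sub_const r).pow 2) (by positivity [sub_pos.2 hrc])
  rw [zero_div] at h
  refine h.congr' ?_
  filter_upwards [eventually_gt_atTop 0] with n hn
  have hn0 : (0 : ℝ) < n := Nat.cast_pos.2 hn
  have : n * f (t / √n) - r * √n = √n * (√n * f (t / √n) - r) := by
    rw [mul_sub, ← mul_assoc, Real.mul_self_sqrt hn0.le, mul_comm r]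
  rw [this, mul_pow, Real.sq_sqrt hn0.le, mul_div_mul_left _ _ hn0.ne']
  rfl

end Asymptotics

section AchievableRate

variable {p : ℝ → ℝ} {b ζ s κ R a r t Δ ε : ℝ}

lemma exists_tilt_of_sq_lt {V : ℝ} (hV : 0 ≤ V) (ha : 0 ≤ a) (h : a ^ 2 < 2 * Δ * V) :
    ∃ t, 0 < t ∧ a < t * V ∧ t ^ 2 * (V / 2) < Δ := by
  have hV0 : 0 < V := hV.lt_of_ne (by rintro rfl; nlinarith [sq_nonneg a])
  have hlt : a / V < √(2 * Δ / V) := by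
    refine Real.lt_sqrt_of_sq_lt ?_
    rw [div_pow, div_lt_div_iff₀ (by positivity) hV0]
    nlinarith
  obtain ⟨t, hat, htΔ⟩ := exists_between hlt
  have ht : 0 < t := lt_of_le_of_lt (by positivity) hat
  rw [Real.lt_sqrt ht.le, lt_div_iff₀ hV0] at htΔ
  exact ⟨t, ht, (div_lt_iff₀ hV0).1 hat, by linarith⟩

lemma eventually_failureBound_lt_one (hp : IsPDF p)
    (h0 : 0 ∈ interior (integrableExpSet (surprisal p) (noiseLaw p))) (hs : 0 < s) (hκ : 0 < κ)
    (hR : Real.log κ < R * s) (ha : 0 ≤ a) (har : a < r) (ht : 0 < t)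
    (hrt : r < t * Var[surprisal p; noiseLaw p])
    (htΔ : t ^ 2 * (Var[surprisal p; noiseLaw p] / 2) < Δ) (hε : 0 < ε) :
    ∀ᶠ n : ℕ in atTop,
      (ENNReal.ofReal ((s * (⌈Real.exp (a * √n)⌉₊ * ⌈Real.exp (R * n)⌉₊ : ℝ) ^ s)⁻¹ * κ ^ n) +
        ENNReal.ofReal (n * (t / √n * deriv (cgf (surprisal p) (noiseLaw p)) (t / √n) -
          cgf (surprisal p) (noiseLaw p) (t / √n)))) / ENNReal.ofReal Δ +
      (ENNReal.ofReal (n * dispersionBound p s κ (t / √n) /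
          (n * tiltInfo p (t / √n) - r * √n) ^ 2) +
        ENNReal.ofReal (⌈Real.exp (a * √n)⌉₊ * Real.exp (-(r * √n)))) / ENNReal.ofReal ε < 1 := by
  have := hp.isProbabilityMeasure
  have hV : 0 ≤ Var[surprisal p; noiseLaw p] := variance_nonneg _ _
  have hΔ : 0 < Δ := lt_of_le_of_lt (by positivity) htΔ
  have hcodebook (n : ℕ) :
      Real.exp (R * n) ≤ (⌈Real.exp (a * √n)⌉₊ : ℝ) * ⌈Real.exp (R * n)⌉₊ :=
    (Nat.le_ceil _).trans <| le_mul_of_one_le_left (Nat.cast_nonneg _) <|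
      (Real.one_le_exp (by positivity)).trans (Nat.le_ceil _)
  have hsoft := tendsto_inv_mul_rpow_mul_pow hs hκ hR hcodebook
  have hdiv := tendsto_natCast_mul_of_tendsto_div_sq ht (tendsto_legendre_cgf_div_sq h0)
  have hcheb := tendsto_chebyshev ht hrt (tendsto_dispersionBound (s := s) (κ := κ) hp h0)
    (tendsto_tiltInfo_div hp h0)
  have hthreshold := tendsto_ceil_exp_mul_exp_neg ha har
  have hlim := (ENNReal.Tendsto.div_const ((ENNReal.tendsto_ofReal hsoft).add
    (ENNReal.tendsto_ofReal hdiv)) (.inr (ENNReal.ofReal_pos.2 hΔ).ne')).add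
    (ENNReal.Tendsto.div_const ((ENNReal.tendsto_ofReal hcheb).add
      (ENNReal.tendsto_ofReal hthreshold)) (.inr (ENNReal.ofReal_pos.2 hε).ne'))
  refine hlim.eventually_lt_const ?_
  rw [ENNReal.ofReal_zero, zero_add, add_zero, ENNReal.zero_div, add_zero,
    ← ENNReal.ofReal_div_of_pos hΔ, ENNReal.ofReal_lt_one, div_lt_one hΔ]
  exact htΔ

lemma RegularDensity.eventually_exists_code (h : RegularDensity p b ζ)
    (hdec : ∀ᶠ γ in 𝓝[>] 0, ∃ P : Measure ℝ, IsProbabilityMeasure P ∧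
      P.conv (noiseLaw p) = noiseLaw (tiltedDensity p γ))
    (hs : 0 < s) (hsζ : s < 1 - ζ) (hR : Real.log (keyFactor p b s) < R * s) (ha : 0 ≤ a)
    (haΔ : a ^ 2 < 2 * Δ * Var[surprisal p; noiseLaw p]) (hε : 0 < ε) :
    ∀ᶠ n : ℕ in atTop, ∃ C : Code n, C.numMsg = ⌈Real.exp (a * √n)⌉₊ ∧
      C.numKey = ⌈Real.exp (R * n)⌉₊ ∧ C.IsCovert p Δ ∧ C.avgError p ≤ ε := by
  have := h.isProbabilityMeasure
  have hp := h.toIsPDF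
  have h0 := h.zero_mem_interior
  have hb : 0 ≤ b := zero_le_one.trans h.one_le
  have hs1 : s < 1 := by linarith [h.pos]
  have hκ := keyFactor_pos (p := p) (s := s) hb
  have hV : 0 ≤ Var[surprisal p; noiseLaw p] := variance_nonneg _ _
  obtain ⟨t, ht, hat, htΔ⟩ := exists_tilt_of_sq_lt hV ha haΔ
  obtain ⟨r, har, hrt⟩ := exists_between hat
  have htilt := tendsto_div_sqrt_nhdsGT ht
  have hlint := (htilt.mono_right nhdsWithin_le_nhds).eventually
    (eventually_lintegral_tiltedDensity_rpow_le h.measurable hp hb h0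
      (h.mem_interior_integrableExpSet hsζ) hs1)
  filter_upwards [eventually_failureBound_lt_one hp h0 hs hκ hR ha har ht hrt htΔ hε,
    (tendsto_sqrt_mul_of_tendsto_div ht (tendsto_tiltInfo_div hp h0)).eventually_const_lt hrt,
    htilt.eventually hdec, hlint,
    htilt.eventually (Ioo_mem_nhdsGT (sub_pos.2 h.lt_one)), eventually_gt_atTop 0]
    with n hfail hinfo ⟨P, hP, hconv⟩ hγs hγ hn
  have hγ1 : t / √n < 1 := by linarith [hγ.2, h.pos]
  have hmem := h.mem_interior_integrableExpSet hγ.2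
  have : NeZero ⌈Real.exp (a * √n)⌉₊ := ⟨(Nat.ceil_pos.2 (Real.exp_pos _)).ne'⟩
  have : NeZero ⌈Real.exp (R * n)⌉₊ := ⟨(Nat.ceil_pos.2 (Real.exp_pos _)).ne'⟩
  have hτ : r * √n < n * tiltInfo p (t / √n) := by
    have hr : 0 < √(n : ℝ) := by positivity
    have hsq : √(n : ℝ) * √n = n := Real.mul_self_sqrt n.cast_nonneg
    nlinarith [mul_lt_mul_of_pos_right hinfo hr]
  exact exists_code_of_conv_tiltedDensity h.measurable hp h.le_bound hγ1 h0 hmem hconv hs hs1.le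
    hκ.le hγs (lt_of_le_of_lt (by positivity) htΔ) hε
    (variance_infoDensity_tiltedDensity_le h.measurable hp h.le_bound hγ.1 hγ1 h0 hmem hconv hs
      hκ.le hγs) hτ hfail

end AchievableRate

section TrivialCode

/-- The code with a single codeword, the origin, and a single key. It stands in for the lengths at
which the random coding argument yields no code. -/
def Code.trivial (n : ℕ) : Code n where
  numMsg := 1
  numKey := 1
  numMsg_pos := one_pos
  numKey_pos := one_pos
  enc := fun _ _ => 0
  dec := fun _ _ => 0
  measurable_dec := fun _ => measurable_const

variable {p : ℝ → ℝ} {n : ℕ}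

lemma Code.isCovert_trivial [SigmaFinite (noiseLawN p n)] (Δ : ℝ) :
    (Code.trivial n).IsCovert p Δ := by
  have h : (Code.trivial n).outputLaw p = noiseLawN p n := by
    change (((1 : ℕ) : ℝ≥0∞) * ((1 : ℕ) : ℝ≥0∞))⁻¹ •
      ∑ _m : Fin 1, ∑ _k : Fin 1, (noiseLawN p n).map (fun z => 0 + z) = _
    simp
  rw [IsCovert, h, klDiv_self]
  exact zero_le

lemma Code.avgError_trivial (p : ℝ → ℝ) : (Code.trivial n).avgError p = 0 := by
  have h (m k) : {z | (trivial n).dec ((trivial n).enc m k + z) k ≠ m} = ∅ :=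
    Set.eq_empty_of_forall_notMem fun z hz => hz (Subsingleton.elim (α := Fin 1) _ _)
  simp only [avgError, h, measureReal_empty, Finset.sum_const_zero, mul_zero]

end TrivialCode

section ScalingConstant

lemma le_log_ceil_exp (x : ℝ) : x ≤ Real.log ⌈Real.exp x⌉₊ :=
  (Real.le_log_iff_exp_le (Nat.cast_pos.2 (Nat.ceil_pos.2 (Real.exp_pos x)))).2 (Nat.le_ceil _)

lemma log_ceil_exp_le {x : ℝ} (hx : 0 ≤ x) : Real.log ⌈Real.exp x⌉₊ ≤ x + Real.log 2 := by
  rw [Real.log_le_iff_le_exp (Nat.cast_pos.2 (Nat.ceil_pos.2 (Real.exp_pos x))), Real.exp_add,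
    Real.exp_log two_pos, mul_comm]
  exact ceil_exp_le_two_mul hx

/-- The number `√2 √Var[ln p_Z(Z)]`, which turns out to be `L`. -/
def scalingConstant (p : ℝ → ℝ) : ℝ :=
  √2 * √Var[surprisal p; noiseLaw p]

variable {p : ℝ → ℝ} {b ζ a Δ ε L R : ℝ} {n : ℕ}

lemma scalingConstant_nonneg (p : ℝ → ℝ) : 0 ≤ scalingConstant p := by
  rw [scalingConstant]
  positivity

lemma sq_scalingConstant (p : ℝ → ℝ) :
    scalingConstant p ^ 2 = 2 * Var[surprisal p; noiseLaw p] := by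
  rw [scalingConstant, mul_pow, Real.sq_sqrt zero_le_two, Real.sq_sqrt (variance_nonneg _ _)]

lemma Code.avgError_nonneg (C : Code n) (p : ℝ → ℝ) : 0 ≤ C.avgError p :=
  mul_nonneg (by positivity)
    (Finset.sum_nonneg fun _ _ => Finset.sum_nonneg fun _ _ => measureReal_nonneg)

/-- The code is covert, its average error is at most `ε`, its normalized message length is
`ε`-close to `L`, and its key length per channel use is at most `R`. -/
structure Code.Attains (C : Code n) (p : ℝ → ℝ) (Δ L R ε : ℝ) : Prop where
  isCovert : C.IsCovert p Δ
  avgError_le : C.avgError p ≤ ε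
  abs_sub_le : |Real.log C.numMsg / √(n * Δ) - L| ≤ ε
  log_numKey_le : Real.log C.numKey ≤ R * n

lemma Code.attains_trivial [SigmaFinite (noiseLawN p n)] (hε : 0 ≤ ε) (hR : 0 ≤ R) :
    (Code.trivial n).Attains p Δ 0 R ε where
  isCovert := Code.isCovert_trivial Δ
  avgError_le := (Code.avgError_trivial p).trans_le hε
  abs_sub_le := by simpa [Code.trivial] using hε
  log_numKey_le := by
    simp only [Code.trivial, Nat.cast_one, Real.log_one]
    positivity

lemma tendsto_log_ceil_exp_div_sqrt (ha : 0 ≤ a) (hΔ : 0 < Δ) :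
    Tendsto (fun n : ℕ => Real.log ⌈Real.exp (a * √Δ * √n)⌉₊ / √(n * Δ)) atTop (𝓝 a) := by
  have hsqrt (n : ℕ) : a * √Δ * √n = a * √(n * Δ) := by
    rw [mul_assoc, mul_comm (√Δ), Real.sqrt_mul n.cast_nonneg]
  have hlarge : Tendsto (fun n : ℕ => √(n * Δ)) atTop atTop :=
    Real.tendsto_sqrt_atTop.comp (tendsto_natCast_atTop_atTop.atTop_mul_const hΔ)
  have hlim : Tendsto (fun n : ℕ => a + Real.log 2 / √(n * Δ)) atTop (𝓝 a) := by
    simpa using (hlarge.const_div_atTop (Real.log 2)).const_add a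
  simp_rw [hsqrt]
  refine tendsto_of_tendsto_of_tendsto_of_le_of_le' tendsto_const_nhds hlim ?_ ?_
  · filter_upwards [hlarge.eventually_gt_atTop 0] with n hn
    exact (le_div_iff₀ hn).2 (le_log_ceil_exp _)
  · filter_upwards [hlarge.eventually_gt_atTop 0] with n hn
    rw [div_le_iff₀ hn, add_mul, div_mul_cancel₀ _ hn.ne']
    exact log_ceil_exp_le (by positivity)

lemma log_ceil_exp_mul_natCast_le (hR : 0 ≤ R) (hn : 0 < n) :
    Real.log ⌈Real.exp (R * n)⌉₊ ≤ (R + 1) * n := by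
  have h := log_ceil_exp_le (x := R * n) (by positivity)
  have : (1 : ℝ) ≤ n := by exact_mod_cast hn
  linarith [Real.log_two_lt_d9]

lemma RegularDensity.exists_keyRate_eventually_attains (h : RegularDensity p b ζ)
    (hdec : ∀ᶠ γ in 𝓝[>] 0, ∃ P : Measure ℝ, IsProbabilityMeasure P ∧
      P.conv (noiseLaw p) = noiseLaw (tiltedDensity p γ)) (hΔ : 0 < Δ) :
    ∃ R, ∀ ε, 0 < ε → ∀ᶠ n : ℕ in atTop, ∃ C : Code n, C.Attains p Δ (scalingConstant p) R ε := by
  have := h.isProbabilityMeasure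
  rcases (scalingConstant_nonneg p).eq_or_lt with hL | hL
  · refine ⟨0, fun ε hε => .of_forall fun n => ⟨Code.trivial n, ?_⟩⟩
    rw [← hL]
    exact Code.attains_trivial hε.le le_rfl
  obtain ⟨s, hs, hsζ⟩ := exists_between (sub_pos.2 h.lt_one)
  obtain ⟨R, hR⟩ := exists_gt (max 0 (Real.log (keyFactor p b s) / s))
  obtain ⟨hR0, hR⟩ := max_lt_iff.1 hR
  refine ⟨R + 1, fun ε hε => ?_⟩
  obtain ⟨a, ha, haL⟩ := exists_between (max_lt hL (sub_lt_self (scalingConstant p) hε))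
  obtain ⟨ha0, haε⟩ := max_lt_iff.1 ha
  have haΔ : (a * √Δ) ^ 2 < 2 * Δ * Var[surprisal p; noiseLaw p] := by
    rw [mul_right_comm, ← sq_scalingConstant, mul_pow, Real.sq_sqrt hΔ.le]
    gcongr
  have hclose : |a - scalingConstant p| < ε := abs_sub_lt_iff.2 ⟨by linarith, by linarith⟩
  filter_upwards [h.eventually_exists_code hdec hs hsζ ((div_lt_iff₀ hs).1 hR) (by positivity)
      haΔ hε, eventually_gt_atTop 0,
    ((tendsto_log_ceil_exp_div_sqrt ha0.le hΔ).sub_const _).abs.eventually_le_const hclose]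
    with n ⟨C, hmsg, hkey, hcov, herr⟩ hn hrate
  exact ⟨C, hcov, herr, hmsg ▸ hrate, hkey ▸ log_ceil_exp_mul_natCast_le hR0.le hn⟩

lemma exists_tendsto_atTop_eventually {P : ℕ → ℕ → Prop} (h : ∀ k, ∀ᶠ n in atTop, P k n) :
    ∃ φ : ℕ → ℕ, Tendsto φ atTop atTop ∧ ∀ᶠ n in atTop, P (φ n) n := by
  classical
  refine ⟨fun n => Nat.findGreatest (P · n) n, tendsto_atTop.2 fun k => ?_, ?_⟩
  · filter_upwards [h k, eventually_ge_atTop k] with n hP hk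
    exact Nat.le_findGreatest hk hP
  · filter_upwards [h 0] with n hP
    exact Nat.findGreatest_spec (P := (P · n)) (Nat.zero_le n) hP

lemma RegularDensity.exists_code_sequence (h : RegularDensity p b ζ)
    (hdec : ∀ᶠ γ in 𝓝[>] 0, ∃ P : Measure ℝ, IsProbabilityMeasure P ∧
      P.conv (noiseLaw p) = noiseLaw (tiltedDensity p γ)) (hΔ : 0 < Δ) :
    ∃ C : (n : ℕ) → Code n, (∀ n, (C n).IsCovert p Δ) ∧
      Tendsto (fun n => (C n).avgError p) atTop (𝓝 0) ∧
      Tendsto (fun n : ℕ => Real.log (C n).numMsg / √(n * Δ)) atTop (𝓝 (scalingConstant p)) ∧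
      (fun n => Real.log (C n).numKey) =O[atTop] fun n : ℕ => (n : ℝ) := by
  have := h.isProbabilityMeasure
  obtain ⟨R, hR⟩ := h.exists_keyRate_eventually_attains hdec hΔ
  obtain ⟨φ, hφ, hattains⟩ := exists_tendsto_atTop_eventually fun k : ℕ =>
    hR (1 / (k + 1)) Nat.one_div_pos_of_nat
  have hε : Tendsto (fun n => (1 : ℝ) / (φ n + 1)) atTop (𝓝 0) :=
    tendsto_one_div_add_atTop_nhds_zero_nat.comp hφ
  have hcode (n : ℕ) : ∃ C : Code n, C.IsCovert p Δ ∧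
      ((∃ C : Code n, C.Attains p Δ (scalingConstant p) R (1 / (φ n + 1))) →
        C.Attains p Δ (scalingConstant p) R (1 / (φ n + 1))) := by
    by_cases hex : ∃ C : Code n, C.Attains p Δ (scalingConstant p) R (1 / (φ n + 1))
    · obtain ⟨C, hC⟩ := hex
      exact ⟨C, hC.isCovert, fun _ => hC⟩
    · exact ⟨Code.trivial n, Code.isCovert_trivial Δ, fun hC => absurd hC hex⟩
  choose C hcov hC using hcode
  replace hC := hattains.mono hC
  refine ⟨C, hcov, ?_, ?_, ?_⟩
  · exact squeeze_zero' (.of_forall fun n => (C n).avgError_nonneg p)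
      (hC.mono fun _ hn => hn.avgError_le) hε
  · exact tendsto_iff_dist_tendsto_zero.2 <| squeeze_zero' (.of_forall fun _ => dist_nonneg)
      (hC.mono fun _ hn => hn.abs_sub_le) hε
  · refine .of_bound R (hC.mono fun n hn => ?_)
    rw [Real.norm_of_nonneg (Real.log_natCast_nonneg _), Real.norm_of_nonneg n.cast_nonneg]
    exact hn.log_numKey_le

lemma ofReal_le_liminf_maxLogMsg {C : (n : ℕ) → Code n} (hcov : ∀ n, (C n).IsCovert p Δ)
    (herr : Tendsto (fun n => (C n).avgError p) atTop (𝓝 0))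
    (hmsg : Tendsto (fun n : ℕ => Real.log (C n).numMsg / √(n * Δ)) atTop (𝓝 L))
    (hΔ : 0 < Δ) (hε : 0 < ε) :
    ENNReal.ofReal L ≤
      liminf (fun n : ℕ => maxLogMsg p n Δ ε / ENNReal.ofReal √(n * Δ)) atTop := by
  rw [← (ENNReal.tendsto_ofReal hmsg).liminf_eq]
  refine liminf_le_liminf ?_
  filter_upwards [herr.eventually_le_const hε, eventually_gt_atTop 0] with n hn hn0
  rw [ENNReal.ofReal_div_of_pos (by positivity)]
  exact ENNReal.div_le_div_right (le_iSup₂_of_le (C n) ⟨hcov n, hn⟩ le_rfl) _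

lemma RegularDensity.liminf_maxLogMsg_le_of_lt (h : RegularDensity p b ζ) (hΔ : 0 < Δ)
    (hε : ε < 1) (ha : scalingConstant p < a) :
    liminf (fun n : ℕ => maxLogMsg p n Δ ε / ENNReal.ofReal √(n * Δ)) atTop ≤
      ENNReal.ofReal (a / (1 - ε)) := by
  have hL := scalingConstant_nonneg p
  have ha0 : 0 < a := hL.trans_lt ha
  have haΔ : 2 * Δ * Var[surprisal p; noiseLaw p] < (a * √Δ) ^ 2 := by
    rw [mul_right_comm, ← sq_scalingConstant, mul_pow, Real.sq_sqrt hΔ.le]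
    gcongr
  refine liminf_le_of_frequently_le' (Eventually.frequently ?_)
  filter_upwards [h.eventually_log_numMsg_le hΔ (by positivity) haΔ] with n hn
  refine ENNReal.div_le_of_le_mul (iSup₂_le fun C hC => ?_)
  rw [← ENNReal.ofReal_mul (div_nonneg ha0.le (sub_pos.2 hε).le), div_mul_eq_mul_div]
  refine ENNReal.ofReal_le_ofReal ((le_div_iff₀ (sub_pos.2 hε)).2 ?_)
  calc Real.log C.numMsg * (1 - ε)
    _ ≤ (1 - C.avgError p) * Real.log C.numMsg := by
        rw [mul_comm]
        exact mul_le_mul_of_nonneg_right (by linarith [hC.2]) (Real.log_natCast_nonneg _)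
    _ ≤ a * √Δ * √n := hn C hC.1
    _ = a * √(n * Δ) := by rw [mul_assoc, mul_comm (√Δ), Real.sqrt_mul n.cast_nonneg]

lemma RegularDensity.liminf_maxLogMsg_le (h : RegularDensity p b ζ) (hΔ : 0 < Δ) (hε : ε < 1) :
    liminf (fun n : ℕ => maxLogMsg p n Δ ε / ENNReal.ofReal √(n * Δ)) atTop ≤
      ENNReal.ofReal (scalingConstant p / (1 - ε)) := by
  have hlim : Tendsto (fun a : ℝ => ENNReal.ofReal (a / (1 - ε))) (𝓝[>] scalingConstant p)
      (𝓝 (ENNReal.ofReal (scalingConstant p / (1 - ε)))) :=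
    ENNReal.tendsto_ofReal ((tendsto_id.div_const _).mono_left nhdsWithin_le_nhds)
  refine ge_of_tendsto hlim ?_
  filter_upwards [self_mem_nhdsWithin] with a ha
  exact h.liminf_maxLogMsg_le_of_lt hΔ hε ha

lemma RegularDensity.isScalingConstant (h : RegularDensity p b ζ)
    (hdec : ∀ᶠ γ in 𝓝[>] 0, ∃ P : Measure ℝ, IsProbabilityMeasure P ∧
      P.conv (noiseLaw p) = noiseLaw (tiltedDensity p γ)) (hΔ : 0 < Δ) :
    IsScalingConstant p Δ (scalingConstant p) := by
  obtain ⟨C, hcov, herr, hmsg, -⟩ := h.exists_code_sequence hdec hΔ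
  have hupper : Tendsto (fun ε : ℝ => ENNReal.ofReal (scalingConstant p / (1 - ε))) (𝓝[>] 0)
      (𝓝 (ENNReal.ofReal (scalingConstant p))) := by
    have hlim := tendsto_const_nhds (x := scalingConstant p).div
      ((tendsto_id (x := 𝓝 (0 : ℝ))).const_sub 1) (by norm_num)
    rw [sub_zero, div_one] at hlim
    exact ENNReal.tendsto_ofReal (hlim.mono_left nhdsWithin_le_nhds)
  refine ⟨scalingConstant_nonneg p,
    tendsto_of_tendsto_of_tendsto_of_le_of_le' tendsto_const_nhds hupper ?_ ?_⟩
  · filter_upwards [self_mem_nhdsWithin] with ε hε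
    exact ofReal_le_liminf_maxLogMsg hcov herr hmsg hΔ hε
  · filter_upwards [Ioo_mem_nhdsGT one_pos] with ε hε
    exact h.liminf_maxLogMsg_le hΔ hε.2

end ScalingConstant

section Versions

variable {p p' : ℝ → ℝ}

lemma noiseLaw_congr (h : p =ᵐ[volume] p') : noiseLaw p = noiseLaw p' :=
  withDensity_congr_ae (h.fun_comp ENNReal.ofReal)

lemma tiltedDensity_ae_eq (h : p =ᵐ[volume] p') (γ : ℝ) :
    tiltedDensity p γ =ᵐ[volume] tiltedDensity p' γ := by
  have hrpow : (fun z => p z ^ (1 - γ)) =ᵐ[volume] fun z => p' z ^ (1 - γ) :=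
    h.fun_comp (· ^ (1 - γ))
  filter_upwards [hrpow] with z hz
  rw [tiltedDensity, tiltedDensity, integral_congr_ae hrpow, hz]

lemma Code.isCovert_congr (h : noiseLaw p = noiseLaw p') {n : ℕ} (C : Code n) {Δ : ℝ} :
    C.IsCovert p Δ ↔ C.IsCovert p' Δ := by
  simp only [IsCovert, outputLaw, noiseLawN, h]

lemma Code.avgError_congr (h : noiseLaw p = noiseLaw p') {n : ℕ} (C : Code n) :
    C.avgError p = C.avgError p' := by
  simp only [avgError, noiseLawN, h]

lemma isScalingConstant_congr (h : noiseLaw p = noiseLaw p') {Δ L : ℝ} :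
    IsScalingConstant p Δ L ↔ IsScalingConstant p' Δ L := by
  simp only [IsScalingConstant, maxLogMsg, Code.isCovert_congr h, Code.avgError_congr h]

lemma scalingConstant_congr (h : p =ᵐ[volume] p') : scalingConstant p = scalingConstant p' := by
  have hsurprisal : surprisal p =ᵐ[noiseLaw p'] surprisal p' :=
    (withDensity_absolutelyContinuous _ _).ae_le (h.fun_comp (-Real.log ·))
  rw [scalingConstant, scalingConstant, noiseLaw_congr h, variance_congr hsurprisal]

lemma scalingConstant_eq (p : ℝ → ℝ) :
    scalingConstant p = √2 * √(Var[fun z => Real.log (p z); noiseLaw p]) := by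
  rw [scalingConstant, ← variance_fun_neg]
  simp only [surprisal, neg_neg]

lemma IsPDF.exists_regularDensity (hp : IsPDF p) {b ζ : ℝ} (hb : ∀ z, p z ≤ b) (hζ0 : 0 < ζ)
    (hζ1 : ζ < 1) (hζ : Integrable fun z => p z ^ ζ) :
    ∃ p', RegularDensity p' (max b 1) ζ ∧ p =ᵐ[volume] p' := by
  obtain ⟨k, hk, hpk⟩ := hp.integrable.aemeasurable
  have hae : p =ᵐ[volume] fun z => max 0 (min (max b 1) (k z)) := by
    filter_upwards [hpk] with z hz
    rw [← hz, min_eq_right ((hb z).trans (le_max_left _ _)), max_eq_right (hp.nonneg z)]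
  exact ⟨_,
    { measurable := by fun_prop
      nonneg := fun z => le_max_left _ _
      integrable := hp.integrable.congr hae
      integral_eq_one := (integral_congr_ae hae).symm.trans hp.integral_eq_one
      one_le := le_max_right _ _
      le_bound := fun z => max_le (zero_le_one.trans (le_max_right _ _)) (min_le_left _ _)
      pos := hζ0
      lt_one := hζ1
      integrable_rpow := hζ.congr (hae.fun_comp (· ^ ζ)) }, hae⟩

end Versions

end CovertChannel

end

open CovertChannel in
theorem proposition1_general {p : ℝ → ℝ} (hp : IsPDF p) (hbdd : ∃ b, ∀ z, p z ≤ b)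
    (hint : ∃ ζ : ℝ, 0 < ζ ∧ ζ < 1 ∧ Integrable fun z => p z ^ ζ)
    (hdec : ∀ᶠ γ in 𝓝[>] 0, ∃ P : Measure ℝ, IsProbabilityMeasure P ∧
      P.conv (noiseLaw p) = noiseLaw (tiltedDensity p γ))
    {Δ : ℝ} (hΔ : 0 < Δ) :
    ∃ L : ℝ,
      IsScalingConstant p Δ L ∧
      L = √2 * √(Var[fun z => Real.log (p z); noiseLaw p]) ∧
      ∃ C : (n : ℕ) → Code n,
        (∀ n, (C n).IsCovert p Δ) ∧
        Tendsto (fun n => (C n).avgError p) atTop (𝓝 0) ∧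
        Tendsto (fun n : ℕ => Real.log (C n).numMsg / √(n * Δ)) atTop (𝓝 L) ∧
        (fun n => Real.log (C n).numKey) =O[atTop] fun n : ℕ => (n : ℝ) := by
  obtain ⟨b, hb⟩ := hbdd
  obtain ⟨ζ, hζ0, hζ1, hζ⟩ := hint
  obtain ⟨p', hreg, hae⟩ := hp.exists_regularDensity hb hζ0 hζ1 hζ
  have hlaw := noiseLaw_congr hae
  simp only [hlaw, noiseLaw_congr (tiltedDensity_ae_eq hae _)] at hdec
  obtain ⟨C, hcov, herr, hmsg, hkey⟩ := hreg.exists_code_sequence hdec hΔ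
  refine ⟨scalingConstant p, ?_, scalingConstant_eq p, C,
    fun n => ((C n).isCovert_congr hlaw).2 (hcov n), ?_, ?_, hkey⟩
  · rw [scalingConstant_congr hae, isScalingConstant_congr hlaw]
    exact hreg.isScalingConstant hdec hΔ
  · simpa only [Code.avgError_congr hlaw] using herr
  · rwa [scalingConstant_congr hae]

/-- There is a number `L`, the scaling constant of the channel with value
`√2 √Var[ln p_Z(Z)]`, and a sequence of covert codes, one for each length, with vanishing average
error, `ln |M_n| / √(n Δ) → L` and key lengths `ln |K_n| = O(n)`. -/
theorem proposition1 (p : ℝ → ℝ) (hp : CovertChannel.IsPDF p)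
    (hint : CovertChannel.IntegrabilityConditions p)
    (hassum : CovertChannel.NoiseAssumption p)
    (Δ : ℝ) (hΔ : 0 < Δ) :
    ∃ L : ℝ,
      CovertChannel.IsScalingConstant p Δ L ∧
      L = Real.sqrt 2 * Real.sqrt
        (ProbabilityTheory.variance (fun z => Real.log (p z)) (CovertChannel.noiseLaw p)) ∧
      ∃ C : (n : ℕ) → CovertChannel.Code n,
        (∀ n, (C n).IsCovert p Δ) ∧
        Filter.Tendsto (fun n => (C n).avgError p) Filter.atTop (nhds 0) ∧
        Filter.Tendsto (fun n : ℕ => Real.log (C n).numMsg / Real.sqrt (n * Δ))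
          Filter.atTop (nhds L) ∧
        Asymptotics.IsBigO Filter.atTop (fun n => Real.log (C n).numKey)
          (fun n : ℕ => (n : ℝ)) := by
  obtain ⟨ζ, hζ0, hζ1, -, hζ, -⟩ := hint
  obtain ⟨b, -, hb⟩ := hassum.bounded
  obtain ⟨ξ, hξ, -, hdec⟩ := hassum.decomposable
  exact proposition1_general hp ⟨b, hb⟩ ⟨ζ, hζ0, hζ1, hζ⟩
    (mem_of_superset (Ioo_mem_nhdsGT hξ) fun γ hγ => hdec γ hγ.1.le hγ.2) hΔ
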